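/- A finite Bayesian game consists of players $N=\{1,\dots,n\}$ ($n\ge 1$), finite non-empty type sets $\Theta_i$ and action sets $A_i$, a common prior $\rho\in\Delta(\Theta)$ on $\Theta=\prod_i\Theta_i$ (possibly correlated), and utilities $v_i\colon\Theta\times A\to[0,1]$, where $A=\prod_i A_i$. A type-wise distribution $\pi\in\Delta(A)^\Theta$ assigns a distribution $\pi(\theta)\in\Delta(A)$ to each $\theta\in\Theta$. It is an $\epsilon$-approximate communication equilibrium if for all $i\in N$, $\psi\colon\Theta_i\to\Theta_i$ and $\phi\colon\Theta_i\times A_i\to A_i$, $$\mathop{\mathbb E}_{\theta\sim\rho}\Big[\mathop{\mathbb E}_{a\sim\pi(\theta)}[v_i(\theta;a)]\Big]\ \ge\ \mathop{\mathbb E}_{\theta\sim\rho}\Big[\mathop{\mathbb E}_{a\sim\pi(\psi(\theta_i),\theta_{-i})}[v_i(\theta;\phi(\theta_i,a_i),a_{-i})]\Big]-\epsilon .$$ It is strategy-representable if there is a distribution $\sigma$ on the set $S=\prod_i A_i^{\Theta_i}$ of strategy profiles such that $\pi(\theta;a)=\Pr_{s\sim\sigma}(s(\theta)=a)$ for all $\theta\in\Theta$,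 $a\in A$, where $s(\theta)=(s_i(\theta_i))_{i\in N}$. A succinct representation of $\pi$ is an integer $T\ge 1$ together with distributions $\pi_i^t(\theta_i)\in\Delta(A_i)$ for all $t\in\{1,\dots,T\}$, $i\in N$, $\theta_i\in\Theta_i$, listed explicitly, such that $\pi(\theta;a)=\frac1T\sum_{t=1}^T\prod_{i\in N}\pi_i^t(\theta_i;a_i)$ for all $\theta\in\Theta$, $a\in A$. An algorithm is a randomized real-RAM program: it uses exact real arithmetic ($+,-,\times,/$, comparison) and addition, (truncated) subtraction and comparison of natural numbers, all at unit cost, and fair coin tosses. Its memory consists of arrays of naturals and of reals, and its program constants are natural numbers. It accesses the game through unit-cost oracles which (a) return $v_i(\theta;a)$ for given $i,\theta,a$; (b) sample $\theta_i$ from the marginal $\rho_i$ of $\rho$ for given $i$; (c) sample $\theta_{-i}$ from $\rho$ conditioned on a given $\theta_i$ (the answers follow an arbitrary fixed law if $\rho_i(\theta_i)=0$). All answers of the sampling oracles and all coin tosses are independent. There exists a single algorithm and a polynomial $P$ such that, for every finite Bayesian game, every $\epsilon>0$ and every $\delta\in(0,1)$, on input $n$, $(|\Theta_i|)_{i\in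 N}$, $(|A_i|)_{i\in N}$, $\epsilon$, $\delta$ and with these oracles, the algorithm always halts within $$P\Big(n,\ \max_{i\in N}|\Theta_i|,\ \max_{i\in N}|A_i|,\ \tfrac1\epsilon,\ \log\tfrac1\delta\Big)$$ steps, and with probability at least $1-\delta$ it outputs a succinct representation of an $\epsilon$-approximate communication equilibrium that is strategy-representable. -/

import Mathlib

open scoped BigOperators ENNReal

noncomputable section

namespace CommEq

/-! ### Bayesian games -/

/-- A finite Bayesian game with player set `Fin n`. Player `i` has the types
`Fin (numTypes i)` and the actions `Fin (numActions i)`; `prior` is the common prior on type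
profiles, possibly correlated (its existence forces every `numTypes i` to be positive). -/
structure BayesianGame (n : ℕ) where
  numTypes : Fin n → ℕ
  numActions : Fin n → ℕ
  numActions_pos : ∀ i, 0 < numActions i
  prior : PMF (∀ i, Fin (numTypes i))
  utility : Fin n → (∀ i, Fin (numTypes i)) → (∀ i, Fin (numActions i)) → ℝ
  utility_mem : ∀ i θ a, utility i θ a ∈ Set.Icc (0 : ℝ) 1

namespace BayesianGame

variable {n : ℕ} (G : BayesianGame n)

/-- Type profiles `Θ`. -/
abbrev Types : Type := ∀ i, Fin (G.numTypes i)

/-- Action profiles `A`. -/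
abbrev Actions : Type := ∀ i, Fin (G.numActions i)

/-- Strategy profiles `S`: every player chooses an action for each of their types. -/
abbrev Strategies : Type := ∀ i, Fin (G.numTypes i) → Fin (G.numActions i)

/-- `π` is a type-wise distribution, an element of `Δ(A)^Θ`. -/
def IsTypewise (π : G.Types → G.Actions → ℝ) : Prop :=
  ∀ θ, π θ ∈ stdSimplex ℝ G.Actions

/-- `π` is induced by some distribution `σ ∈ Δ(S)`: `π(θ; a) = Pr_{s ∼ σ} (s(θ) = a)`. -/
def StrategyRepresentable (π : G.Types → G.Actions → ℝ) : Prop :=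
  ∃ σ ∈ stdSimplex ℝ G.Strategies, ∀ (θ : G.Types) (a : G.Actions),
    π θ a = ∑ s : G.Strategies, if (fun i => s i (θ i)) = a then σ s else 0

/-- The expected payoff of player `i` when the others report truthfully and obey, while `i`
reports `ψ(θ_i)` instead of `θ_i` and plays `φ(θ_i, a_i)` instead of the recommended `a_i`. -/
def deviationPayoff (π : G.Types → G.Actions → ℝ) (i : Fin n)
    (ψ : Fin (G.numTypes i) → Fin (G.numTypes i))
    (φ : Fin (G.numTypes i) → Fin (G.numActions i) → Fin (G.numActions i)) : ℝ :=
  ∑ θ : G.Types, (G.prior θ).toReal *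
    ∑ a : G.Actions, π (Function.update θ i (ψ (θ i))) a *
      G.utility i θ (Function.update a i (φ (θ i) (a i)))

/-- The expected payoff of player `i` under truthful reports and obedience. -/
def payoff (π : G.Types → G.Actions → ℝ) (i : Fin n) : ℝ :=
  ∑ θ : G.Types, (G.prior θ).toReal * ∑ a : G.Actions, π θ a * G.utility i θ a

/-- `ε`-approximate communication equilibria. -/
def IsApproxCommEq (ε : ℝ) (π : G.Types → G.Actions → ℝ) : Prop :=
  G.IsTypewise π ∧ ∀ (i : Fin n) (ψ : Fin (G.numTypes i) → Fin (G.numTypes i))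
    (φ : Fin (G.numTypes i) → Fin (G.numActions i) → Fin (G.numActions i)),
    G.payoff π i ≥ G.deviationPayoff π i ψ φ - ε

/-- `κ i t` is the law of the answers of the oracle asked to sample the types of the other
players conditioned on player `i` having type `t`. It is the conditional distribution of the
prior whenever `t` has positive probability. Nothing is required for the other `t`, where the
conditional distribution is undefined. (The `i`-th coordinate of an answer is never read.) -/
def IsConditionalSampler (κ : ∀ i : Fin n, Fin (G.numTypes i) → PMF G.Types) : Prop :=
  ∀ (i : Fin n) (t : Fin (G.numTypes i))
    (h : ∃ θ ∈ {θ : G.Types | θ i = t}, θ ∈ G.prior.support),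
    κ i t = G.prior.filter {θ : G.Types | θ i = t} h

end BayesianGame

/-! ### Randomized real-RAM programs with oracles

The memory consists of natural-number cells and real cells. A cell is addressed by the name of an
array and a tuple of indices; scalars are the cells with the empty tuple. Naturals can be added,
subtracted (with truncation) and compared; reals can be added, subtracted, multiplied, divided
(with `x / 0 = 0`) and compared exactly. There is no rounding of reals to naturals and the only
constants in a program are naturals. -/

/-- The content of the memory. -/
structure State where
  int : ℕ → List ℕ → ℕ
  real : ℕ → List ℕ → ℝ

namespace State

/-- Write `v` to the natural-number cell `(x, l)`. -/
def setInt (s : State) (x : ℕ) (l : List ℕ) (v : ℕ) : State :=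
  { s with int := fun y m => if y = x ∧ m = l then v else s.int y m }

/-- Write `v` to the real cell `(x, l)`. -/
def setReal (s : State) (x : ℕ) (l : List ℕ) (v : ℝ) : State :=
  { s with real := fun y m => if y = x ∧ m = l then v else s.real y m }

end State

/-- Natural-number expressions; `cell x d idx` is the entry of the array `x` at the index tuple
`idx` of length `d`. -/
inductive IExp where
  | lit (k : ℕ)
  | cell (x : ℕ) (d : ℕ) (idx : Fin d → IExp)
  | add (e f : IExp)
  | sub (e f : IExp)

def IExp.eval (s : State) : IExp → ℕ
  | .lit k => k
  | .cell x _ idx => s.int x (List.ofFn fun j => (idx j).eval s)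
  | .add e f => e.eval s + f.eval s
  | .sub e f => e.eval s - f.eval s

/-- Real expressions. -/
inductive RExp where
  | ofInt (e : IExp)
  | cell (x : ℕ) (d : ℕ) (idx : Fin d → IExp)
  | add (e f : RExp)
  | sub (e f : RExp)
  | mul (e f : RExp)
  | div (e f : RExp)

def RExp.eval (s : State) : RExp → ℝ
  | .ofInt e => (e.eval s : ℝ)
  | .cell x _ idx => s.real x (List.ofFn fun j => (idx j).eval s)
  | .add e f => e.eval s + f.eval s
  | .sub e f => e.eval s - f.eval s
  | .mul e f => e.eval s * f.eval s
  | .div e f => e.eval s / f.eval s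

/-- Tests: comparison of naturals or of reals. -/
inductive Test where
  | intLt (e f : IExp)
  | realLt (e f : RExp)

def Test.holds (s : State) : Test → Prop
  | .intLt e f => e.eval s < f.eval s
  | .realLt e f => e.eval s < f.eval s

/-- Programs. -/
inductive Cmd where
  /-- assign to a natural-number cell -/
  | setInt (x : ℕ) (d : ℕ) (idx : Fin d → IExp) (e : IExp)
  /-- assign to a real cell -/
  | setReal (x : ℕ) (d : ℕ) (idx : Fin d → IExp) (e : RExp)
  /-- toss a fair coin and store `0` or `1` in the natural-number scalar `x` -/
  | coin (x : ℕ)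
  /-- utility oracle: store in the real scalar `r` the payoff of player `i` at the type profile
  and the action profile written in the natural-number arrays `θ` and `a` -/
  | utility (r : ℕ) (i : IExp) (θ a : ℕ)
  /-- sample the type of player `i` from its marginal law, into the natural-number scalar `x` -/
  | sampleType (x : ℕ) (i : IExp)
  /-- sample the types of the players `j ≠ i` conditioned on player `i` having type `t`, into
  the cells `(x, [j])` of the natural-number array `x` -/
  | sampleOthers (x : ℕ) (i t : IExp)
  | seq (c d : Cmd)
  | branch (b : Test) (c d : Cmd)
  | loop (b : Test) (c : Cmd)

/-- A machine configuration: the commands that remain to be executed, and the memory. The machine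
has halted when no command is left. -/
abbrev Config : Type := List Cmd × State

section Execution

variable {n : ℕ} (G : BayesianGame n) (κ : ∀ i : Fin n, Fin (G.numTypes i) → PMF G.Types)

open Classical in
/-- The answer to a utility query (`0` for an ill-formed one). -/
def utilityAnswer (s : State) (i θ a : ℕ) : ℝ :=
  if h : i < n ∧ (∀ j : Fin n, s.int θ [(j : ℕ)] < G.numTypes j) ∧
      (∀ j : Fin n, s.int a [(j : ℕ)] < G.numActions j) then
    G.utility ⟨i, h.1⟩ (fun j => ⟨s.int θ [(j : ℕ)], h.2.1 j⟩)
      (fun j => ⟨s.int a [(j : ℕ)], h.2.2 j⟩)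
  else 0

/-- Write the types `θ_j`, `j ≠ i`, to the cells `(x, [j])`. -/
def writeOthers (s : State) (x : ℕ) (i : Fin n) (θ : G.Types) : State :=
  { s with
    int := fun y l =>
      match l with
      | [j] => if h : j < n then (if y = x ∧ j ≠ (i : ℕ) then (θ ⟨j, h⟩ : ℕ) else s.int y [j])
          else s.int y [j]
      | l => s.int y l }

open Classical in
/-- One step of execution. Each command that is executed (an assignment, a coin toss, an oracle
call, the evaluation of a test, the unfolding of a composition) takes one step; as expressions
and index tuples occurring in a fixed program have bounded size, this amounts to a bounded number
of elementary operations. Ill-formed sampling requests have no effect. -/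
def step : Config → PMF Config
  | ([], s) => PMF.pure ([], s)
  | (.setInt x _ idx e :: k, s) =>
      PMF.pure (k, s.setInt x (List.ofFn fun j => (idx j).eval s) (e.eval s))
  | (.setReal x _ idx e :: k, s) =>
      PMF.pure (k, s.setReal x (List.ofFn fun j => (idx j).eval s) (e.eval s))
  | (.coin x :: k, s) =>
      (PMF.uniformOfFintype (Fin 2)).map fun b => (k, s.setInt x [] (b : ℕ))
  | (.utility r i θ a :: k, s) =>
      PMF.pure (k, s.setReal r [] (utilityAnswer G s (i.eval s) θ a))
  | (.sampleType x i :: k, s) =>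
      if h : i.eval s < n then
        G.prior.map fun θ => (k, s.setInt x [] (θ ⟨i.eval s, h⟩ : ℕ))
      else PMF.pure (k, s)
  | (.sampleOthers x i t :: k, s) =>
      if h : ∃ h : i.eval s < n, t.eval s < G.numTypes ⟨i.eval s, h⟩ then
        (κ ⟨i.eval s, h.1⟩ ⟨t.eval s, h.2⟩).map fun θ =>
          (k, writeOthers G s x ⟨i.eval s, h.1⟩ θ)
      else PMF.pure (k, s)
  | (.seq c d :: k, s) => PMF.pure (c :: d :: k, s)
  | (.branch b c d :: k, s) => PMF.pure (if b.holds s then (c :: k, s) else (d :: k, s))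
  | (.loop b c :: k, s) =>
      PMF.pure (if b.holds s then (c :: .loop b c :: k, s) else (k, s))

/-- The law of the configuration after the given number of steps; the answers of the sampling
oracles and the coin tosses are independent. -/
def run : ℕ → Config → PMF Config
  | 0, c => PMF.pure c
  | t + 1, c => (step G κ c).bind (run t)

/-- The input: the natural-number scalar `0` holds `n`, the natural-number arrays `1` and `2` hold
the numbers of types and of actions of the players, the real scalars `0` and `1` hold `ε` and `δ`.
All other cells are zero. -/
def inputState (ε δ : ℝ) : State where
  int x l :=
    match x, l with
    | 0, [] => n
    | 1, [i] => if h : i < n then G.numTypes ⟨i, h⟩ else 0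
    | 2, [i] => if h : i < n then G.numActions ⟨i, h⟩ else 0
    | _, _ => 0
  real x l :=
    match x, l with
    | 0, [] => ε
    | 1, [] => δ
    | _, _ => 0

/-- The output. The natural-number scalar `3` holds a number `T ≥ 1`, and for every `t < T` the
real cells `(2, [t, i, θ_i, a_i])` hold distributions `π_i^t(θ_i) ∈ Δ(A_i)`. The output succinctly
represents the type-wise distribution `π(θ; a) = (1 / T) ∑_t ∏_i π_i^t(θ_i; a_i)`. -/
def OutputRepresents (s : State) (π : G.Types → G.Actions → ℝ) : Prop :=
  0 < s.int 3 [] ∧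
  (∀ t < s.int 3 [], ∀ (i : Fin n) (θi : Fin (G.numTypes i)),
    (fun ai : Fin (G.numActions i) => s.real 2 [t, (i : ℕ), (θi : ℕ), (ai : ℕ)]) ∈
      stdSimplex ℝ (Fin (G.numActions i))) ∧
  ∀ (θ : G.Types) (a : G.Actions),
    π θ a = (1 / (s.int 3 [] : ℝ)) * ∑ t ∈ Finset.range (s.int 3 []),
      ∏ i : Fin n, s.real 2 [t, (i : ℕ), (θ i : ℕ), (a i : ℕ)]

/-- The machine has halted, and its output represents an `ε`-approximate communication
equilibrium that is strategy-representable. -/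
def Succeeds (ε : ℝ) (c : Config) : Prop :=
  c.1 = [] ∧ ∃ π : G.Types → G.Actions → ℝ,
    OutputRepresents G c.2 π ∧ G.IsApproxCommEq ε π ∧ G.StrategyRepresentable π

end Execution

end CommEq

end

/-!
The algorithm simulates learning dynamics in which no player regrets anything, and outputs the
sequence of the strategies that are played. With an accuracy parameter `H`, polynomial in the size
of the game, `1 / ε` and `log (1 / δ)`, there are `H ^ 4` rounds.

*Equilibrium.* Let every player `i`, for every type `θ`, compare the strategies played with all
deviations of the form "report `θ'`, and play `φ a'` when recommended `a'`". If no such deviation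
gains more than a small amount on average, then the mixture of the played product profiles is an
approximate communication equilibrium: its deviation payoff is the average, over the types of `i`,
of conditional payoffs given the type, and these are exactly what the conditional sampling oracle
gives access to (`deviationPayoff_indep`, `isApproxCommEq_mixture`). A product profile is induced
by a product distribution on strategy profiles, so the mixture is strategy-representable
(`strategyRepresentable_mixture`).

*Regret.* There are exponentially many maps `φ`, but if the multiplicative weight of a deviation is
chosen as a product over the recommendations `a'`, then the sum of the weights over all `φ` is a
product of sums, and the random deviation in proportion to the weights is computed in polynomial
time (`wtReport`, `wtKernel`). When a player plays a fixed point of this random deviation, the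
payoff of the deviation is the payoff of playing, and the usual potential argument bounds the
regret (`regret_le`). The average of the first `H` iterates of the deviation is sufficiently close
to a fixed point (`IsDeviation.almost_fixed`).

*Sampling.* The conditional payoffs of a round are estimated from `H ^ 4` samples. The only source
of randomness besides the oracles is a fair coin, so the strategies are first rounded to multiples
of `1 / 2 ^ k`; an action is then drawn exactly from the rounded strategy by `k` coin tosses
(`sum_draw`). The estimates of different rounds depend on each other through the dynamics, but
given the past, each estimate fails with exponentially small probability (`iterExp_sample_bad_le`),
and the union bound suffices (`total_missProb_le`).

*Programs.* A program is analysed through its weakest pre-expectation `wp` with respect to a step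
bound. Three kinds of assertions are derived from it: `Det` for certain outcomes, `Rand` for
outcomes with a known law, and `Fail` for outcomes that are good except with a given probability.
Each contains the assertion that the program halts within the step bound (`Fail.run`). The
deterministic computations are compiled from expressions with bounded sums and products (`BigExp`,
`fill`), which are verified once and for all.
-/

open scoped BigOperators ENNReal

noncomputable section

namespace CommEq

/-! ### Expectations and a pre-expectation calculus -/

/-- The expectation of a nonnegative function under a discrete law. -/
def mean {α : Type*} (μ : PMF α) (g : α → ℝ≥0∞) : ℝ≥0∞ := ∑' a, μ a * g a

section mean

variable {α β : Type*}

lemma mean_pure (a : α) (g : α → ℝ≥0∞) : mean (PMF.pure a) g = g a := by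
  classical
  unfold mean
  rw [tsum_eq_single a]
  · simp
  · intro b hb
    simp [PMF.pure_apply, hb]

lemma mean_bind (μ : PMF α) (ν : α → PMF β) (g : β → ℝ≥0∞) :
    mean (μ.bind ν) g = mean μ fun a => mean (ν a) g := by
  unfold mean
  simp only [PMF.bind_apply, ← ENNReal.tsum_mul_right, ← ENNReal.tsum_mul_left]
  rw [ENNReal.tsum_comm]
  simp only [mul_assoc]

lemma mean_map (μ : PMF α) (h : α → β) (g : β → ℝ≥0∞) :
    mean (μ.map h) g = mean μ fun a => g (h a) := by
  rw [PMF.map, mean_bind]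
  simp [mean_pure]

lemma mean_mono (μ : PMF α) {g g' : α → ℝ≥0∞} (h : ∀ a, g a ≤ g' a) : mean μ g ≤ mean μ g' :=
  ENNReal.tsum_le_tsum fun a => mul_le_mul_right (h a) _

lemma mean_fintype [Fintype α] (μ : PMF α) (g : α → ℝ≥0∞) : mean μ g = ∑ a, μ a * g a :=
  tsum_fintype _

end mean

section Calculus

variable {n : ℕ} (G : BayesianGame n) (κ : ∀ i : Fin n, Fin (G.numTypes i) → PMF G.Types)

/-- The expected value of `F` at the configuration reached after `τ` steps. -/
def expect (τ : ℕ) (c : Config) (F : Config → ℝ≥0∞) : ℝ≥0∞ := mean (run G κ τ c) F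

lemma expect_zero (c : Config) (F : Config → ℝ≥0∞) : expect G κ 0 c F = F c :=
  mean_pure _ _

lemma expect_succ (τ : ℕ) (c : Config) (F : Config → ℝ≥0∞) :
    expect G κ (τ + 1) c F = mean (step G κ c) fun d => expect G κ τ d F :=
  mean_bind _ _ _

lemma expect_nil (τ : ℕ) (s : State) (F : Config → ℝ≥0∞) :
    expect G κ τ ([], s) F = F ([], s) := by
  induction τ with
  | zero => exact expect_zero G κ _ _
  | succ τ ih => rw [expect_succ, step, mean_pure, ih]

/-- The weakest pre-expectation of `f` with respect to the command `c` and the step bound `B`: the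
least upper bound that the hypothesis "whatever remains to be executed after `c` has expected
value at most `f` of the memory, if at most `B` steps have been spent" gives for the expected
value before the execution of `c`. A finite bound on `wp` therefore contains the assertion that `c`
terminates within `B` steps. -/
def wp (c : Cmd) (B : ℕ) (f : State → ℝ≥0∞) (s : State) : ℝ≥0∞ :=
  ⨆ (k : List Cmd) (F : Config → ℝ≥0∞) (τ : ℕ) (_ : B ≤ τ)
    (_ : ∀ τ' s', τ ≤ τ' + B → expect G κ τ' (k, s') F ≤ f s'), expect G κ τ (c :: k, s) F

variable {G κ}

lemma wp_le {c : Cmd} {B : ℕ} {f : State → ℝ≥0∞} {s : State} {r : ℝ≥0∞}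
    (h : ∀ (k : List Cmd) (F : Config → ℝ≥0∞) (τ : ℕ), B ≤ τ →
      (∀ τ' s', τ ≤ τ' + B → expect G κ τ' (k, s') F ≤ f s') →
        expect G κ τ (c :: k, s) F ≤ r) : wp G κ c B f s ≤ r := by
  simp only [wp, iSup_le_iff]
  exact h

lemma le_wp {c : Cmd} {B : ℕ} {f : State → ℝ≥0∞} {s : State} (k : List Cmd)
    (F : Config → ℝ≥0∞) (τ : ℕ) (hB : B ≤ τ)
    (hF : ∀ τ' s', τ ≤ τ' + B → expect G κ τ' (k, s') F ≤ f s') :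
    expect G κ τ (c :: k, s) F ≤ wp G κ c B f s := by
  unfold wp
  exact le_iSup_of_le k (le_iSup_of_le F (le_iSup_of_le τ (le_iSup_of_le hB
    (le_iSup_of_le hF le_rfl))))

lemma wp_mono {c : Cmd} {B B' : ℕ} {f f' : State → ℝ≥0∞} {s : State} (hB : B ≤ B')
    (hf : ∀ s', f s' ≤ f' s') : wp G κ c B' f s ≤ wp G κ c B f' s :=
  wp_le fun k F τ hτ hF => le_wp k F τ (hB.trans hτ) fun τ' s' h =>
    (hF τ' s' (by omega)).trans (hf s')

/-- A command whose execution is a single random assignment. -/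
lemma wp_of_step {c : Cmd} {s : State} {α : Type*} (μ : PMF α) (g : α → State)
    (h : ∀ k, step G κ (c :: k, s) = μ.map fun a => (k, g a)) (f : State → ℝ≥0∞) :
    wp G κ c 1 f s ≤ mean μ fun a => f (g a) := by
  refine wp_le fun k F τ hτ hF => ?_
  obtain ⟨τ, rfl⟩ : ∃ t, τ = t + 1 := ⟨τ - 1, by omega⟩
  rw [expect_succ, h, mean_map]
  exact mean_mono _ fun a => hF _ _ le_rfl

lemma wp_of_step_pure {c : Cmd} {s s' : State}
    (h : ∀ k, step G κ (c :: k, s) = PMF.pure (k, s')) (f : State → ℝ≥0∞) :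
    wp G κ c 1 f s ≤ f s' := by
  have := wp_of_step (G := G) (κ := κ) (c := c) (s := s) (PMF.pure ()) (fun _ => s')
    (fun k => by rw [h, PMF.pure_map]) f
  rwa [mean_pure] at this

/-- The basic rule of the calculus: `wp` of a composition is the composition of the `wp`s. -/
lemma wp_seq (c d : Cmd) (B₁ B₂ : ℕ) (f : State → ℝ≥0∞) (s : State) :
    wp G κ (.seq c d) (B₁ + B₂ + 1) f s ≤ wp G κ c B₁ (wp G κ d B₂ f) s := by
  refine wp_le fun k F τ hτ hF => ?_
  obtain ⟨τ, rfl⟩ : ∃ t, τ = t + 1 := ⟨τ - 1, by omega⟩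
  rw [expect_succ, step, mean_pure]
  exact le_wp _ F τ (by omega) fun τ' s' h =>
    le_wp k F τ' (by omega) fun τ'' s'' h' => hF _ _ (by omega)

lemma wp_branch_pos {b : Test} {s : State} (hb : b.holds s) (c d : Cmd) (B : ℕ)
    (f : State → ℝ≥0∞) : wp G κ (.branch b c d) (B + 1) f s ≤ wp G κ c B f s := by
  refine wp_le fun k F τ hτ hF => ?_
  obtain ⟨τ, rfl⟩ : ∃ t, τ = t + 1 := ⟨τ - 1, by omega⟩
  rw [expect_succ, step, mean_pure, if_pos hb]
  exact le_wp _ F τ (by omega) fun τ' s' h => hF _ _ (by omega)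

lemma wp_branch_neg {b : Test} {s : State} (hb : ¬ b.holds s) (c d : Cmd) (B : ℕ)
    (f : State → ℝ≥0∞) : wp G κ (.branch b c d) (B + 1) f s ≤ wp G κ d B f s := by
  refine wp_le fun k F τ hτ hF => ?_
  obtain ⟨τ, rfl⟩ : ∃ t, τ = t + 1 := ⟨τ - 1, by omega⟩
  rw [expect_succ, step, mean_pure, if_neg hb]
  exact le_wp _ F τ (by omega) fun τ' s' h => hF _ _ (by omega)

lemma wp_loop_neg {b : Test} {s : State} (hb : ¬ b.holds s) (c : Cmd) (f : State → ℝ≥0∞) :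
    wp G κ (.loop b c) 1 f s ≤ f s :=
  wp_of_step_pure (fun k => by rw [step, if_neg hb]) f

lemma wp_loop_pos {b : Test} {s : State} (hb : b.holds s) (c : Cmd) (B₁ B₂ : ℕ)
    (f : State → ℝ≥0∞) :
    wp G κ (.loop b c) (B₁ + B₂ + 1) f s ≤ wp G κ c B₁ (wp G κ (.loop b c) B₂ f) s := by
  refine wp_le fun k F τ hτ hF => ?_
  obtain ⟨τ, rfl⟩ : ∃ t, τ = t + 1 := ⟨τ - 1, by omega⟩
  rw [expect_succ, step, mean_pure, if_pos hb]
  exact le_wp _ F τ (by omega) fun τ' s' h =>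
    le_wp k F τ' (by omega) fun τ'' s'' h' => hF _ _ (by omega)

variable (G κ)

/-! ### Triples for certain, random and fallible execution -/

/-- Started in the memory `s`, the command `c` halts within `B` steps, certainly in a memory
satisfying `Q`. -/
def Det (c : Cmd) (s : State) (B : ℕ) (Q : State → Prop) : Prop :=
  ∀ (f : State → ℝ≥0∞) (r : ℝ≥0∞), (∀ s', Q s' → f s' ≤ r) → wp G κ c B f s ≤ r

/-- Started in the memory `s`, the command `c` halts within `B` steps, and draws an outcome `a`
whose expectation functional is dominated by `E`; the final memory is related to the outcome
by `Q`. -/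
def Rand {α : Type*} (c : Cmd) (s : State) (B : ℕ) (E : (α → ℝ≥0∞) → ℝ≥0∞)
    (Q : α → State → Prop) : Prop :=
  ∀ (f : State → ℝ≥0∞) (g : α → ℝ≥0∞), (∀ a s', Q a s' → f s' ≤ g a) → wp G κ c B f s ≤ E g

/-- Started in the memory `s`, the command `c` halts within `B` steps, certainly in a memory
satisfying `Q`, and except with probability at most `p` this memory satisfies `R` as well. -/
def Fail (c : Cmd) (s : State) (B : ℕ) (Q R : State → Prop) (p : ℝ≥0∞) : Prop :=
  ∀ (f : State → ℝ≥0∞) (r : ℝ≥0∞), (∀ s', Q s' → f s' ≤ r + 1) →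
    (∀ s', Q s' → R s' → f s' ≤ r) → wp G κ c B f s ≤ r + p

variable {G κ}

lemma Det.mono {c : Cmd} {s : State} {B B' : ℕ} {Q Q' : State → Prop} (h : Det G κ c s B Q)
    (hB : B ≤ B') (hQ : ∀ s', Q s' → Q' s') : Det G κ c s B' Q' :=
  fun f r hf => (wp_mono hB fun _ => le_rfl).trans (h f r fun s' hs => hf s' (hQ s' hs))

lemma Rand.mono {α : Type*} {c : Cmd} {s : State} {B B' : ℕ} {E : (α → ℝ≥0∞) → ℝ≥0∞}
    {Q Q' : α → State → Prop} (h : Rand G κ c s B E Q) (hB : B ≤ B')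
    (hQ : ∀ a s', Q a s' → Q' a s') : Rand G κ c s B' E Q' :=
  fun f g hf => (wp_mono hB fun _ => le_rfl).trans (h f g fun a s' hs => hf a s' (hQ a s' hs))

lemma Fail.mono {c : Cmd} {s : State} {B B' : ℕ} {Q Q' R R' : State → Prop} {p p' : ℝ≥0∞}
    (h : Fail G κ c s B Q R p) (hB : B ≤ B') (hQ : ∀ s', Q s' → Q' s')
    (hR : ∀ s', Q s' → R s' → R' s') (hp : p ≤ p') : Fail G κ c s B' Q' R' p' :=
  fun f r h₁ h₂ => ((wp_mono hB fun _ => le_rfl).trans (h f r (fun s' hs => h₁ s' (hQ s' hs))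
    fun s' hs hs' => h₂ s' (hQ s' hs) (hR s' hs hs'))).trans (by gcongr)

/-- An experiment with a known law fails with the probability that its outcome is bad. -/
lemma Rand.fail {α : Type*} {c : Cmd} {s : State} {B : ℕ} {E : (α → ℝ≥0∞) → ℝ≥0∞}
    {P : α → State → Prop} (h : Rand G κ c s B E P) {Q R : State → Prop} (bad : α → Prop)
    [DecidablePred bad] (hQ : ∀ a s', P a s' → Q s') (hR : ∀ a s', P a s' → ¬ bad a → R s')
    {p : ℝ≥0∞} (hp : ∀ r : ℝ≥0∞, E (fun a => r + if bad a then 1 else 0) ≤ r + p) :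
    Fail G κ c s B Q R p := by
  intro f r h₁ h₂
  refine (h f (fun a => r + if bad a then 1 else 0) fun a s' hs => ?_).trans (hp r)
  by_cases hb : bad a
  · simpa [hb] using h₁ s' (hQ a s' hs)
  · simpa [hb] using h₂ s' (hQ a s' hs) (hR a s' hs hb)

lemma Det.seq {c d : Cmd} {s : State} {B₁ B₂ : ℕ} {Q Q' : State → Prop}
    (h₁ : Det G κ c s B₁ Q) (h₂ : ∀ s', Q s' → Det G κ d s' B₂ Q') :
    Det G κ (.seq c d) s (B₁ + B₂ + 1) Q' :=
  fun f r hf => (wp_seq c d B₁ B₂ f s).trans (h₁ _ r fun s' hs => h₂ s' hs f r hf)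

/-- The expectation functionals of successive experiments are composed. -/
lemma Rand.seq {α β : Type*} {c d : Cmd} {s : State} {B₁ B₂ : ℕ} {E : (α → ℝ≥0∞) → ℝ≥0∞}
    {E' : α → (β → ℝ≥0∞) → ℝ≥0∞} {Q : α → State → Prop} {Q' : β → State → Prop}
    (h₁ : Rand G κ c s B₁ E Q) (h₂ : ∀ a s', Q a s' → Rand G κ d s' B₂ (E' a) Q') :
    Rand G κ (.seq c d) s (B₁ + B₂ + 1) (fun g => E fun a => E' a g) Q' :=
  fun f g hf => (wp_seq c d B₁ B₂ f s).trans (h₁ _ _ fun a s' hs => h₂ a s' hs f g hf)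

lemma Det.seq_rand {β : Type*} {c d : Cmd} {s : State} {B₁ B₂ : ℕ} {E : (β → ℝ≥0∞) → ℝ≥0∞}
    {Q : State → Prop} {Q' : β → State → Prop} (h₁ : Det G κ c s B₁ Q)
    (h₂ : ∀ s', Q s' → Rand G κ d s' B₂ E Q') : Rand G κ (.seq c d) s (B₁ + B₂ + 1) E Q' :=
  fun f g hf => (wp_seq c d B₁ B₂ f s).trans (h₁ _ _ fun s' hs => h₂ s' hs f g hf)

lemma Rand.seq_det {α : Type*} {c d : Cmd} {s : State} {B₁ B₂ : ℕ} {E : (α → ℝ≥0∞) → ℝ≥0∞}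
    {Q Q' : α → State → Prop} (h₁ : Rand G κ c s B₁ E Q)
    (h₂ : ∀ a s', Q a s' → Det G κ d s' B₂ (Q' a)) : Rand G κ (.seq c d) s (B₁ + B₂ + 1) E Q' :=
  fun f _ hf => (wp_seq c d B₁ B₂ f s).trans (h₁ _ _ fun a s' hs => h₂ a s' hs f _ (hf a))

lemma Det.seq_fail {c d : Cmd} {s : State} {B₁ B₂ : ℕ} {Q Q' R' : State → Prop} {p : ℝ≥0∞}
    (h₁ : Det G κ c s B₁ Q) (h₂ : ∀ s', Q s' → Fail G κ d s' B₂ Q' R' p) :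
    Fail G κ (.seq c d) s (B₁ + B₂ + 1) Q' R' p :=
  fun f r hf hf' => (wp_seq c d B₁ B₂ f s).trans (h₁ _ _ fun s' hs => h₂ s' hs f r hf hf')

/-- The rule for loops: `Inv j` holds after `j` iterations, of which there are at most `N`. -/
lemma Det.loop {b : Test} {c : Cmd} {B N : ℕ} (Inv : ℕ → State → Prop)
    (h : ∀ j s, Inv j s → b.holds s → j < N ∧ Det G κ c s B (Inv (j + 1))) {s : State}
    (hs : Inv 0 s) :
    Det G κ (.loop b c) s (N * (B + 1) + 1) fun s' => ∃ j, Inv j s' ∧ ¬ b.holds s' := by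
  suffices H : ∀ m j s, Inv j s → N ≤ j + m →
      Det G κ (.loop b c) s (m * (B + 1) + 1) fun s' => ∃ j, Inv j s' ∧ ¬ b.holds s' from
    H N 0 s hs (by omega)
  intro m
  induction m with
  | zero =>
    intro j s hj hN f r hf
    have hb : ¬ b.holds s := fun hb => by have := (h j s hj hb).1; omega
    exact (wp_mono (by omega) fun _ => le_rfl).trans ((wp_loop_neg hb c f).trans
      (hf s ⟨j, hj, hb⟩))
  | succ m ih =>
    intro j s hj hN f r hf
    by_cases hb : b.holds s
    · have e : (m + 1) * (B + 1) + 1 = B + (m * (B + 1) + 1) + 1 := by ring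
      rw [e]
      exact (wp_loop_pos hb c B _ f).trans ((h j s hj hb).2 _ _ fun s' hs' =>
        ih (j + 1) s' hs' (by omega) f r hf)
    · exact (wp_mono (by nlinarith) fun _ => le_rfl).trans ((wp_loop_neg hb c f).trans
        (hf s ⟨j, hj, hb⟩))

end Calculus

/-! ### Assignments and counting loops -/

/-- The entry of the natural-number array `x` at the index tuple `l`. -/
def ic (x : ℕ) (l : List IExp) : IExp := .cell x l.length fun j => l.get j

/-- The entry of the real array `x` at the index tuple `l`. -/
def rc (x : ℕ) (l : List IExp) : RExp := .cell x l.length fun j => l.get j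

/-- Assignment to an entry of a natural-number array. -/
def asgInt (x : ℕ) (l : List IExp) (e : IExp) : Cmd := .setInt x l.length (fun j => l.get j) e

/-- Assignment to an entry of a real array. -/
def asgReal (x : ℕ) (l : List IExp) (e : RExp) : Cmd := .setReal x l.length (fun j => l.get j) e

/-- `for x < b do c`: the counter `x` runs through the naturals below the real number `b`. -/
def forLoop (x : ℕ) (b : RExp) (c : Cmd) : Cmd :=
  .seq (asgInt x [] (.lit 0))
    (.loop (.realLt (.ofInt (ic x [])) b) (.seq c (asgInt x [] (.add (ic x []) (.lit 1)))))

lemma ofFn_get_eval (s : State) (l : List IExp) :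
    (List.ofFn fun j => (l.get j).eval s) = l.map (IExp.eval s) := by
  conv_rhs => rw [← List.ofFn_get l, List.map_ofFn]
  rfl

@[simp] lemma eval_ic (s : State) (x : ℕ) (l : List IExp) :
    (ic x l).eval s = s.int x (l.map (IExp.eval s)) := by
  rw [ic, IExp.eval, ofFn_get_eval]

@[simp] lemma eval_rc (s : State) (x : ℕ) (l : List IExp) :
    (rc x l).eval s = s.real x (l.map (IExp.eval s)) := by
  rw [rc, RExp.eval, ofFn_get_eval]

@[simp] lemma setInt_int (s : State) (x : ℕ) (l : List ℕ) (v y : ℕ) (m : List ℕ) :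
    (s.setInt x l v).int y m = if y = x ∧ m = l then v else s.int y m := rfl

@[simp] lemma setInt_real (s : State) (x : ℕ) (l : List ℕ) (v : ℕ) :
    (s.setInt x l v).real = s.real := rfl

@[simp] lemma setReal_real (s : State) (x : ℕ) (l : List ℕ) (v : ℝ) (y : ℕ) (m : List ℕ) :
    (s.setReal x l v).real y m = if y = x ∧ m = l then v else s.real y m := rfl

@[simp] lemma setReal_int (s : State) (x : ℕ) (l : List ℕ) (v : ℝ) :
    (s.setReal x l v).int = s.int := rfl

lemma setInt_int_ne (s : State) {x y : ℕ} (h : y ≠ x) (l : List ℕ) (v : ℕ) :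
    (s.setInt x l v).int y = s.int y := by
  funext m; simp [h]

lemma setReal_real_ne (s : State) {x y : ℕ} (h : y ≠ x) (l : List ℕ) (v : ℝ) :
    (s.setReal x l v).real y = s.real y := by
  funext m; simp [h]

section Loops

variable {n : ℕ} {G : BayesianGame n} {κ : ∀ i : Fin n, Fin (G.numTypes i) → PMF G.Types}

lemma wp_asgInt (x : ℕ) (l : List IExp) (e : IExp) (f : State → ℝ≥0∞) (s : State) :
    wp G κ (asgInt x l e) 1 f s ≤ f (s.setInt x (l.map (IExp.eval s)) (e.eval s)) :=
  wp_of_step_pure (fun k => by rw [asgInt, step, ofFn_get_eval]) f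

lemma wp_asgReal (x : ℕ) (l : List IExp) (e : RExp) (f : State → ℝ≥0∞) (s : State) :
    wp G κ (asgReal x l e) 1 f s ≤ f (s.setReal x (l.map (IExp.eval s)) (e.eval s)) :=
  wp_of_step_pure (fun k => by rw [asgReal, step, ofFn_get_eval]) f

lemma det_asgInt {x : ℕ} {l : List IExp} {e : IExp} {s : State} {Q : State → Prop}
    (h : Q (s.setInt x (l.map (IExp.eval s)) (e.eval s))) : Det G κ (asgInt x l e) s 1 Q :=
  fun f _ hf => (wp_asgInt x l e f s).trans (hf _ h)

lemma det_asgReal {x : ℕ} {l : List IExp} {e : RExp} {s : State} {Q : State → Prop}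
    (h : Q (s.setReal x (l.map (IExp.eval s)) (e.eval s))) : Det G κ (asgReal x l e) s 1 Q :=
  fun f _ hf => (wp_asgReal x l e f s).trans (hf _ h)

/-- A bound for the number of steps of a counting loop with `N` iterations of at most `B` steps. -/
def forCost (N B : ℕ) : ℕ := N * (B + 3) + 3

lemma forCost_mono {N N' B B' : ℕ} (hN : N ≤ N') (hB : B ≤ B') : forCost N B ≤ forCost N' B' := by
  unfold forCost; gcongr

/-- The rule for counting loops in terms of an invariant expectation `Φ`, whose value is `⊤` where
the invariant fails to hold. -/
lemma wp_forLoop {x : ℕ} {b : RExp} {c : Cmd} {B : ℕ} (Φ : ℕ → State → ℝ≥0∞) (N : ℕ)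
    (hx : ∀ j s, Φ j s ≠ ⊤ → s.int x [] = j ∧ ⌈b.eval s⌉₊ = N)
    (hc : ∀ j s, j < N → Φ j s ≠ ⊤ →
      wp G κ c B (fun s' => Φ (j + 1) (s'.setInt x [] (s'.int x [] + 1))) s ≤ Φ j s) (s : State) :
    wp G κ (forLoop x b c) (forCost N B) (Φ N) s ≤ Φ 0 (s.setInt x [] 0) := by
  set body : Cmd := .seq c (asgInt x [] (.add (ic x []) (.lit 1)))
  set tst : Test := .realLt (.ofInt (ic x [])) b
  have H : ∀ m j s, j + m = N → wp G κ (.loop tst body) (m * (B + 3) + 1) (Φ N) s ≤ Φ j s := by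
    intro m
    induction m with
    | zero =>
      intro j s hj
      by_cases ht : Φ j s = ⊤
      · simp [ht]
      obtain ⟨h₁, h₂⟩ := hx j s ht
      obtain rfl : j = N := hj
      have hb : ¬ tst.holds s := by
        simp only [tst, Test.holds, RExp.eval, eval_ic, List.map_nil, h₁, not_lt]
        exact Nat.ceil_le.1 h₂.le
      rw [zero_mul, zero_add]
      exact wp_loop_neg hb body _
    | succ m ih =>
      intro j s hj
      by_cases ht : Φ j s = ⊤
      · simp [ht]
      obtain ⟨h₁, h₂⟩ := hx j s ht
      have hb : tst.holds s := by
        simp only [tst, Test.holds, RExp.eval, eval_ic, List.map_nil, h₁]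
        exact Nat.lt_ceil.1 (by omega)
      have e : (m + 1) * (B + 3) + 1 = (B + 1 + 1) + (m * (B + 3) + 1) + 1 := by ring
      rw [e]
      refine (wp_loop_pos hb body _ _ _).trans ((wp_mono le_rfl fun s' =>
        ih (j + 1) s' (by omega)).trans ((wp_seq _ _ _ _ _ _).trans
          ((wp_mono le_rfl fun s' => ?_).trans (hc j s (by omega) ht))))
      simpa [IExp.eval] using wp_asgInt x [] (.add (ic x []) (.lit 1)) (Φ (j + 1)) s'
  have e : forCost N B = 1 + (N * (B + 3) + 1) + 1 := by unfold forCost; ring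
  rw [e]
  refine (wp_seq _ _ _ _ _ _).trans ((wp_mono le_rfl fun s' =>
    H N 0 s' (zero_add N)).trans ?_)
  simpa [IExp.eval] using wp_asgInt (G := G) (κ := κ) x [] (.lit 0) (Φ 0) s

/-- The rule for counting loops: `Inv j` holds after `j` iterations. -/
lemma Det.forLoop {x : ℕ} {b : RExp} {c : Cmd} {B : ℕ} {s : State} (Inv : ℕ → State → Prop)
    (N : ℕ) (hx : ∀ j s, Inv j s → s.int x [] = j ∧ ⌈b.eval s⌉₊ = N)
    (h0 : Inv 0 (s.setInt x [] 0))
    (hc : ∀ j s, j < N → Inv j s →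
      Det G κ c s B fun s' => Inv (j + 1) (s'.setInt x [] (s'.int x [] + 1))) :
    Det G κ (forLoop x b c) s (forCost N B) (Inv N) := by
  classical
  intro f r hf
  have := wp_forLoop (G := G) (κ := κ) (x := x) (b := b) (c := c) (B := B)
    (fun j s => if Inv j s then r else ⊤) N
    (fun j s h => hx j s (by by_contra h'; simp [h'] at h))
    (fun j s hj h => by
      have hi : Inv j s := by by_contra h'; simp [h'] at h
      rw [if_pos hi]
      exact hc j s hj hi _ _ fun s' hs' => by rw [if_pos hs']) s
  rw [if_pos h0] at this
  refine (wp_mono le_rfl fun s' => ?_).trans this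
  split_ifs with h
  · exact hf s' h
  · exact le_top

/-- The union bound for counting loops: the invariant `Inv` holds with certainty, and every
iteration preserves `Gd` except with probability `p`. -/
lemma Fail.forLoop {x : ℕ} {b : RExp} {c : Cmd} {B : ℕ} {s : State} (Inv Gd : ℕ → State → Prop)
    (p : ℝ≥0∞) (N : ℕ) (hx : ∀ j s, Inv j s → s.int x [] = j ∧ ⌈b.eval s⌉₊ = N)
    (h0 : Inv 0 (s.setInt x [] 0)) (h0' : Gd 0 (s.setInt x [] 0))
    (hc : ∀ j s, j < N → Inv j s →
      Fail G κ c s B (fun s' => Inv (j + 1) (s'.setInt x [] (s'.int x [] + 1)))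
        (fun s' => Gd j s → Gd (j + 1) (s'.setInt x [] (s'.int x [] + 1))) p) :
    Fail G κ (forLoop x b c) s (forCost N B) (Inv N) (Gd N) (N * p) := by
  classical
  intro f r hf hf'
  have := wp_forLoop (G := G) (κ := κ) (x := x) (b := b) (c := c) (B := B)
    (fun j s => if Inv j s then (r + if Gd j s then 0 else 1) + (N - j : ℕ) * p else ⊤) N
    (fun j s h => hx j s (by by_contra h'; simp [h'] at h))
    (fun j s hj h => by
      have hi : Inv j s := by by_contra h'; simp [h'] at h
      have e : ((N - j : ℕ) : ℝ≥0∞) * p = (N - (j + 1) : ℕ) * p + p := by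
        rw [show N - j = N - (j + 1) + 1 by omega]; push_cast; ring
      rw [if_pos hi, e, ← add_assoc]
      by_cases hg : Gd j s
      · rw [if_pos hg, add_zero]
        refine hc j s hj hi _ _ (fun s' hs' => ?_) fun s' hs' hg' => ?_
        · rw [if_pos hs', add_right_comm]
          gcongr
          split_ifs <;> simp
        · rw [if_pos hs', if_pos (hg' hg), add_zero]
      · rw [if_neg hg]
        refine hc j s hj hi _ _ (fun s' hs' => ?_) fun s' hs' hg' => ?_
        · rw [if_pos hs']
          refine le_trans ?_ le_self_add
          gcongr
          split_ifs <;> simp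
        · rw [if_pos hs']
          gcongr
          split_ifs <;> simp) s
  rw [if_pos h0, if_pos h0', add_zero, Nat.sub_zero] at this
  refine (wp_mono le_rfl fun s' => ?_).trans this
  split_ifs with h h'
  · simpa using hf' s' h h'
  · simpa using hf s' h
  · exact le_top

/-- The expectation functional of `m` successive random experiments `E j a`, `E (j + 1) a'`, …,
each of which depends on the outcome of the one before. -/
def iterExp {α : Type*} (E : ℕ → α → (α → ℝ≥0∞) → ℝ≥0∞) : ℕ → ℕ → α → (α → ℝ≥0∞) → ℝ≥0∞
  | _, 0, a, g => g a
  | j, m + 1, a, g => E j a fun a' => iterExp E (j + 1) m a' g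

/-- A counting loop performs its experiments one after the other, starting from outcome `a₀`. -/
lemma Rand.forLoop {α : Type*} {x : ℕ} {b : RExp} {c : Cmd} {B : ℕ} {s : State}
    (Inv : ℕ → α → State → Prop) (E : ℕ → α → (α → ℝ≥0∞) → ℝ≥0∞) (a₀ : α)
    (N : ℕ) (hx : ∀ j a s, Inv j a s → s.int x [] = j ∧ ⌈b.eval s⌉₊ = N)
    (h0 : Inv 0 a₀ (s.setInt x [] 0))
    (hc : ∀ j a s, j < N → Inv j a s → Rand G κ c s B (E j a) fun a' s' =>
      Inv (j + 1) a' (s'.setInt x [] (s'.int x [] + 1))) :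
    Rand G κ (forLoop x b c) s (forCost N B) (iterExp E 0 N a₀) (Inv N) := by
  intro f g hf
  have := wp_forLoop (G := G) (κ := κ) (x := x) (b := b) (c := c) (B := B)
    (fun j s => ⨅ (a) (_ : Inv j a s), iterExp E j (N - j) a g) N
    (fun j s h => by
      by_contra h'
      refine h ?_
      simp only [iInf_eq_top]
      exact fun a ha => absurd (hx j a s ha) h')
    (fun j s hj h => by
      refine le_iInf₂ fun a ha => ?_
      rw [show N - j = N - (j + 1) + 1 by omega, iterExp]
      exact hc j a s hj ha _ _ fun a' s' hs' => iInf₂_le a' hs') s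
  refine (wp_mono le_rfl fun s' => ?_).trans (this.trans (iInf₂_le a₀ h0))
  refine le_iInf₂ fun a ha => ?_
  simpa [iterExp] using hf a s' ha

end Loops

/-! ### Expressions with bounded sums and products, and loops filling an array -/

/-- The bounds of the loops inside compound expressions. -/
inductive Bd where
  /-- the number of players -/
  | players
  /-- the number of types of a player -/
  | types (i : IExp)
  /-- the number of actions of a player -/
  | acts (i : IExp)
  /-- one more than the number of actions of a player -/
  | cuts (i : IExp)
  /-- the index of the current round -/
  | rounds
  /-- the accuracy parameter -/
  | iters
  /-- the number of grid points -/
  | grid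

/-- The bound as an expression of the machine. -/
def Bd.exp : Bd → RExp
  | players => .ofInt (ic 0 [])
  | types i => .ofInt (ic 1 [i])
  | acts i => .ofInt (ic 2 [i])
  | cuts i => .ofInt (.add (ic 2 [i]) (.lit 1))
  | rounds => .ofInt (ic 3 [])
  | iters => rc 4 []
  | grid => rc 6 []

/-- The number of iterations that the bound allows. -/
def Bd.card (s : State) (b : Bd) : ℕ := ⌈b.exp.eval s⌉₊

@[simp] lemma Bd.card_players (s : State) : Bd.players.card s = s.int 0 [] := by
  simp [Bd.card, Bd.exp, RExp.eval]

@[simp] lemma Bd.card_types (s : State) (i : IExp) :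
    (Bd.types i).card s = s.int 1 [i.eval s] := by
  simp [Bd.card, Bd.exp, RExp.eval]

@[simp] lemma Bd.card_acts (s : State) (i : IExp) :
    (Bd.acts i).card s = s.int 2 [i.eval s] := by
  simp [Bd.card, Bd.exp, RExp.eval]

@[simp] lemma Bd.card_cuts (s : State) (i : IExp) :
    (Bd.cuts i).card s = s.int 2 [i.eval s] + 1 := by
  rw [Bd.card, Bd.exp, RExp.eval, Nat.ceil_natCast]
  simp [IExp.eval]

@[simp] lemma Bd.card_rounds (s : State) : Bd.rounds.card s = s.int 3 [] := by
  simp [Bd.card, Bd.exp, RExp.eval]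

@[simp] lemma Bd.card_iters (s : State) : Bd.iters.card s = ⌈s.real 4 []⌉₊ := by
  simp [Bd.card, Bd.exp]

@[simp] lemma Bd.card_grid (s : State) : Bd.grid.card s = ⌈s.real 6 []⌉₊ := by
  simp [Bd.card, Bd.exp]

/-- All loop bounds are at most `N`. -/
def Small (N : ℕ) (s : State) : Prop :=
  (∀ l, s.int 1 l ≤ N) ∧ (∀ l, s.int 2 l + 1 ≤ N) ∧ s.int 0 [] ≤ N ∧ s.int 3 [] ≤ N ∧
    s.real 4 [] ≤ N ∧ s.real 6 [] ≤ N

lemma Small.card_le {N : ℕ} {s : State} (h : Small N s) (b : Bd) : b.card s ≤ N := by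
  obtain ⟨h1, h2, h0, h3, h4, h6⟩ := h
  cases b with
  | players => simpa using h0
  | types i => simpa using h1 _
  | acts i => simpa using (Nat.le_succ _).trans (h2 _)
  | cuts i => simpa using h2 _
  | rounds => simpa using h3
  | iters => simpa using h4
  | grid => simpa using h6

/-- Real expressions extended by case distinctions and bounded sums and products. -/
inductive BigExp where
  | base (e : RExp)
  | ite (t : Test) (e f : BigExp)
  | sum (b : Bd) (e : BigExp)
  | prod (b : Bd) (e : BigExp)

namespace BigExp

/-- A program that evaluates the expression into the real scalar `d`. The scalars from `d` on are
registers, the natural-number scalars from `d` on are loop counters. -/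
def compile : BigExp → ℕ → Cmd
  | base e, d => asgReal d [] e
  | ite t e f, d => .branch t (e.compile d) (f.compile d)
  | sum b e, d => .seq (asgReal d [] (.ofInt (.lit 0)))
      (forLoop d b.exp (.seq (e.compile (d + 1)) (asgReal d [] (.add (rc d []) (rc (d + 1) [])))))
  | prod b e, d => .seq (asgReal d [] (.ofInt (.lit 1)))
      (forLoop d b.exp (.seq (e.compile (d + 1)) (asgReal d [] (.mul (rc d []) (rc (d + 1) [])))))

open Classical in
/-- The value of an expression; the bound variable of a sum or product at depth `d` is the
natural-number scalar `d`. -/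
def val : BigExp → ℕ → State → ℝ
  | base e, _, s => e.eval s
  | ite t e f, d, s => if t.holds s then e.val d s else f.val d s
  | sum b e, d, s => ∑ j ∈ Finset.range (b.card s), e.val (d + 1) (s.setInt d [] j)
  | prod b e, d, s => ∏ j ∈ Finset.range (b.card s), e.val (d + 1) (s.setInt d [] j)

/-- A bound for the number of steps of the evaluation if all loop bounds are at most `N`. -/
def cost (N : ℕ) : BigExp → ℕ
  | base _ => 1
  | ite _ e f => e.cost N + f.cost N + 1
  | sum _ e => forCost N (e.cost N + 1 + 1) + 2
  | prod _ e => forCost N (e.cost N + 1 + 1) + 2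

end BigExp

/-- The natural-number arrays have the same content in both memories, except possibly for the
scalars from `d` on. -/
def SameInt (d : ℕ) (s s' : State) : Prop :=
  ∀ y l, y < d ∨ l ≠ [] → s'.int y l = s.int y l

/-- The memories agree in the sense of `SameInt`, and the real arrays below `100`, except possibly
`x`, have the same content. -/
def Same (d x : ℕ) (s s' : State) : Prop :=
  SameInt d s s' ∧ ∀ y < 100, y ≠ x → s'.real y = s.real y

/-- All arrays that occur in the expression are below `d`. -/
def IExp.Low (d : ℕ) : IExp → Prop
  | .lit _ => True
  | .cell x _ idx => x < d ∧ ∀ j, (idx j).Low d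
  | .add e f => e.Low d ∧ f.Low d
  | .sub e f => e.Low d ∧ f.Low d

/-- All natural-number arrays that occur in the expression are below `d`, all real arrays are
below `100` and different from `x`. -/
def RExp.Low (d x : ℕ) : RExp → Prop
  | .ofInt e => e.Low d
  | .cell y _ idx => y < 100 ∧ y ≠ x ∧ ∀ j, (idx j).Low d
  | .add e f => e.Low d x ∧ f.Low d x
  | .sub e f => e.Low d x ∧ f.Low d x
  | .mul e f => e.Low d x ∧ f.Low d x
  | .div e f => e.Low d x ∧ f.Low d x

/-- The analogue of `RExp.Low` for tests. -/
def Test.Low (d x : ℕ) : Test → Prop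
  | .intLt e f => e.Low d ∧ f.Low d
  | .realLt e f => e.Low d x ∧ f.Low d x

/-- The analogue of `RExp.Low` for bounds. -/
def Bd.Low (d : ℕ) : Bd → Prop
  | types i => i.Low d
  | acts i => i.Low d
  | cuts i => i.Low d
  | _ => True

/-- The analogue of `RExp.Low` for compound expressions at depth `d`. -/
def BigExp.Low (x : ℕ) : ℕ → BigExp → Prop
  | d, base e => e.Low d x
  | d, ite t e f => t.Low d x ∧ e.Low x d ∧ f.Low x d
  | d, sum b e => b.Low d ∧ e.Low x (d + 1)
  | d, prod b e => b.Low d ∧ e.Low x (d + 1)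

lemma ic_low {d x : ℕ} {l : List IExp} : (ic x l).Low d ↔ x < d ∧ ∀ e ∈ l, e.Low d := by
  rw [ic, IExp.Low, List.forall_mem_iff_get]

lemma rc_low {d x y : ℕ} {l : List IExp} :
    (rc y l).Low d x ↔ y < 100 ∧ y ≠ x ∧ ∀ e ∈ l, e.Low d := by
  rw [rc, RExp.Low, List.forall_mem_iff_get]

section Congr

variable {d x : ℕ} {s s' : State}

lemma SameInt.eq (h : SameInt d s s') {y : ℕ} (hy : y < d) : s'.int y = s.int y :=
  funext fun l => h y l (Or.inl hy)

lemma SameInt.trans {s'' : State} (h : SameInt d s s') (h' : SameInt d s' s'') :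
    SameInt d s s'' :=
  fun y l hl => (h' y l hl).trans (h y l hl)

lemma SameInt.mono {d' : ℕ} (h : SameInt d s s') (hd : d' ≤ d) : SameInt d' s s' :=
  fun y l hl => h y l (hl.imp_left fun h => h.trans_le hd)

lemma sameInt_setInt (j : ℕ) : SameInt d s (s.setInt d [] j) := by
  intro y l hl
  rw [setInt_int, if_neg]
  rintro ⟨rfl, rfl⟩
  simp at hl

lemma SameInt.setInt (h : SameInt d s s') (j : ℕ) :
    SameInt (d + 1) (s.setInt d [] j) (s'.setInt d [] j) := by
  intro y l hl
  rw [setInt_int, setInt_int]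
  split_ifs with hy
  · rfl
  · exact h y l (by grind)

lemma SameInt.of_counter {j : ℕ} (h : SameInt d s s') (hj : s'.int d [] = j) :
    SameInt (d + 1) (s.setInt d [] j) s' := by
  intro y l hl
  rw [setInt_int]
  split_ifs with hy
  · rw [hy.1, hy.2, hj]
  · exact h y l (by grind)

lemma IExp.eval_congr (h : SameInt d s s') {e : IExp} (he : e.Low d) :
    e.eval s' = e.eval s := by
  induction e with
  | lit k => rfl
  | cell y m idx ih =>
    rw [IExp.eval, IExp.eval, h.eq he.1]
    congr 2
    funext j
    exact ih j (he.2 j)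
  | add e f ihe ihf => rw [IExp.eval, IExp.eval, ihe he.1, ihf he.2]
  | sub e f ihe ihf => rw [IExp.eval, IExp.eval, ihe he.1, ihf he.2]

lemma map_eval_congr (h : SameInt d s s') {l : List IExp} (hl : ∀ e ∈ l, e.Low d) :
    l.map (IExp.eval s') = l.map (IExp.eval s) :=
  List.map_congr_left fun e he => IExp.eval_congr h (hl e he)

lemma RExp.eval_congr (h : Same d x s s') {e : RExp} (he : e.Low d x) : e.eval s' = e.eval s := by
  induction e with
  | ofInt e => rw [RExp.eval, RExp.eval, IExp.eval_congr h.1 he]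
  | cell y m idx =>
    rw [RExp.eval, RExp.eval, h.2 y he.1 he.2.1]
    congr 2
    funext j
    exact IExp.eval_congr h.1 (he.2.2 j)
  | add e f ihe ihf => rw [RExp.eval, RExp.eval, ihe he.1, ihf he.2]
  | sub e f ihe ihf => rw [RExp.eval, RExp.eval, ihe he.1, ihf he.2]
  | mul e f ihe ihf => rw [RExp.eval, RExp.eval, ihe he.1, ihf he.2]
  | div e f ihe ihf => rw [RExp.eval, RExp.eval, ihe he.1, ihf he.2]

lemma Test.holds_congr (h : Same d x s s') {t : Test} (ht : t.Low d x) :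
    t.holds s' ↔ t.holds s := by
  cases t with
  | intLt e f => rw [Test.holds, Test.holds, IExp.eval_congr h.1 ht.1, IExp.eval_congr h.1 ht.2]
  | realLt e f => rw [Test.holds, Test.holds, RExp.eval_congr h ht.1, RExp.eval_congr h ht.2]

lemma Bd.card_congr (hd : 100 ≤ d) (hx : x ≠ 4 ∧ x ≠ 6) (h : Same d x s s') {b : Bd}
    (hb : b.Low d) : b.card s' = b.card s := by
  cases b with
  | players => simp [h.1.eq (show 0 < d by omega)]
  | types i => simp [h.1.eq (show 1 < d by omega), IExp.eval_congr h.1 (show i.Low d from hb)]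
  | acts i => simp [h.1.eq (show 2 < d by omega), IExp.eval_congr h.1 (show i.Low d from hb)]
  | cuts i => simp [h.1.eq (show 2 < d by omega), IExp.eval_congr h.1 (show i.Low d from hb)]
  | rounds => simp [h.1.eq (show 3 < d by omega)]
  | iters => simp [h.2 4 (by norm_num) hx.1.symm]
  | grid => simp [h.2 6 (by norm_num) hx.2.symm]

lemma Small.congr {N : ℕ} (hd : 100 ≤ d) (hx : x ≠ 4 ∧ x ≠ 6) (h : Same d x s s')
    (hs : Small N s) : Small N s' := by
  unfold Small at *
  rwa [h.1.eq (show 0 < d by omega), h.1.eq (show 1 < d by omega),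
    h.1.eq (show 2 < d by omega), h.1.eq (show 3 < d by omega),
    h.2 4 (by norm_num) hx.1.symm, h.2 6 (by norm_num) hx.2.symm]

lemma Same.setInt (h : Same d x s s') (j : ℕ) :
    Same (d + 1) x (s.setInt d [] j) (s'.setInt d [] j) :=
  ⟨h.1.setInt j, h.2⟩

lemma Same.of_counter {j : ℕ} (h : Same d x s s') (hj : s'.int d [] = j) :
    Same (d + 1) x (s.setInt d [] j) s' :=
  ⟨h.1.of_counter hj, h.2⟩

lemma BigExp.val_congr {e : BigExp} (hd : 100 ≤ d) (hx : x ≠ 4 ∧ x ≠ 6) (h : Same d x s s')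
    (he : e.Low x d) : e.val d s' = e.val d s := by
  induction e generalizing d s s' with
  | base e => exact RExp.eval_congr h he
  | ite t e f ihe ihf =>
    have ht := Test.holds_congr h he.1
    by_cases hts : t.holds s <;>
      simp [BigExp.val, ht, hts, ihe hd h he.2.1, ihf hd h he.2.2]
  | sum b e ih =>
    simp only [BigExp.val, Bd.card_congr hd hx h he.1]
    exact Finset.sum_congr rfl fun j _ => ih (by omega) (h.setInt j) he.2
  | prod b e ih =>
    simp only [BigExp.val, Bd.card_congr hd hx h he.1]
    exact Finset.prod_congr rfl fun j _ => ih (by omega) (h.setInt j) he.2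

end Congr

section Compile

variable {n : ℕ} {G : BayesianGame n} {κ : ∀ i : Fin n, Fin (G.numTypes i) → PMF G.Types}

/-- What the evaluation of an expression into the register `d` leaves unchanged. -/
def Above (d : ℕ) (s s' : State) : Prop :=
  SameInt d s s' ∧ ∀ y < d, s'.real y = s.real y

lemma Above.same {d x : ℕ} {s s' : State} (hd : 100 ≤ d) (h : Above d s s') : Same d x s s' :=
  ⟨h.1, fun y hy _ => h.2 y (by omega)⟩

/-- The compiled program evaluates the expression. -/
lemma BigExp.det_compile {x N d : ℕ} (hx : x ≠ 4 ∧ x ≠ 6) (e : BigExp) (hd : 100 ≤ d)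
    (he : e.Low x d) (s : State) (hs : Small N s) :
    Det G κ (e.compile d) s (e.cost N) fun s' => Above d s s' ∧ s'.real d [] = e.val d s := by
  induction e generalizing d s with
  | base e =>
    refine det_asgReal ⟨⟨fun _ _ _ => rfl, fun y hy => setReal_real_ne _ hy.ne _ _⟩, ?_⟩
    simp [BigExp.val]
  | ite t e f ihe ihf =>
    intro g r hg
    by_cases ht : t.holds s
    · refine (wp_mono (show e.cost N + 1 ≤ _ by simp only [BigExp.cost]; omega)
        fun _ => le_rfl).trans ((wp_branch_pos ht _ _ _ _).trans (ihe hd he.2.1 s hs g r ?_))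
      simpa [BigExp.val, ht] using hg
    · refine (wp_mono (show f.cost N + 1 ≤ _ by simp only [BigExp.cost]; omega)
        fun _ => le_rfl).trans ((wp_branch_neg ht _ _ _ _).trans (ihf hd he.2.2 s hs g r ?_))
      simpa [BigExp.val, ht] using hg
  | sum b e ih =>
    refine Det.mono (B := 1 + forCost (b.card s) (e.cost N + 1 + 1) + 1) (Det.seq
      (Q := fun s' => Above d s s' ∧ s'.real d [] = 0) ?_ fun s₁ hs₁ =>
      Det.forLoop (fun j s' => Above d s s' ∧ s'.int d [] = j ∧ s'.real d [] =
        ∑ i ∈ Finset.range j, e.val (d + 1) (s.setInt d [] i)) (b.card s) ?_ ?_ ?_) ?_ ?_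
    · refine det_asgReal ⟨⟨fun _ _ _ => rfl, fun y hy => setReal_real_ne _ hy.ne _ _⟩, ?_⟩
      simp [RExp.eval, IExp.eval]
    · exact fun j s' h => ⟨h.2.1, Bd.card_congr hd hx (h.1.same hd) he.1⟩
    · exact ⟨⟨hs₁.1.1.trans (sameInt_setInt 0), hs₁.1.2⟩, by simp, by simpa using hs₁.2⟩
    · intro j s' hj h
      have hsame := (h.1.same (x := x) hd).of_counter h.2.1
      refine Det.seq (ih (d := d + 1) (by omega) he.2 s' (hs.congr hd hx (h.1.same hd)))
        fun s'' h'' => det_asgReal ⟨⟨?_, fun y hy => ?_⟩, ?_, ?_⟩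
      · exact (h.1.1.trans (h''.1.1.mono (Nat.le_succ d))).trans (sameInt_setInt _)
      · rw [setInt_real, List.map_nil, setReal_real_ne _ hy.ne, h''.1.2 y (by omega), h.1.2 y hy]
      · simp [h''.1.1.eq (Nat.lt_succ_self d), h.2.1]
      · rw [Finset.sum_range_succ, ← h.2.2]
        simp [RExp.eval, h''.2, h''.1.2 d (Nat.lt_succ_self d),
          BigExp.val_congr (by omega) hx hsame he.2]
    · simp only [BigExp.cost]
      have := forCost_mono (hs.card_le b) (le_refl (e.cost N + 1 + 1))
      omega
    · exact fun s' h => ⟨h.1, by rw [h.2.2]; rfl⟩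
  | prod b e ih =>
    refine Det.mono (B := 1 + forCost (b.card s) (e.cost N + 1 + 1) + 1) (Det.seq
      (Q := fun s' => Above d s s' ∧ s'.real d [] = 1) ?_ fun s₁ hs₁ =>
      Det.forLoop (fun j s' => Above d s s' ∧ s'.int d [] = j ∧ s'.real d [] =
        ∏ i ∈ Finset.range j, e.val (d + 1) (s.setInt d [] i)) (b.card s) ?_ ?_ ?_) ?_ ?_
    · refine det_asgReal ⟨⟨fun _ _ _ => rfl, fun y hy => setReal_real_ne _ hy.ne _ _⟩, ?_⟩
      simp [RExp.eval, IExp.eval]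
    · exact fun j s' h => ⟨h.2.1, Bd.card_congr hd hx (h.1.same hd) he.1⟩
    · exact ⟨⟨hs₁.1.1.trans (sameInt_setInt 0), hs₁.1.2⟩, by simp, by simpa using hs₁.2⟩
    · intro j s' hj h
      have hsame := (h.1.same (x := x) hd).of_counter h.2.1
      refine Det.seq (ih (d := d + 1) (by omega) he.2 s' (hs.congr hd hx (h.1.same hd)))
        fun s'' h'' => det_asgReal ⟨⟨?_, fun y hy => ?_⟩, ?_, ?_⟩
      · exact (h.1.1.trans (h''.1.1.mono (Nat.le_succ d))).trans (sameInt_setInt _)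
      · rw [setInt_real, List.map_nil, setReal_real_ne _ hy.ne, h''.1.2 y (by omega), h.1.2 y hy]
      · simp [h''.1.1.eq (Nat.lt_succ_self d), h.2.1]
      · rw [Finset.prod_range_succ, ← h.2.2]
        simp [RExp.eval, h''.2, h''.1.2 d (Nat.lt_succ_self d),
          BigExp.val_congr (by omega) hx hsame he.2]
    · simp only [BigExp.cost]
      have := forCost_mono (hs.card_le b) (le_refl (e.cost N + 1 + 1))
      omega
    · exact fun s' h => ⟨h.1, by rw [h.2.2]; rfl⟩

/-- Nested loops with the bounds `bs`, whose counters are the natural-number scalars from `d` on;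
they assign the value of `e` to the entry of the real array `x` whose index is `pre`, followed by
the counters. -/
def fill (x : ℕ) : List IExp → List Bd → BigExp → ℕ → Cmd
  | pre, [], e, d => .seq (e.compile d) (asgReal x pre (rc d []))
  | pre, b :: bs, e, d => forLoop d b.exp (fill x (pre ++ [ic d []]) bs e (d + 1))

/-- The value that `fill` writes at the index `l` (following the fixed part of the index), or
`none` if `l` is out of bounds. -/
def fillVal : List Bd → BigExp → ℕ → State → List ℕ → Option ℝ
  | [], e, d, s, [] => some (e.val d s)
  | b :: bs, e, d, s, j :: l =>
    if j < b.card s then fillVal bs e (d + 1) (s.setInt d [] j) l else none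
  | _, _, _, _, _ => none

/-- A bound for the number of steps of `fill` if all loop bounds are at most `N`. -/
def fillCost (N : ℕ) : List Bd → BigExp → ℕ
  | [], e => e.cost N + 2
  | _ :: bs, e => forCost N (fillCost N bs e)

/-- The analogue of `BigExp.Low` for loop nests. -/
def FillLow (x : ℕ) : List Bd → BigExp → ℕ → Prop
  | [], e, d => e.Low x d
  | b :: bs, e, d => b.Low d ∧ FillLow x bs e (d + 1)

lemma fillVal_congr {x d : ℕ} {s s' : State} {bs : List Bd} {e : BigExp} (hd : 100 ≤ d)
    (hx : x ≠ 4 ∧ x ≠ 6) (h : Same d x s s') (he : FillLow x bs e d) (l : List ℕ) :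
    fillVal bs e d s' l = fillVal bs e d s l := by
  induction bs generalizing d s s' l with
  | nil =>
    cases l with
    | nil => simp only [fillVal, BigExp.val_congr hd hx h he]
    | cons j l => rfl
  | cons b bs ih =>
    cases l with
    | nil => rfl
    | cons j l =>
      simp only [fillVal, Bd.card_congr hd hx h he.1, ih (Nat.le_succ_of_le hd) (h.setInt j) he.2]

/-- The memory `s'` arises from `s` by writing the partially defined array `v` behind the index
prefix `p` of the real array `x`; scratch memory is disregarded. -/
def Filled (d x : ℕ) (p : List ℕ) (v : List ℕ → Option ℝ) (s s' : State) : Prop :=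
  Same d x s s' ∧ (∀ l, s'.real x (p ++ l) = (v l).getD (s.real x (p ++ l))) ∧
    ∀ l, ¬ p <+: l → s'.real x l = s.real x l

lemma low_mono_int {d d' : ℕ} (h : d ≤ d') {e : IExp} (he : e.Low d) : e.Low d' := by
  induction e with
  | lit k => trivial
  | cell y m idx ih => exact ⟨he.1.trans_le h, fun j => ih j (he.2 j)⟩
  | add e f ihe ihf => exact ⟨ihe he.1, ihf he.2⟩
  | sub e f ihe ihf => exact ⟨ihe he.1, ihf he.2⟩

/-- The loop nest fills the array. Its bounds and values do not depend on the array `x`, so the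
value at each index may be computed in the memory before the execution. -/
lemma det_fill {x N d : ℕ} (hx : x ≠ 4 ∧ x ≠ 6) (hx' : x < 100) (pre : List IExp) (bs : List Bd)
    (e : BigExp) (hd : 100 ≤ d) (he : FillLow x bs e d) (hpre : ∀ i ∈ pre, i.Low d) (s : State)
    (hs : Small N s) :
    Det G κ (fill x pre bs e d) s (fillCost N bs e)
      (Filled d x (pre.map (IExp.eval s)) (fillVal bs e d s) s) := by
  induction bs generalizing d s pre with
  | nil =>
    refine (Det.seq (e.det_compile hx hd he s hs) fun s₁ hs₁ => det_asgReal ?_).mono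
      (show _ ≤ _ by simp only [fillCost]; omega) fun _ h => h
    have hp : pre.map (IExp.eval s₁) = pre.map (IExp.eval s) := map_eval_congr hs₁.1.1 hpre
    refine ⟨⟨hs₁.1.1, fun y hy hyx => ?_⟩, fun l => ?_, fun l hl => ?_⟩
    · rw [setReal_real_ne _ hyx, hs₁.1.2 y (by omega)]
    · rw [setReal_real, hp, hs₁.1.2 x (by omega)]
      cases l with
      | nil => simp [fillVal, hs₁.2]
      | cons j l => simp [fillVal]
    · rw [setReal_real, hp, hs₁.1.2 x (by omega), if_neg]
      rintro ⟨-, rfl⟩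
      exact hl (List.prefix_refl _)
  | cons b bs ih =>
    set p := pre.map (IExp.eval s) with hp
    refine Det.mono (B := forCost (b.card s) (fillCost N bs e))
      (Det.forLoop (fun j s' => s'.int d [] = j ∧ Filled d x p (fun l => match l with
        | [] => none
        | i :: l => if i < j then fillVal bs e (d + 1) (s.setInt d [] i) l else none) s s')
        (b.card s) ?_ ?_ ?_) ?_ ?_
    · exact fun j s' h => ⟨h.1, Bd.card_congr hd hx h.2.1 he.1⟩
    · refine ⟨by simp, ⟨sameInt_setInt 0, fun _ _ _ => rfl⟩, fun l => ?_, fun _ _ => rfl⟩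
      cases l <;> simp
    · intro j s' hj h
      refine (ih (d := d + 1) (pre ++ [ic d []]) (by omega) he.2 ?_ s'
        (hs.congr hd hx h.2.1)).mono le_rfl fun s'' h'' => ?_
      · intro i hi
        rcases List.mem_append.1 hi with hi | hi
        · exact low_mono_int (Nat.le_succ d) (hpre i hi)
        · rw [List.mem_singleton.1 hi, ic_low]
          simp
      · have hp' : (pre ++ [ic d []]).map (IExp.eval s') = p ++ [j] := by
          rw [List.map_append, map_eval_congr h.2.1.1 hpre]
          simp [h.1, hp]
        rw [hp'] at h''
        have hv : ∀ l, fillVal bs e (d + 1) s' l = fillVal bs e (d + 1) (s.setInt d [] j) l :=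
          fillVal_congr (by omega) hx (h.2.1.of_counter h.1) he.2
        refine ⟨?_, ⟨?_, fun y hy hyx => ?_⟩, fun l => ?_, fun l hl => ?_⟩
        · simp [h''.1.1.eq (Nat.lt_succ_self d), h.1]
        · exact (h.2.1.1.trans (h''.1.1.mono (Nat.le_succ d))).trans (sameInt_setInt _)
        · rw [setInt_real, h''.1.2 y hy hyx, h.2.1.2 y hy hyx]
        · rw [setInt_real]
          cases l with
          | nil =>
            rw [h''.2.2 _ (fun h => by simpa using h.length_le), h.2.2.1]
          | cons i l =>
            by_cases hij : i = j
            · subst hij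
              have := h''.2.1 l
              rw [List.append_assoc, List.singleton_append, hv] at this
              rw [this, h.2.2.1]
              simp
            · rw [h''.2.2 _ (by simpa [List.prefix_append_right_inj] using Ne.symm hij), h.2.2.1]
              have : i < j + 1 ↔ i < j := by omega
              simp only [this]
        · rw [setInt_real, h''.2.2 l (fun h => hl ((List.prefix_append _ _).trans h)),
            h.2.2.2 l hl]
    · simp only [fillCost]
      exact forCost_mono (hs.card_le b) le_rfl
    · intro s' h
      refine ⟨h.2.1, fun l => ?_, h.2.2.2⟩
      rw [h.2.2.1]
      cases l <;> rfl

end Compile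

/-! ### Regret against misreports and disobedience -/

section Kernel

open Finset

/-- `K θ a θ' a'` is the probability with which somebody of type `θ` reports `θ'` and, when
recommended the action `a'`, plays `a`. The strategy `x` is turned into the resulting one. -/
def app (Θ A : ℕ) (K : ℕ → ℕ → ℕ → ℕ → ℝ) (x : ℕ → ℕ → ℝ) (θ a : ℕ) : ℝ :=
  ∑ θ' ∈ range Θ, ∑ a' ∈ range A, K θ a θ' a' * x θ' a'

/-- `x` assigns a distribution on the first `A` naturals to every type below `Θ`. -/
def IsStrat (Θ A : ℕ) (x : ℕ → ℕ → ℝ) : Prop :=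
  ∀ θ < Θ, (∀ a < A, 0 ≤ x θ a) ∧ ∑ a ∈ range A, x θ a = 1

/-- For every type `θ` a random report, and for every recommendation a random action. -/
def IsDeviation (Θ A : ℕ) (K : ℕ → ℕ → ℕ → ℕ → ℝ) : Prop :=
  ∃ w : ℕ → ℕ → ℝ, (∀ θ < Θ, ∑ θ' ∈ range Θ, w θ θ' = 1) ∧
    (∀ θ < Θ, ∀ a < A, ∀ θ' < Θ, ∀ a' < A, 0 ≤ K θ a θ' a') ∧
    ∀ θ < Θ, ∀ θ' < Θ, ∀ a' < A, ∑ a ∈ range A, K θ a θ' a' = w θ θ'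

variable {Θ A : ℕ} {K : ℕ → ℕ → ℕ → ℕ → ℝ}

lemma sum_app (w : ℕ → ℕ → ℝ) (x : ℕ → ℕ → ℝ) {θ : ℕ}
    (hw : ∀ θ' < Θ, ∀ a' < A, ∑ a ∈ range A, K θ a θ' a' = w θ θ') :
    ∑ a ∈ range A, app Θ A K x θ a = ∑ θ' ∈ range Θ, w θ θ' * ∑ a' ∈ range A, x θ' a' := by
  unfold app
  rw [sum_comm]
  refine sum_congr rfl fun θ' hθ' => ?_
  rw [sum_comm, mul_sum]
  refine sum_congr rfl fun a' ha' => ?_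
  rw [← sum_mul, hw θ' (mem_range.1 hθ') a' (mem_range.1 ha')]

lemma IsDeviation.app_isStrat (hK : IsDeviation Θ A K) {x : ℕ → ℕ → ℝ} (hx : IsStrat Θ A x) :
    IsStrat Θ A (app Θ A K x) := by
  obtain ⟨w, hw1, h0, hw⟩ := hK
  refine fun θ hθ => ⟨fun a ha => sum_nonneg fun θ' hθ' => sum_nonneg fun a' ha' => ?_, ?_⟩
  · rw [mem_range] at hθ' ha'
    exact mul_nonneg (h0 θ hθ a ha θ' hθ' a' ha') ((hx θ' hθ').1 a' ha')
  · rw [sum_app w x (hw θ hθ), ← hw1 θ hθ]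
    refine sum_congr rfl fun θ' hθ' => ?_
    rw [(hx θ' (mem_range.1 hθ')).2, mul_one]

/-- A random deviation does not expand distances, uniformly in the types. -/
lemma IsDeviation.sum_abs_app_le (hK : IsDeviation Θ A K) {z : ℕ → ℕ → ℝ} {C : ℝ} (hA : 0 < A)
    (hz : ∀ θ < Θ, ∑ a ∈ range A, |z θ a| ≤ C) {θ : ℕ} (hθ : θ < Θ) :
    ∑ a ∈ range A, |app Θ A K z θ a| ≤ C := by
  obtain ⟨w, hw1, h0, hw⟩ := hK
  have hw0 : ∀ θ' < Θ, 0 ≤ w θ θ' := fun θ' hθ' => by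
    rw [← hw θ hθ θ' hθ' 0 hA]
    exact sum_nonneg fun a ha => h0 θ hθ a (mem_range.1 ha) θ' hθ' 0 hA
  calc ∑ a ∈ range A, |app Θ A K z θ a|
      ≤ ∑ a ∈ range A, app Θ A K (fun θ a => |z θ a|) θ a := by
        refine sum_le_sum fun a ha => ?_
        unfold app
        refine (abs_sum_le_sum_abs _ _).trans (sum_le_sum fun θ' hθ' =>
          (abs_sum_le_sum_abs _ _).trans (sum_le_sum fun a' ha' => ?_))
        rw [mem_range] at ha hθ' ha'
        rw [abs_mul, abs_of_nonneg (h0 θ hθ a ha θ' hθ' a' ha')]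
    _ = ∑ θ' ∈ range Θ, w θ θ' * ∑ a' ∈ range A, |z θ' a'| := sum_app w _ (hw θ hθ)
    _ ≤ ∑ θ' ∈ range Θ, w θ θ' * C := by
        refine sum_le_sum fun θ' hθ' => ?_
        rw [mem_range] at hθ'
        exact mul_le_mul_of_nonneg_left (hz θ' hθ') (hw0 θ' hθ')
    _ = C := by rw [← sum_mul, hw1 θ hθ, one_mul]

lemma app_sub (x z : ℕ → ℕ → ℝ) (θ a : ℕ) :
    app Θ A K (fun θ a => x θ a - z θ a) θ a = app Θ A K x θ a - app Θ A K z θ a := by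
  simp only [app, mul_sub, sum_sub_distrib]

/-- The average of the first `m` iterates of a deviation is almost invariant under it, and so is
every strategy close to this average. -/
lemma IsDeviation.almost_fixed (hK : IsDeviation Θ A K) (hA : 0 < A) {X : ℕ → ℕ → ℕ → ℝ}
    (hX0 : IsStrat Θ A (X 0))
    (hX : ∀ k, ∀ θ < Θ, ∀ a < A, X (k + 1) θ a = app Θ A K (X k) θ a) {m : ℕ} (hm : 0 < m)
    {y : ℕ → ℕ → ℝ} {C : ℝ}
    (hy : ∀ θ < Θ, ∑ a ∈ range A, |y θ a - (∑ k ∈ range m, X k θ a) / m| ≤ C) {θ : ℕ}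
    (hθ : θ < Θ) :
    ∑ a ∈ range A, |app Θ A K y θ a - y θ a| ≤ 2 * C + 2 / m := by
  have hm' : (0 : ℝ) < m := by exact_mod_cast hm
  have hXs : ∀ k, IsStrat Θ A (X k) := by
    intro k
    induction k with
    | zero => exact hX0
    | succ k ih =>
      intro θ hθ
      have := hK.app_isStrat ih θ hθ
      refine ⟨fun a ha => by rw [hX k θ hθ a ha]; exact this.1 a ha, ?_⟩
      rw [← this.2]
      exact sum_congr rfl fun a ha => hX k θ hθ a (mem_range.1 ha)
  set xb : ℕ → ℕ → ℝ := fun θ a => (∑ k ∈ range m, X k θ a) / m with hxb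
  have hfix : ∀ a < A, app Θ A K xb θ a - xb θ a = (X m θ a - X 0 θ a) / m := by
    intro a ha
    have h1 : app Θ A K xb θ a = (∑ k ∈ range m, X (k + 1) θ a) / m := by
      simp only [hX _ θ hθ a ha, app, hxb]
      symm
      rw [sum_comm, sum_div]
      refine sum_congr rfl fun θ' _ => ?_
      rw [sum_comm, sum_div]
      refine sum_congr rfl fun a' _ => ?_
      rw [← mul_sum, mul_div_assoc]
    rw [h1, hxb, ← sub_div, ← sum_sub_distrib, sum_range_sub (fun k => X k θ a)]
  have h2 : ∑ a ∈ range A, |app Θ A K xb θ a - xb θ a| ≤ 2 / m := by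
    calc ∑ a ∈ range A, |app Θ A K xb θ a - xb θ a|
        ≤ ∑ a ∈ range A, (X m θ a + X 0 θ a) / m := by
          refine sum_le_sum fun a ha => ?_
          rw [mem_range] at ha
          rw [hfix a ha, abs_div, abs_of_pos hm']
          have h1 := (hXs m θ hθ).1 a ha
          have h2 := (hXs 0 θ hθ).1 a ha
          gcongr
          rw [abs_le]
          constructor <;> linarith
      _ = 2 / m := by
          rw [← sum_div, sum_add_distrib, (hXs m θ hθ).2, (hXs 0 θ hθ).2]
          norm_num
  have h3 := hK.sum_abs_app_le hA hy hθ
  calc ∑ a ∈ range A, |app Θ A K y θ a - y θ a|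
      ≤ ∑ a ∈ range A, (|app Θ A K (fun θ a => y θ a - xb θ a) θ a| +
          |app Θ A K xb θ a - xb θ a| + |y θ a - xb θ a|) := by
        refine sum_le_sum fun a _ => ?_
        rw [app_sub]
        have e : app Θ A K y θ a - y θ a = (app Θ A K y θ a - app Θ A K xb θ a) +
          (app Θ A K xb θ a - xb θ a) - (y θ a - xb θ a) := by ring
        rw [e]
        exact (abs_sub _ _).trans (add_le_add_left (abs_add_le _ _) _)
    _ ≤ 2 * C + 2 / m := by
        rw [sum_add_distrib, sum_add_distrib]
        have := hy θ hθ
        linarith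

end Kernel

section Regret

open Finset

/-- The weight, after `t` rounds, of the deviation that consists in reporting `θ'` instead of `θ`
and playing `a` when recommended `a'`. -/
def wt (H : ℝ) (y u : ℕ → ℕ → ℕ → ℝ) (t θ θ' a' a : ℕ) : ℝ :=
  ∏ s ∈ range t, (1 + y s θ' a' * u s θ a / H)

/-- The sum of the weights over the action that is played. -/
def wtSum (A : ℕ) (V : ℕ → ℕ → ℕ → ℕ → ℝ) (θ θ' a' : ℕ) : ℝ := ∑ a ∈ range A, V θ θ' a' a

/-- The weight of the report `θ'`: as the product runs over all recommendations, it is the sum over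
all maps from recommendations to actions of the product of the individual weights. -/
def wtReport (A : ℕ) (V : ℕ → ℕ → ℕ → ℕ → ℝ) (θ θ' : ℕ) : ℝ := ∏ a' ∈ range A, wtSum A V θ θ' a'

/-- The total weight. -/
def wtTotal (Θ A : ℕ) (V : ℕ → ℕ → ℕ → ℕ → ℝ) (θ : ℕ) : ℝ := ∑ θ' ∈ range Θ, wtReport A V θ θ'

/-- The random deviation in proportion to the weights. -/
def wtKernel (Θ A : ℕ) (V : ℕ → ℕ → ℕ → ℕ → ℝ) (θ a θ' a' : ℕ) : ℝ :=
  wtReport A V θ θ' / wtTotal Θ A V θ * (V θ θ' a' a / wtSum A V θ θ' a')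

variable {Θ A : ℕ} {V : ℕ → ℕ → ℕ → ℕ → ℝ}

/-- All weights are positive. -/
def WtPos (Θ A : ℕ) (V : ℕ → ℕ → ℕ → ℕ → ℝ) : Prop :=
  ∀ θ < Θ, ∀ θ' < Θ, ∀ a' < A, ∀ a < A, 0 < V θ θ' a' a

lemma WtPos.sum_pos (hV : WtPos Θ A V) {θ θ' a' : ℕ} (hθ : θ < Θ) (hθ' : θ' < Θ) (ha' : a' < A) :
    0 < wtSum A V θ θ' a' :=
  Finset.sum_pos (fun a ha => hV θ hθ θ' hθ' a' ha' a (mem_range.1 ha)) ⟨a', mem_range.2 ha'⟩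

lemma WtPos.report_pos (hV : WtPos Θ A V) {θ θ' : ℕ} (hθ : θ < Θ) (hθ' : θ' < Θ) :
    0 < wtReport A V θ θ' :=
  prod_pos fun _ ha' => hV.sum_pos hθ hθ' (mem_range.1 ha')

lemma WtPos.total_pos (hV : WtPos Θ A V) {θ : ℕ} (hθ : θ < Θ) : 0 < wtTotal Θ A V θ :=
  Finset.sum_pos (fun _ hθ' => hV.report_pos hθ (mem_range.1 hθ')) ⟨θ, mem_range.2 hθ⟩

lemma WtPos.isDeviation (hV : WtPos Θ A V) : IsDeviation Θ A (wtKernel Θ A V) := by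
  refine ⟨fun θ θ' => wtReport A V θ θ' / wtTotal Θ A V θ, fun θ hθ => ?_,
    fun θ hθ a ha θ' hθ' a' ha' => ?_, fun θ hθ θ' hθ' a' ha' => ?_⟩
  · rw [← sum_div]
    exact div_self (hV.total_pos hθ).ne'
  · exact mul_nonneg (div_nonneg (hV.report_pos hθ hθ').le (hV.total_pos hθ).le)
      (div_nonneg (hV θ hθ θ' hθ' a' ha' a ha).le (hV.sum_pos hθ hθ' ha').le)
  · unfold wtKernel
    rw [← mul_sum, ← sum_div]
    change _ * (wtSum A V θ θ' a' / _) = _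
    rw [div_self (hV.sum_pos hθ hθ' ha').ne', mul_one]

/-- One multiplicative update increases the logarithm of the total weight by little more than the
payoff of the random deviation. -/
lemma WtPos.total_update_le (hV : WtPos Θ A V) {x : ℕ → ℕ → ℝ} (hx : IsStrat Θ A x)
    {u : ℕ → ℕ → ℝ} (hu : ∀ θ < Θ, ∀ a < A, 0 ≤ u θ a ∧ u θ a ≤ 1) {η : ℝ} (hη : 0 ≤ η)
    (hη1 : η ≤ 1) {θ : ℕ} (hθ : θ < Θ) :
    wtTotal Θ A (fun θ θ' a' a => V θ θ' a' a * (1 + η * (x θ' a' * u θ a))) θ ≤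
      wtTotal Θ A V θ *
        Real.exp (η * ∑ a ∈ range A, app Θ A (wtKernel Θ A V) x θ a * u θ a + η ^ 2) := by
  -- the mean payoff after the report `θ'` and the recommendation `a'`
  set w : ℕ → ℕ → ℝ := fun θ' a' => (∑ a ∈ range A, V θ θ' a' a * u θ a) / wtSum A V θ θ' a'
    with hw
  set g : ℕ → ℝ := fun θ' => ∑ a' ∈ range A, x θ' a' * w θ' a' with hg
  have hw0 : ∀ θ' < Θ, ∀ a' < A, 0 ≤ w θ' a' := fun θ' hθ' a' ha' =>
    div_nonneg (sum_nonneg fun a ha => mul_nonneg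
      (hV θ hθ θ' hθ' a' ha' a (mem_range.1 ha)).le (hu θ hθ a (mem_range.1 ha)).1)
      (hV.sum_pos hθ hθ' ha').le
  have hw1 : ∀ θ' < Θ, ∀ a' < A, w θ' a' ≤ 1 := fun θ' hθ' a' ha' => by
    rw [hw]
    refine div_le_one_of_le₀ (sum_le_sum fun a ha => ?_) (hV.sum_pos hθ hθ' ha').le
    rw [mem_range] at ha
    exact mul_le_of_le_one_right (hV θ hθ θ' hθ' a' ha' a ha).le (hu θ hθ a ha).2
  have hg0 : ∀ θ' < Θ, 0 ≤ g θ' := fun θ' hθ' => sum_nonneg fun a' ha' =>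
    mul_nonneg ((hx θ' hθ').1 a' (mem_range.1 ha')) (hw0 θ' hθ' a' (mem_range.1 ha'))
  have hg1 : ∀ θ' < Θ, g θ' ≤ 1 := fun θ' hθ' => by
    rw [← (hx θ' hθ').2]
    refine sum_le_sum fun a' ha' => ?_
    rw [mem_range] at ha'
    exact mul_le_of_le_one_right ((hx θ' hθ').1 a' ha') (hw1 θ' hθ' a' ha')
  have hrep : ∀ θ' < Θ,
      wtReport A (fun θ θ' a' a => V θ θ' a' a * (1 + η * (x θ' a' * u θ a))) θ θ' ≤
        wtReport A V θ θ' * (1 + η * g θ' + η ^ 2) := by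
    intro θ' hθ'
    have h1 : wtReport A (fun θ θ' a' a => V θ θ' a' a * (1 + η * (x θ' a' * u θ a))) θ θ' ≤
        ∏ a' ∈ range A, (wtSum A V θ θ' a' * Real.exp (η * (x θ' a' * w θ' a'))) := by
      refine prod_le_prod (fun a' ha' => sum_nonneg fun a ha => ?_) fun a' ha' => ?_
      · rw [mem_range] at ha ha'
        have h1 := (hV θ hθ θ' hθ' a' ha' a ha).le
        have h2 := (hu θ hθ a ha).1
        have h3 := (hx θ' hθ').1 a' ha'
        positivity
      · rw [mem_range] at ha'
        have hS := hV.sum_pos hθ hθ' ha'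
        have e : wtSum A (fun θ θ' a' a => V θ θ' a' a * (1 + η * (x θ' a' * u θ a))) θ θ' a' =
            wtSum A V θ θ' a' * (1 + η * (x θ' a' * w θ' a')) := by
          have : wtSum A V θ θ' a' * w θ' a' = ∑ a ∈ range A, V θ θ' a' a * u θ a :=
            mul_div_cancel₀ _ hS.ne'
          rw [mul_add, mul_one, show wtSum A V θ θ' a' * (η * (x θ' a' * w θ' a')) =
            η * x θ' a' * (wtSum A V θ θ' a' * w θ' a') by ring, this, mul_sum]
          unfold wtSum
          rw [← sum_add_distrib]
          exact sum_congr rfl fun a _ => by ring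
        rw [e]
        refine mul_le_mul_of_nonneg_left ?_ hS.le
        rw [add_comm]
        exact Real.add_one_le_exp _
    refine h1.trans ?_
    rw [prod_mul_distrib, ← Real.exp_sum, ← mul_sum]
    refine mul_le_mul_of_nonneg_left ?_ (hV.report_pos hθ hθ').le
    change Real.exp (η * g θ') ≤ _
    have h0 := hg0 θ' hθ'
    have h1 := hg1 θ' hθ'
    have h2 : η * g θ' ≤ 1 := mul_le_one₀ hη1 h0 h1
    have h3 := Real.abs_exp_sub_one_sub_id_le (x := η * g θ')
      (by rw [abs_of_nonneg (mul_nonneg hη h0)]; exact h2)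
    have h4 : (η * g θ') ^ 2 ≤ η ^ 2 := by
      rw [mul_pow]
      exact mul_le_of_le_one_right (sq_nonneg _) (pow_le_one₀ h0 h1)
    have := (abs_le.1 h3).2
    linarith
  have hZ := hV.total_pos hθ
  have happ : wtTotal Θ A V θ * ∑ a ∈ range A, app Θ A (wtKernel Θ A V) x θ a * u θ a =
      ∑ θ' ∈ range Θ, wtReport A V θ θ' * g θ' := by
    simp only [app, sum_mul]
    rw [sum_comm, mul_sum]
    refine sum_congr rfl fun θ' hθ' => ?_
    rw [sum_comm, hg, mul_sum, mul_sum]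
    refine sum_congr rfl fun a' ha' => ?_
    rw [hw]
    simp only [wtKernel]
    rw [sum_div, mul_sum, mul_sum, mul_sum]
    refine sum_congr rfl fun a _ => ?_
    field_simp
  calc wtTotal Θ A (fun θ θ' a' a => V θ θ' a' a * (1 + η * (x θ' a' * u θ a))) θ
      ≤ ∑ θ' ∈ range Θ, wtReport A V θ θ' * (1 + η * g θ' + η ^ 2) :=
        sum_le_sum fun θ' hθ' => hrep θ' (mem_range.1 hθ')
    _ = wtTotal Θ A V θ *
        ((η * ∑ a ∈ range A, app Θ A (wtKernel Θ A V) x θ a * u θ a + η ^ 2) + 1) := by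
        have : wtTotal Θ A V θ *
          ((η * ∑ a ∈ range A, app Θ A (wtKernel Θ A V) x θ a * u θ a + η ^ 2) + 1) =
          η * (wtTotal Θ A V θ * ∑ a ∈ range A, app Θ A (wtKernel Θ A V) x θ a * u θ a) +
          wtTotal Θ A V θ * (1 + η ^ 2) := by ring
        rw [this, happ, wtTotal, mul_sum, sum_mul, ← sum_add_distrib]
        exact sum_congr rfl fun θ' _ => by ring
    _ ≤ _ := mul_le_mul_of_nonneg_left (Real.add_one_le_exp _) hZ.le

lemma exp_sub_sq_le {z : ℝ} (hz : 0 ≤ z) : Real.exp (z - z ^ 2) ≤ 1 + z := by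
  have h1 : z - z ^ 2 ≤ z / (1 + z) := by
    rw [le_div_iff₀ (by linarith)]
    nlinarith [pow_nonneg hz 3]
  have h2 := Real.add_one_le_exp (-(z / (1 + z)))
  have h3 : -(z / (1 + z)) + 1 = (1 + z)⁻¹ := by
    field_simp
    ring
  rw [h3, Real.exp_neg] at h2
  exact (Real.exp_le_exp.2 h1).trans ((inv_le_inv₀ (by linarith) (Real.exp_pos _)).1 h2)

variable {H : ℝ} {y u : ℕ → ℕ → ℕ → ℝ} {T : ℕ}

lemma wt_pos (hH : 0 < H) (hy : ∀ t < T, IsStrat Θ A (y t))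
    (hu : ∀ t < T, ∀ θ < Θ, ∀ a < A, 0 ≤ u t θ a ∧ u t θ a ≤ 1) : WtPos Θ A (wt H y u T) := by
  intro θ hθ θ' hθ' a' ha' a ha
  refine prod_pos fun s hs => ?_
  rw [mem_range] at hs
  have h1 := (hy s hs θ' hθ').1 a' ha'
  have h2 := (hu s hs θ hθ a ha).1
  positivity

/-- In comparison with a fixed report `θ'` and a fixed map `φ` from recommendations to actions, the
random deviations in proportion to the weights have small regret. -/
theorem regret_le (hH : 1 ≤ H) (hy : ∀ t < T, IsStrat Θ A (y t))
    (hu : ∀ t < T, ∀ θ < Θ, ∀ a < A, 0 ≤ u t θ a ∧ u t θ a ≤ 1) {θ θ' : ℕ} (hθ : θ < Θ)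
    (hθ' : θ' < Θ) {φ : ℕ → ℕ} (hφ : ∀ a < A, φ a < A) :
    ∑ t ∈ range T, ∑ a ∈ range A, y t θ' a * u t θ (φ a) ≤
      ∑ t ∈ range T, ∑ a ∈ range A, app Θ A (wtKernel Θ A (wt H y u t)) (y t) θ a * u t θ a +
        (Θ + A * A) * H + 2 * T / H := by
  have hH0 : 0 < H := by linarith
  set η : ℝ := H⁻¹ with hη
  have hη0 : 0 < η := inv_pos.2 hH0
  have hη1 : η ≤ 1 := inv_le_one_of_one_le₀ hH
  set D := ∑ t ∈ range T, ∑ a ∈ range A, y t θ' a * u t θ (φ a) with hD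
  set R : ℕ → ℝ := fun t =>
    ∑ a ∈ range A, app Θ A (wtKernel Θ A (wt H y u t)) (y t) θ a * u t θ a with hR
  have hup : ∀ t ≤ T, wtTotal Θ A (wt H y u t) θ ≤
      Real.exp (Θ + A * A) * Real.exp (∑ s ∈ range t, (η * R s + η ^ 2)) := by
    intro t
    induction t with
    | zero =>
      intro _
      have h1 : wtTotal Θ A (wt H y u 0) θ = Θ * (A : ℝ) ^ A := by
        simp [wtTotal, wtReport, wtSum, wt]
      rw [h1, range_zero, sum_empty, Real.exp_zero, mul_one, Real.exp_add, Real.exp_nat_mul]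
      have h2 : ∀ m : ℕ, (m : ℝ) ≤ Real.exp m := fun m => by
        have := Real.add_one_le_exp (m : ℝ)
        linarith
      exact mul_le_mul (h2 Θ) (pow_le_pow_left₀ (Nat.cast_nonneg _) (h2 A) A) (by positivity)
        (by positivity)
    | succ t ih =>
      intro ht
      have hV := wt_pos hH0 (fun s hs => hy s (by omega)) (fun s hs => hu s (by omega)) (T := t)
      have h1 : wt H y u (t + 1) =
          fun θ θ' a' a => wt H y u t θ θ' a' a * (1 + η * (y t θ' a' * u t θ a)) := by
        funext θ θ' a' a
        rw [wt, prod_range_succ, hη, div_eq_inv_mul]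
        rfl
      rw [h1, sum_range_succ, Real.exp_add (∑ s ∈ range t, (η * R s + η ^ 2)), ← mul_assoc]
      exact (hV.total_update_le (hy t ht) (hu t ht) hη0.le hη1 hθ).trans
        (mul_le_mul_of_nonneg_right (ih (by omega)) (Real.exp_pos _).le)
  have hV := wt_pos hH0 hy hu
  have hlow : Real.exp (η * D - T * η ^ 2) ≤ wtTotal Θ A (wt H y u T) θ := by
    have h1 : wtReport A (wt H y u T) θ θ' ≤ wtTotal Θ A (wt H y u T) θ :=
      single_le_sum (f := fun θ' => wtReport A (wt H y u T) θ θ')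
        (fun θ' hθ' => (hV.report_pos hθ (mem_range.1 hθ')).le) (mem_range.2 hθ')
    refine le_trans ?_ h1
    have h2 : ∏ a' ∈ range A, wt H y u T θ θ' a' (φ a') ≤ wtReport A (wt H y u T) θ θ' := by
      refine prod_le_prod (fun a' ha' => ?_) fun a' ha' => ?_
      · rw [mem_range] at ha'
        exact (hV θ hθ θ' hθ' a' ha' _ (hφ a' ha')).le
      · rw [mem_range] at ha'
        exact single_le_sum (f := fun a => wt H y u T θ θ' a' a)
          (fun a ha => (hV θ hθ θ' hθ' a' ha' a (mem_range.1 ha)).le) (mem_range.2 (hφ a' ha'))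
    refine le_trans ?_ h2
    have h3 : ∏ a' ∈ range A, ∏ t ∈ range T, Real.exp (η * (y t θ' a' * u t θ (φ a')) -
        (η * (y t θ' a' * u t θ (φ a'))) ^ 2) ≤ ∏ a' ∈ range A, wt H y u T θ θ' a' (φ a') := by
      refine prod_le_prod (fun a' _ => prod_nonneg fun t _ => (Real.exp_pos _).le) fun a' ha' =>
        prod_le_prod (fun t _ => (Real.exp_pos _).le) fun t ht => ?_
      rw [mem_range] at ha' ht
      have h1 := (hy t ht θ' hθ').1 a' ha'
      have h2 := (hu t ht θ hθ _ (hφ a' ha')).1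
      have := exp_sub_sq_le (z := η * (y t θ' a' * u t θ (φ a'))) (by positivity)
      rwa [div_eq_inv_mul]
    refine le_trans ?_ h3
    simp only [← Real.exp_sum]
    rw [Real.exp_le_exp, sum_comm, hD, mul_sum, ← nsmul_eq_mul, ← card_range T,
      ← sum_const, card_range, ← sum_sub_distrib]
    refine sum_le_sum fun t ht => ?_
    rw [mem_range] at ht
    rw [sum_sub_distrib, ← mul_sum]
    refine sub_le_sub_left ?_ _
    calc ∑ a ∈ range A, (η * (y t θ' a * u t θ (φ a))) ^ 2 ≤ ∑ a ∈ range A, η ^ 2 * y t θ' a := by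
          refine sum_le_sum fun a ha => ?_
          have h1 := (hy t ht θ' hθ').1 a (mem_range.1 ha)
          have h2 := hu t ht θ hθ _ (hφ a (mem_range.1 ha))
          have h3 : y t θ' a ≤ 1 := by
            rw [← (hy t ht θ' hθ').2]
            exact single_le_sum (f := y t θ')
              (fun b hb => (hy t ht θ' hθ').1 b (mem_range.1 hb)) ha
          rw [mul_pow]
          refine mul_le_mul_of_nonneg_left ?_ (sq_nonneg _)
          have h4 : y t θ' a * u t θ (φ a) ≤ y t θ' a := mul_le_of_le_one_right h1 h2.2
          have h5 : 0 ≤ y t θ' a * u t θ (φ a) := mul_nonneg h1 h2.1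
          nlinarith
      _ = η ^ 2 := by rw [← mul_sum, (hy t ht θ' hθ').2, mul_one]
  have h := hlow.trans (hup T le_rfl)
  rw [← Real.exp_add, Real.exp_le_exp, sum_add_distrib, ← mul_sum, sum_const, card_range,
    nsmul_eq_mul] at h
  have h5 : H * (η * D - T * η ^ 2) ≤ H * (Θ + A * A + (η * ∑ t ∈ range T, R t + T * η ^ 2)) :=
    mul_le_mul_of_nonneg_left h hH0.le
  have h6 : H * η = 1 := mul_inv_cancel₀ hH0.ne'
  have e1 : H * (η * D - T * η ^ 2) = D - T * η := by
    linear_combination (D - T * η) * h6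
  have e2 : H * (Θ + A * A + (η * ∑ t ∈ range T, R t + T * η ^ 2)) =
      (Θ + A * A) * H + ∑ t ∈ range T, R t + T * η := by
    linear_combination (∑ t ∈ range T, R t + T * η) * h6
  rw [e1, e2] at h5
  have e3 : 2 * (T : ℝ) / H = 2 * (T * η) := by rw [hη, div_eq_mul_inv, mul_assoc]
  rw [e3]
  linarith

end Regret

/-! ### Rounding a distribution to a grid -/

section Rounding

open Finset

/-- The action drawn by the grid point `m`, if `c` is the cumulative distribution function scaled
by the number of grid points. -/
def draw (A : ℕ) (c : ℕ → ℝ) (m : ℕ) : ℕ := #{b ∈ range A | c (b + 1) ≤ m}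

open Classical in
/-- The probability of the action `a` if the grid point is uniformly distributed. -/
def rounded (K : ℕ) (c : ℕ → ℝ) (a : ℕ) : ℝ :=
  ∑ m ∈ range K, if (m : ℝ) < c a then 0 else if (m : ℝ) < c (a + 1) then 1 / (K : ℝ) else 0

variable {A K : ℕ} {c : ℕ → ℝ}

lemma mono_of_le_succ (hc : ∀ a < A, c a ≤ c (a + 1)) {a b : ℕ} (hab : a ≤ b) (hb : b ≤ A) :
    c a ≤ c b := by
  induction b with
  | zero => rw [Nat.le_zero.1 hab]
  | succ b ih =>
    rcases Nat.le_succ_iff.1 hab with h | h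
    · exact (ih h (by omega)).trans (hc b (by omega))
    · rw [h]

lemma draw_eq (hc : ∀ a < A, c a ≤ c (a + 1)) {a m : ℕ} (ha : a < A) (h : c a ≤ m)
    (h' : (m : ℝ) < c (a + 1)) : draw A c m = a := by
  rw [draw, ← card_range a]
  congr 1
  ext b
  rw [mem_filter, mem_range, mem_range]
  constructor
  · rintro ⟨hb, hbm⟩
    by_contra hab
    exact (hbm.trans_lt h').not_ge (mono_of_le_succ hc (by omega) hb)
  · exact fun hb => ⟨hb.trans ha, (mono_of_le_succ hc (by omega) ha.le).trans h⟩

lemma exists_cell (h0 : c 0 = 0) (hA : c A = K) {m : ℕ} (hm : m < K) :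
    ∃ a < A, c a ≤ m ∧ (m : ℝ) < c (a + 1) := by
  by_contra! h
  have : ∀ a ≤ A, c a ≤ m := by
    intro a
    induction a with
    | zero => exact fun _ => by rw [h0]; positivity
    | succ a ih => exact fun ha => h a ha (ih (by omega))
  have h1 := this A le_rfl
  rw [hA] at h1
  exact absurd (Nat.cast_le.1 h1) (by omega)

lemma draw_lt (h0 : c 0 = 0) (hA : c A = K) (hc : ∀ a < A, c a ≤ c (a + 1)) {m : ℕ}
    (hm : m < K) : draw A c m < A := by
  obtain ⟨a, ha, h1, h2⟩ := exists_cell h0 hA hm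
  rwa [draw_eq hc ha h1 h2]

lemma draw_eq_iff (h0 : c 0 = 0) (hA : c A = K) (hc : ∀ a < A, c a ≤ c (a + 1)) {m a : ℕ}
    (hm : m < K) (ha : a < A) : draw A c m = a ↔ c a ≤ m ∧ (m : ℝ) < c (a + 1) := by
  refine ⟨fun h => ?_, fun h => draw_eq hc ha h.1 h.2⟩
  obtain ⟨b, hb, h1, h2⟩ := exists_cell h0 hA hm
  rw [draw_eq hc hb h1 h2] at h
  rw [← h]
  exact ⟨h1, h2⟩

lemma rounded_eq_card (K : ℕ) (c : ℕ → ℝ) (a : ℕ) :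
    rounded K c a = #{m ∈ range K | c a ≤ (m : ℕ) ∧ ((m : ℕ) : ℝ) < c (a + 1)} / (K : ℝ) := by
  classical
  rw [rounded, div_eq_mul_one_div (Nat.cast _), ← nsmul_eq_mul, ← sum_const, sum_filter]
  refine sum_congr rfl fun m _ => ?_
  by_cases h1 : (m : ℝ) < c a
  · simp [h1]
  · simp [not_lt.1 h1]

lemma rounded_eq (h0 : c 0 = 0) (hA : c A = K) (hc : ∀ a < A, c a ≤ c (a + 1)) {a : ℕ}
    (ha : a < A) : rounded K c a = #{m ∈ range K | draw A c m = a} / (K : ℝ) := by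
  rw [rounded_eq_card]
  congr 3
  ext m
  simp only [mem_filter, mem_range]
  exact and_congr_right fun hm => (draw_eq_iff h0 hA hc hm ha).symm

lemma rounded_nonneg (K : ℕ) (c : ℕ → ℝ) (a : ℕ) : 0 ≤ rounded K c a := by
  rw [rounded_eq_card]
  positivity

lemma sum_rounded (hK : 0 < K) (h0 : c 0 = 0) (hA : c A = K) (hc : ∀ a < A, c a ≤ c (a + 1)) :
    ∑ a ∈ range A, rounded K c a = 1 := by
  rw [sum_congr rfl fun a ha => rounded_eq h0 hA hc (mem_range.1 ha), ← sum_div, ← Nat.cast_sum,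
    ← card_eq_sum_card_fiberwise fun m hm => ?_, card_range, div_self (by positivity)]
  simpa using draw_lt h0 hA hc (by simpa using hm)

/-- Rounding changes every probability by at most the mesh of the grid. -/
lemma abs_rounded_sub_le (h0 : c 0 = 0) (hA : c A = K) (hc : ∀ a < A, c a ≤ c (a + 1)) {a : ℕ}
    (ha : a < A) : |rounded K c a - (c (a + 1) - c a) / K| ≤ 1 / K := by
  have hp : 0 ≤ c a := h0 ▸ mono_of_le_succ hc (Nat.zero_le a) ha.le
  have hpq : c a ≤ c (a + 1) := hc a ha
  have hq : c (a + 1) ≤ K := hA ▸ mono_of_le_succ hc ha le_rfl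
  have : ({m ∈ range K | c a ≤ (m : ℕ) ∧ ((m : ℕ) : ℝ) < c (a + 1)} : Finset ℕ) =
      Ico ⌈c a⌉₊ ⌈c (a + 1)⌉₊ := by
    ext m
    rw [mem_filter, mem_range, mem_Ico, Nat.ceil_le, Nat.lt_ceil]
    exact ⟨fun h => h.2, fun h => ⟨by exact_mod_cast h.2.trans_le hq, h⟩⟩
  rw [rounded_eq_card, this, Nat.card_Ico, Nat.cast_sub (Nat.ceil_mono hpq), ← sub_div, abs_div,
    Nat.abs_cast]
  gcongr
  have h1 := Nat.le_ceil (c a)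
  have h2 := Nat.ceil_lt_add_one hp
  have h3 := Nat.le_ceil (c (a + 1))
  have h4 := Nat.ceil_lt_add_one (hp.trans hpq)
  rw [abs_le]
  constructor <;> linarith

/-- Drawing the action of a uniform grid point amounts to drawing from the rounded
distribution. -/
lemma sum_draw (hK : 0 < K) (h0 : c 0 = 0) (hA : c A = K) (hc : ∀ a < A, c a ≤ c (a + 1))
    (g : ℕ → ℝ≥0∞) : (∑ m ∈ range K, g (draw A c m)) / K =
      ∑ a ∈ range A, ENNReal.ofReal (rounded K c a) * g a := by
  rw [← sum_fiberwise_of_maps_to (t := range A) (g := draw A c) fun m hm => ?_,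
    div_eq_mul_inv, sum_mul]
  · refine sum_congr rfl fun a ha => ?_
    rw [sum_congr rfl fun m hm => by rw [(mem_filter.1 hm).2], sum_const,
      rounded_eq h0 hA hc (mem_range.1 ha), ENNReal.ofReal_div_of_pos (by positivity),
      ENNReal.ofReal_natCast, ENNReal.ofReal_natCast, nsmul_eq_mul, div_eq_mul_inv, mul_right_comm]
  · exact mem_range.2 (draw_lt h0 hA hc (mem_range.1 hm))

end Rounding

/-! ### Concentration of sample means -/

section Concentration

open Finset

variable {Ω : Type*} [Fintype Ω] {W : Ω → ℝ≥0∞}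

lemma sum_toReal_eq_one (hW : ∑ ω, W ω = 1) : ∑ ω, (W ω).toReal = 1 := by
  rw [← ENNReal.toReal_sum fun ω _ => ?_, hW, ENNReal.toReal_one]
  exact (lt_of_le_of_lt (single_le_sum (f := W) (fun _ _ => zero_le) (mem_univ ω))
    (by rw [hW]; exact ENNReal.one_lt_top)).ne

lemma sum_mul_ofReal (hW : ∑ ω, W ω = 1) {f : Ω → ℝ} (hf : ∀ ω, 0 ≤ f ω) :
    ∑ ω, W ω * ENNReal.ofReal (f ω) = ENNReal.ofReal (∑ ω, (W ω).toReal * f ω) := by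
  rw [ENNReal.ofReal_sum_of_nonneg fun ω _ => mul_nonneg ENNReal.toReal_nonneg (hf ω)]
  refine sum_congr rfl fun ω _ => ?_
  rw [ENNReal.ofReal_mul ENNReal.toReal_nonneg, ENNReal.ofReal_toReal]
  exact (lt_of_le_of_lt (single_le_sum (f := W) (fun _ _ => zero_le) (mem_univ ω))
    (by rw [hW]; exact ENNReal.one_lt_top)).ne

lemma sum_exp_le (hW : ∑ ω, W ω = 1) {X : Ω → ℝ} (hX : ∀ ω, 0 ≤ X ω ∧ X ω ≤ 1) {l : ℝ}
    (hl : |l| ≤ 1) :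
    ∑ ω, W ω * ENNReal.ofReal (Real.exp (l * X ω)) ≤
      ENNReal.ofReal (Real.exp (l * ∑ ω, (W ω).toReal * X ω + l ^ 2)) := by
  rw [sum_mul_ofReal hW fun ω => (Real.exp_pos _).le]
  refine ENNReal.ofReal_le_ofReal ?_
  calc ∑ ω, (W ω).toReal * Real.exp (l * X ω)
      ≤ ∑ ω, (W ω).toReal * (1 + l * X ω + l ^ 2) := by
        refine sum_le_sum fun ω _ => mul_le_mul_of_nonneg_left ?_ ENNReal.toReal_nonneg
        obtain ⟨h0, h1⟩ := hX ω
        have h2 : |l * X ω| ≤ 1 := by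
          rw [abs_mul, abs_of_nonneg h0]
          exact mul_le_one₀ hl h0 h1
        have h3 := (abs_le.1 (Real.abs_exp_sub_one_sub_id_le h2)).2
        have h4 : (l * X ω) ^ 2 ≤ l ^ 2 := by
          rw [mul_pow]
          exact mul_le_of_le_one_right (sq_nonneg _) (pow_le_one₀ h0 h1)
        linarith
    _ = (l * ∑ ω, (W ω).toReal * X ω + l ^ 2) + 1 := by
        simp only [mul_add, sum_add_distrib, mul_one, sum_toReal_eq_one hW, ← sum_mul, mul_sum]
        rw [sum_congr rfl fun ω _ => mul_left_comm (W ω).toReal l (X ω)]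
        ring
    _ ≤ _ := Real.add_one_le_exp _

variable (W) in
/-- The experiment that draws `ω` and adds the fraction `1 / M` of the values `X ω` to the
accumulators. -/
def sampleExp (X : Ω → ℕ → ℝ) (M : ℝ) (_ : ℕ) (acc : ℕ → ℝ) (g : (ℕ → ℝ) → ℝ≥0∞) : ℝ≥0∞ :=
  ∑ ω, W ω * g fun a => acc a + X ω a / M

variable {X : Ω → ℕ → ℝ} {M : ℝ}

lemma iterExp_sample_mono {g g' : (ℕ → ℝ) → ℝ≥0∞} (h : ∀ acc, g acc ≤ g' acc) (j m : ℕ)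
    (acc : ℕ → ℝ) :
    iterExp (sampleExp W X M) j m acc g ≤ iterExp (sampleExp W X M) j m acc g' := by
  induction m generalizing j acc with
  | zero => exact h acc
  | succ m ih => exact sum_le_sum fun ω _ => mul_le_mul_right (ih _ _) _

lemma iterExp_sample_const (hW : ∑ ω, W ω = 1) (r : ℝ≥0∞) (j m : ℕ) (acc : ℕ → ℝ) :
    iterExp (sampleExp W X M) j m acc (fun _ => r) = r := by
  induction m generalizing j acc with
  | zero => rfl
  | succ m ih => simp only [iterExp, sampleExp, ih, ← sum_mul, hW, one_mul]

lemma iterExp_sample_add (g g' : (ℕ → ℝ) → ℝ≥0∞) (j m : ℕ) (acc : ℕ → ℝ) :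
    iterExp (sampleExp W X M) j m acc (fun acc => g acc + g' acc) =
      iterExp (sampleExp W X M) j m acc g + iterExp (sampleExp W X M) j m acc g' := by
  induction m generalizing j acc with
  | zero => rfl
  | succ m ih => simp only [iterExp, sampleExp, ih, ← sum_add_distrib, mul_add]

lemma iterExp_sample_sum (s : Finset ℕ) (g : ℕ → (ℕ → ℝ) → ℝ≥0∞) (j m : ℕ) (acc : ℕ → ℝ) :
    iterExp (sampleExp W X M) j m acc (fun acc => ∑ a ∈ s, g a acc) =
      ∑ a ∈ s, iterExp (sampleExp W X M) j m acc (g a) := by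
  induction m generalizing j acc with
  | zero => rfl
  | succ m ih =>
    simp only [iterExp, sampleExp, ih, mul_sum]
    exact sum_comm

lemma iterExp_sample_exp_le (hW : ∑ ω, W ω = 1) (hX : ∀ ω a, 0 ≤ X ω a ∧ X ω a ≤ 1) (hM : 0 < M)
    {l : ℝ} (hl : |l| ≤ 1) (C : ℝ) (a : ℕ) (j m : ℕ) (acc : ℕ → ℝ) :
    iterExp (sampleExp W X M) j m acc
        (fun acc => ENNReal.ofReal (Real.exp (l * (M * acc a) + C))) ≤
      ENNReal.ofReal (Real.exp (l * (M * acc a) + C +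
        m * (l * ∑ ω, (W ω).toReal * X ω a + l ^ 2))) := by
  induction m generalizing j acc with
  | zero => simp [iterExp]
  | succ m ih =>
    simp only [iterExp, sampleExp]
    set q := l * ∑ ω, (W ω).toReal * X ω a + l ^ 2 with hq
    calc _ ≤ ∑ ω, W ω * (ENNReal.ofReal (Real.exp (l * (M * acc a) + C + m * q)) *
          ENNReal.ofReal (Real.exp (l * X ω a))) := by
          refine sum_le_sum fun ω _ => mul_le_mul_right ((ih _ _).trans_eq ?_) _
          rw [← ENNReal.ofReal_mul (Real.exp_pos _).le, ← Real.exp_add]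
          congr 2
          field_simp
          ring
      _ = ENNReal.ofReal (Real.exp (l * (M * acc a) + C + m * q)) *
          ∑ ω, W ω * ENNReal.ofReal (Real.exp (l * X ω a)) := by
          rw [mul_sum]
          exact sum_congr rfl fun ω _ => mul_left_comm _ _ _
      _ ≤ ENNReal.ofReal (Real.exp (l * (M * acc a) + C + m * q)) *
          ENNReal.ofReal (Real.exp q) := mul_le_mul_right (sum_exp_le hW (hX · a) hl) _
      _ = _ := by
          rw [← ENNReal.ofReal_mul (Real.exp_pos _).le, ← Real.exp_add]
          congr 2
          push_cast
          ring

open Classical in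
/-- Some of `A` sample means of size `M` differs by more than `1 / H` from its expected value with
exponentially small probability only. -/
lemma iterExp_sample_bad_le (hW : ∑ ω, W ω = 1) (hX : ∀ ω a, 0 ≤ X ω a ∧ X ω a ≤ 1) {M : ℕ}
    (hM : 0 < M) {H : ℝ} (hH : 1 ≤ H) (A : ℕ) (r : ℝ≥0∞) :
    iterExp (sampleExp W X M) 0 M (fun _ => 0)
        (fun acc => r + if ∃ a < A, 1 / H < |acc a - ∑ ω, (W ω).toReal * X ω a| then 1 else 0) ≤
      r + A * (2 * ENNReal.ofReal (Real.exp (-(M / (4 * H ^ 2))))) := by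
  have hH0 : 0 < H := by linarith
  have hM' : (0 : ℝ) < M := by exact_mod_cast hM
  set l : ℝ := 1 / (2 * H) with hl
  have hl0 : 0 < l := by positivity
  have hl1 : |l| ≤ 1 := by
    rw [abs_of_pos hl0, hl, div_le_one (by positivity)]
    linarith
  set p : ℕ → ℝ := fun a => ∑ ω, (W ω).toReal * X ω a with hp
  -- the exponential moments of the deviations to both sides
  set up : ℕ → (ℕ → ℝ) → ℝ≥0∞ := fun a acc =>
    ENNReal.ofReal (Real.exp (l * (M * acc a) + (-(l * M * p a) - l * M / H))) with hup
  set dn : ℕ → (ℕ → ℝ) → ℝ≥0∞ := fun a acc =>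
    ENNReal.ofReal (Real.exp (-l * (M * acc a) + (l * M * p a - l * M / H))) with hdn
  have h1 : ∀ acc : ℕ → ℝ, (r + if ∃ a < A, 1 / H < |acc a - p a| then 1 else 0) ≤
      r + ∑ a ∈ range A, (up a acc + dn a acc) := by
    intro acc
    gcongr
    split_ifs with h
    · obtain ⟨a, ha, hb⟩ := h
      refine le_trans ?_ (single_le_sum (f := fun a => up a acc + dn a acc)
        (fun _ _ => zero_le) (mem_range.2 ha))
      have hlM : 0 < l * M := by positivity
      rcases lt_abs.1 hb with hb | hb
      · refine le_trans ?_ le_self_add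
        rw [hup, ← ENNReal.ofReal_one]
        refine ENNReal.ofReal_le_ofReal (Real.one_le_exp ?_)
        have := mul_le_mul_of_nonneg_left hb.le hlM.le
        have e : l * M * (1 / H) = l * M / H := by ring
        linarith
      · refine le_trans ?_ le_add_self
        rw [hdn, ← ENNReal.ofReal_one]
        refine ENNReal.ofReal_le_ofReal (Real.one_le_exp ?_)
        have := mul_le_mul_of_nonneg_left hb.le hlM.le
        have e : l * M * (1 / H) = l * M / H := by ring
        linarith
    · exact zero_le
  refine (iterExp_sample_mono h1 _ _ _).trans ?_
  rw [iterExp_sample_add, iterExp_sample_const hW, iterExp_sample_sum]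
  gcongr
  rw [← nsmul_eq_mul, ← card_range A, ← sum_const, card_range]
  refine sum_le_sum fun a _ => ?_
  rw [iterExp_sample_add, two_mul]
  have hexp : (M : ℝ) * l ^ 2 - l * M / H = -(M / (4 * H ^ 2)) := by
    rw [hl]
    field_simp
    ring
  refine add_le_add ?_ ?_
  · refine (iterExp_sample_exp_le hW hX hM' hl1 _ a 0 M _).trans (le_of_eq ?_)
    congr 2
    rw [← hexp]
    ring
  · refine (iterExp_sample_exp_le hW hX hM' (by rwa [abs_neg]) _ a 0 M _).trans (le_of_eq ?_)
    congr 2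
    rw [← hexp]
    ring

end Concentration

/-! ### From small regret to communication equilibria -/

section Equilibrium

open Finset

variable {n : ℕ} (G : BayesianGame n)

/-- The probability of the action profile `a` if the players of the types `θ` draw their actions
independently from their strategies `Y`. -/
def indep (Y : ℕ → ℕ → ℕ → ℝ) (θ : G.Types) (a : G.Actions) : ℝ :=
  ∏ j : Fin n, Y j (θ j) (a j)

/-- The probability of the outcome `(θ, a)` if the types of the others are sampled conditionally on
player `i` having type `t`, and the actions are then drawn independently. -/
def sampleWeight (κ : ∀ i : Fin n, Fin (G.numTypes i) → PMF G.Types) (Y : ℕ → ℕ → ℕ → ℝ)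
    (i : Fin n) (t : Fin (G.numTypes i)) (ω : G.Types × G.Actions) : ℝ≥0∞ :=
  κ i t ω.1 * ∏ j : Fin n, ENNReal.ofReal (Y j (Function.update ω.1 i t j) (ω.2 j))

/-- The payoff of player `i`, having type `t` and playing `b`, at the sampled outcome; the value is
`0` if `b` is not an action. -/
def sampleValue (i : Fin n) (t : Fin (G.numTypes i)) (ω : G.Types × G.Actions) (b : ℕ) : ℝ :=
  if h : b < G.numActions i then
    G.utility i (Function.update ω.1 i t) (Function.update ω.2 i ⟨b, h⟩) else 0

/-- The conditional expectation of the payoff of player `i` given the type `t` and the action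
`b`. -/
def condPayoff (κ : ∀ i : Fin n, Fin (G.numTypes i) → PMF G.Types) (Y : ℕ → ℕ → ℕ → ℝ)
    (i : Fin n) (t : Fin (G.numTypes i)) (b : ℕ) : ℝ :=
  ∑ ω, (sampleWeight G κ Y i t ω).toReal * sampleValue G i t ω b

/-- `Y` consists of strategies of all players. -/
def IsProfile (Y : ℕ → ℕ → ℕ → ℝ) : Prop :=
  ∀ j : Fin n, IsStrat (G.numTypes j) (G.numActions j) (Y j)

variable {G} {κ : ∀ i : Fin n, Fin (G.numTypes i) → PMF G.Types} {Y : ℕ → ℕ → ℕ → ℝ}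

lemma sampleValue_mem (i : Fin n) (t : Fin (G.numTypes i)) (ω : G.Types × G.Actions) (b : ℕ) :
    0 ≤ sampleValue G i t ω b ∧ sampleValue G i t ω b ≤ 1 := by
  unfold sampleValue
  split_ifs
  · exact G.utility_mem _ _ _
  · norm_num

lemma IsProfile.nonneg (hY : IsProfile G Y) (j : Fin n) (t : Fin (G.numTypes j))
    (a : Fin (G.numActions j)) : 0 ≤ Y j t a :=
  (hY j t t.2).1 a a.2

lemma IsProfile.sum_eq (hY : IsProfile G Y) (j : Fin n) (t : Fin (G.numTypes j)) :
    ∑ a : Fin (G.numActions j), Y j t a = 1 := by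
  rw [← (hY j t t.2).2, sum_range]

lemma IsProfile.indep_nonneg (hY : IsProfile G Y) (θ : G.Types) (a : G.Actions) :
    0 ≤ indep G Y θ a :=
  prod_nonneg fun j _ => hY.nonneg j _ _

lemma IsProfile.sum_indep (hY : IsProfile G Y) (θ : G.Types) : ∑ a, indep G Y θ a = 1 := by
  unfold indep
  rw [← Fintype.prod_sum fun (j : Fin n) (a : Fin (G.numActions j)) => Y j (θ j) a]
  exact prod_eq_one fun j _ => hY.sum_eq j _

lemma sampleWeight_eq (hY : IsProfile G Y) (i : Fin n) (t : Fin (G.numTypes i))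
    (ω : G.Types × G.Actions) : sampleWeight G κ Y i t ω =
      κ i t ω.1 * ENNReal.ofReal (indep G Y (Function.update ω.1 i t) ω.2) := by
  rw [sampleWeight, indep, ENNReal.ofReal_prod_of_nonneg fun j _ => hY.nonneg j _ _]

lemma IsProfile.sum_sampleWeight (hY : IsProfile G Y) (i : Fin n) (t : Fin (G.numTypes i)) :
    ∑ ω, sampleWeight G κ Y i t ω = 1 := by
  rw [Fintype.sum_prod_type]
  simp only [sampleWeight_eq hY, ← mul_sum]
  have : ∀ θ : G.Types, ∑ a, ENNReal.ofReal (indep G Y (Function.update θ i t) a) = 1 := by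
    intro θ
    rw [← ENNReal.ofReal_sum_of_nonneg fun a _ => hY.indep_nonneg _ _, hY.sum_indep,
      ENNReal.ofReal_one]
  simp only [this, mul_one]
  exact (tsum_fintype (κ i t)).symm.trans (κ i t).tsum_coe

lemma condPayoff_eq (hY : IsProfile G Y) (i : Fin n) (t : Fin (G.numTypes i))
    (b : Fin (G.numActions i)) : condPayoff G κ Y i t b =
      ∑ θ, (κ i t θ).toReal * ∑ a, indep G Y (Function.update θ i t) a *
        G.utility i (Function.update θ i t) (Function.update a i b) := by
  rw [condPayoff, Fintype.sum_prod_type]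
  refine sum_congr rfl fun θ _ => ?_
  rw [mul_sum]
  refine sum_congr rfl fun a _ => ?_
  rw [sampleWeight_eq hY, ENNReal.toReal_mul, ENNReal.toReal_ofReal (hY.indep_nonneg _ _),
    sampleValue, dif_pos b.2, mul_assoc]

/-- The coordinate `i` of a random vector with independent coordinates may be drawn separately. -/
lemma sum_prod_update {ι : Type*} [Fintype ι] [DecidableEq ι] {β : ι → Type*}
    [∀ i, Fintype (β i)] (p : ∀ i, β i → ℝ) (i : ι) (hp : ∑ b, p i b = 1) (q : β i → ℝ)
    (f : β i → (∀ i, β i) → ℝ) (hf : ∀ b a c, f b (Function.update a i c) = f b a) :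
    ∑ a, (∏ j, Function.update p i q j (a j)) * f (a i) a =
      ∑ b, q b * ∑ a, (∏ j, p j (a j)) * f b a := by
  classical
  have hprod : ∀ (r : ∀ i, β i → ℝ) (a : ∀ i, β i),
      ∏ j, r j (a j) = r i (a i) * ∏ j ∈ univ.erase i, r j (a j) := fun r a =>
    (mul_prod_erase univ (fun j => r j (a j)) (mem_univ i)).symm
  -- exchanging the coordinate `i` with a separate draw
  let e : β i × (∀ i, β i) → β i × (∀ i, β i) := fun x => (x.2 i, Function.update x.2 i x.1)
  have he : Function.Involutive e := fun x => by
    simp [e]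
  calc ∑ a, (∏ j, Function.update p i q j (a j)) * f (a i) a
      = ∑ x : β i × (∀ i, β i), p i x.1 *
          ((∏ j, Function.update p i q j (x.2 j)) * f (x.2 i) x.2) := by
        rw [Fintype.sum_prod_type]
        simp only [← mul_sum]
        rw [← sum_mul, hp, one_mul]
    _ = ∑ x : β i × (∀ i, β i), q x.1 * ((∏ j, p j (x.2 j)) * f x.1 x.2) := by
        refine Fintype.sum_equiv he.toPerm _ _ fun x => ?_
        simp only [Function.Involutive.coe_toPerm, e, hf]
        rw [hprod, hprod p, Function.update_self, Function.update_self]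
        have : ∀ j ∈ univ.erase i, Function.update p i q j (x.2 j) =
            p j (Function.update x.2 i x.1 j) := fun j hj => by
          rw [Function.update_of_ne (ne_of_mem_erase hj),
            Function.update_of_ne (ne_of_mem_erase hj)]
        rw [prod_congr rfl this]
        ring
    _ = _ := by
        rw [Fintype.sum_prod_type]
        simp only [mul_sum]

/-- The marginal probability of the type `t` of player `i`. -/
def marginal (G : BayesianGame n) (i : Fin n) (t : Fin (G.numTypes i)) : ℝ :=
  ∑ θ : G.Types, if θ i = t then (G.prior θ).toReal else 0

lemma marginal_nonneg (i : Fin n) (t : Fin (G.numTypes i)) : 0 ≤ marginal G i t :=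
  sum_nonneg fun θ _ => by split_ifs <;> simp

lemma sum_prior : ∑ θ, (G.prior θ).toReal = 1 :=
  sum_toReal_eq_one ((tsum_fintype G.prior).symm.trans G.prior.tsum_coe)

lemma sum_marginal (i : Fin n) : ∑ t, marginal G i t = 1 := by
  unfold marginal
  rw [sum_comm, ← sum_prior (G := G)]
  exact sum_congr rfl fun θ _ => by simp

lemma marginal_mul (hκ : G.IsConditionalSampler κ) (i : Fin n) (t : Fin (G.numTypes i))
    (θ : G.Types) :
    marginal G i t * (κ i t θ).toReal = if θ i = t then (G.prior θ).toReal else 0 := by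
  classical
  have hm : marginal G i t = (∑' a, Set.indicator {θ : G.Types | θ i = t} G.prior a).toReal := by
    rw [tsum_fintype, ENNReal.toReal_sum, marginal]
    · refine sum_congr rfl fun a _ => ?_
      by_cases h : a i = t
      · rw [if_pos h, Set.indicator_of_mem (by exact h)]
      · rw [if_neg h, Set.indicator_of_notMem (by exact h), ENNReal.toReal_zero]
    · intro a _
      exact ne_top_of_le_ne_top (G.prior.apply_ne_top a) (Set.indicator_le_self _ _ a)
  by_cases hex : ∃ θ ∈ {θ : G.Types | θ i = t}, θ ∈ G.prior.support
  · rw [hκ i t hex, PMF.filter_apply, ENNReal.toReal_mul, ENNReal.toReal_inv, ← hm]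
    have h0 : marginal G i t ≠ 0 := by
      obtain ⟨θ₀, h₁, h₂⟩ := hex
      have h3 : 0 < (G.prior θ₀).toReal :=
        ENNReal.toReal_pos ((PMF.mem_support_iff _ _).1 h₂) (G.prior.apply_ne_top _)
      refine (h3.trans_le ?_).ne'
      have := single_le_sum (f := fun θ : G.Types => if θ i = t then (G.prior θ).toReal else 0)
        (fun θ _ => by split_ifs <;> simp) (mem_univ θ₀)
      simpa [show θ₀ i = t from h₁, marginal] using this
    rw [mul_comm, mul_assoc, inv_mul_cancel₀ h0, mul_one]
    by_cases h : θ i = t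
    · rw [if_pos h, Set.indicator_of_mem (by exact h)]
    · rw [if_neg h, Set.indicator_of_notMem (by exact h), ENNReal.toReal_zero]
  · have hz : ∀ a : G.Types, a i = t → G.prior a = 0 := fun a ha => by
      by_contra h
      exact hex ⟨a, ha, (PMF.mem_support_iff _ _).2 h⟩
    have h0 : marginal G i t = 0 := sum_eq_zero fun a _ => by
      split_ifs with h
      · rw [hz a h, ENNReal.toReal_zero]
      · rfl
    rw [h0, zero_mul]
    split_ifs with h
    · rw [hz θ h, ENNReal.toReal_zero]
    · rfl

lemma deviationPayoff_indep (hκ : G.IsConditionalSampler κ) (hY : IsProfile G Y) (i : Fin n)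
    (ψ : Fin (G.numTypes i) → Fin (G.numTypes i))
    (φ : Fin (G.numTypes i) → Fin (G.numActions i) → Fin (G.numActions i)) :
    G.deviationPayoff (indep G Y) i ψ φ =
      ∑ t, marginal G i t * ∑ b : Fin (G.numActions i),
        Y i (ψ t) b * condPayoff G κ Y i t (φ t b) := by
  classical
  -- the payoff of the action that `φ` substitutes for `b`, as a function of the types
  set V : Fin (G.numTypes i) → Fin (G.numActions i) → G.Types → ℝ := fun t b θ =>
    ∑ a, indep G Y θ a * G.utility i θ (Function.update a i (φ t b)) with hV
  have h1 : ∀ θ : G.Types, ∑ a, indep G Y (Function.update θ i (ψ (θ i))) a *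
      G.utility i θ (Function.update a i (φ (θ i) (a i))) =
        ∑ b : Fin (G.numActions i), Y i (ψ (θ i)) b * V (θ i) b θ := by
    intro θ
    have := sum_prod_update (fun (j : Fin n) (b : Fin (G.numActions j)) => Y j (θ j) b) i
      (hY.sum_eq i _) (fun b => Y i (ψ (θ i)) b)
      (fun b a => G.utility i θ (Function.update a i (φ (θ i) b))) (fun b a c => by simp)
    rw [hV]
    refine Eq.trans (sum_congr rfl fun a _ => ?_) this
    congr 1
    unfold indep
    refine prod_congr rfl fun j _ => ?_
    by_cases hj : j = i
    · subst hj
      simp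
    · simp [Function.update_of_ne hj]
  have h2 : ∀ θ : G.Types, (G.prior θ).toReal = ∑ t, marginal G i t * (κ i t θ).toReal := by
    intro θ
    simp [marginal_mul hκ]
  unfold BayesianGame.deviationPayoff
  calc ∑ θ : G.Types, (G.prior θ).toReal * ∑ a, indep G Y (Function.update θ i (ψ (θ i))) a *
        G.utility i θ (Function.update a i (φ (θ i) (a i)))
      = ∑ θ : G.Types, ∑ t, (if θ i = t then (G.prior θ).toReal else 0) *
          ∑ b : Fin (G.numActions i), Y i (ψ t) b * V t b (Function.update θ i t) := by
        refine sum_congr rfl fun θ _ => ?_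
        rw [h1]
        simp only [ite_mul, zero_mul]
        rw [sum_ite_eq, if_pos (mem_univ _), Function.update_eq_self]
    _ = ∑ t, marginal G i t * ∑ b : Fin (G.numActions i), Y i (ψ t) b *
          ∑ θ : G.Types, (κ i t θ).toReal * V t b (Function.update θ i t) := by
        rw [sum_comm]
        refine sum_congr rfl fun t _ => ?_
        simp only [← marginal_mul hκ, mul_assoc, ← mul_sum]
        congr 1
        simp only [mul_sum]
        rw [sum_comm]
        exact sum_congr rfl fun b _ => sum_congr rfl fun θ _ => mul_left_comm _ _ _
    _ = _ := by
        refine sum_congr rfl fun t _ => ?_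
        congr 1
        refine sum_congr rfl fun b _ => ?_
        rw [condPayoff_eq hY]

/-- The uniform mixture of `T` independent profiles. -/
def mixture (G : BayesianGame n) (T : ℕ) (Y : ℕ → ℕ → ℕ → ℕ → ℝ) (θ : G.Types)
    (a : G.Actions) : ℝ :=
  1 / (T : ℝ) * ∑ t ∈ range T, indep G (Y t) θ a

variable {T : ℕ} {Z : ℕ → ℕ → ℕ → ℕ → ℝ}

lemma deviationPayoff_mixture (i : Fin n) (ψ : Fin (G.numTypes i) → Fin (G.numTypes i))
    (φ : Fin (G.numTypes i) → Fin (G.numActions i) → Fin (G.numActions i)) :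
    G.deviationPayoff (mixture G T Z) i ψ φ =
      1 / (T : ℝ) * ∑ t ∈ range T, G.deviationPayoff (indep G (Z t)) i ψ φ := by
  simp only [BayesianGame.deviationPayoff, mixture, mul_sum, sum_mul]
  rw [sum_comm]
  simp only [sum_comm (s := range T)]
  rw [sum_comm]
  refine sum_congr rfl fun a _ => sum_congr rfl fun θ _ => sum_congr rfl fun t _ => ?_
  ring

lemma payoff_eq_deviationPayoff (π : G.Types → G.Actions → ℝ) (i : Fin n) :
    G.payoff π i = G.deviationPayoff π i id fun _ => id := by
  simp [BayesianGame.payoff, BayesianGame.deviationPayoff]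

lemma isTypewise_mixture (hT : 0 < T) (hZ : ∀ t < T, IsProfile G (Z t)) :
    G.IsTypewise (mixture G T Z) := by
  have hT' : (T : ℝ) ≠ 0 := by positivity
  refine fun θ => ⟨fun a => mul_nonneg (by positivity) (sum_nonneg fun t ht =>
    (hZ t (mem_range.1 ht)).indep_nonneg θ a), ?_⟩
  unfold mixture
  rw [← mul_sum, sum_comm, sum_congr rfl fun t ht => (hZ t (mem_range.1 ht)).sum_indep θ]
  simp [hT']

/-- No player gains by misreporting or disobeying in the mixture if no deviation has large
regret with respect to the conditional payoffs. -/
lemma isApproxCommEq_mixture (hκ : G.IsConditionalSampler κ) (hT : 0 < T)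
    (hZ : ∀ t < T, IsProfile G (Z t)) {ε : ℝ}
    (h : ∀ (i : Fin n) (s s' : Fin (G.numTypes i))
      (φ : Fin (G.numActions i) → Fin (G.numActions i)),
      ∑ t ∈ range T, ∑ b : Fin (G.numActions i),
          Z t i s' b * condPayoff G κ (Z t) i s (φ b) ≤
        ∑ t ∈ range T, ∑ b : Fin (G.numActions i),
          Z t i s b * condPayoff G κ (Z t) i s b + ε * T) :
    G.IsApproxCommEq ε (mixture G T Z) := by
  have hT' : (0 : ℝ) < T := by exact_mod_cast hT
  refine ⟨isTypewise_mixture hT hZ, fun i ψ φ => ?_⟩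
  rw [payoff_eq_deviationPayoff, deviationPayoff_mixture, deviationPayoff_mixture, ge_iff_le,
    sub_le_iff_le_add]
  have hexp : ∀ (ψ : Fin (G.numTypes i) → Fin (G.numTypes i))
      (φ : Fin (G.numTypes i) → Fin (G.numActions i) → Fin (G.numActions i)),
      ∑ t ∈ range T, G.deviationPayoff (indep G (Z t)) i ψ φ = ∑ s, marginal G i s *
        ∑ t ∈ range T, ∑ b : Fin (G.numActions i),
          Z t i (ψ s) b * condPayoff G κ (Z t) i s (φ s b) := by
    intro ψ φ
    rw [sum_congr rfl fun t ht => deviationPayoff_indep hκ (hZ t (mem_range.1 ht)) i ψ φ, sum_comm]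
    exact sum_congr rfl fun s _ => (mul_sum _ _ _).symm
  have h1 : ∑ t ∈ range T, G.deviationPayoff (indep G (Z t)) i ψ φ ≤
      ∑ t ∈ range T, G.deviationPayoff (indep G (Z t)) i id (fun _ => id) + ε * T := by
    rw [hexp, hexp]
    calc _ ≤ ∑ s, marginal G i s * (∑ t ∈ range T, ∑ b : Fin (G.numActions i),
            Z t i s b * condPayoff G κ (Z t) i s b + ε * T) :=
          sum_le_sum fun s _ => mul_le_mul_of_nonneg_left (h i s (ψ s) (φ s)) (marginal_nonneg i s)
      _ = _ := by
          simp only [mul_add, sum_add_distrib, ← sum_mul, sum_marginal, one_mul, id]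
  calc 1 / (T : ℝ) * ∑ t ∈ range T, G.deviationPayoff (indep G (Z t)) i ψ φ
      ≤ 1 / (T : ℝ) * (∑ t ∈ range T,
          G.deviationPayoff (indep G (Z t)) i id (fun _ => id) + ε * T) :=
        mul_le_mul_of_nonneg_left h1 (by positivity)
    _ = _ := by
        rw [mul_add]
        congr 1
        field_simp

/-- A mixture of independent profiles is induced by drawing a round and then, independently, an
action for every type of every player. -/
lemma strategyRepresentable_mixture (hT : 0 < T) (hZ : ∀ t < T, IsProfile G (Z t)) :
    G.StrategyRepresentable (mixture G T Z) := by
  classical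
  have hT' : (T : ℝ) ≠ 0 := by positivity
  set p : ℕ → G.Strategies → ℝ := fun t s =>
    ∏ i : Fin n, ∏ τ : Fin (G.numTypes i), Z t i τ (s i τ) with hp
  have hsum : ∀ t < T, ∑ s, p t s = 1 := fun t ht => by
    rw [hp]
    rw [← Fintype.prod_sum fun (i : Fin n) (s : Fin (G.numTypes i) → Fin (G.numActions i)) =>
      ∏ τ : Fin (G.numTypes i), Z t i τ (s τ)]
    refine prod_eq_one fun i _ => ?_
    rw [← Fintype.prod_sum fun (τ : Fin (G.numTypes i)) (a : Fin (G.numActions i)) => Z t i τ a]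
    exact prod_eq_one fun τ _ => (hZ t ht).sum_eq i τ
  have hmarg : ∀ t < T, ∀ (θ : G.Types) (a : G.Actions),
      (∑ s : G.Strategies, if (fun i => s i (θ i)) = a then p t s else 0) =
        indep G (Z t) θ a := by
    intro t ht θ a
    have h1 : ∀ s : G.Strategies, (if (fun i => s i (θ i)) = a then p t s else 0) =
        ∏ i, ∏ τ, (if τ = θ i ∧ s i τ ≠ a i then 0 else Z t i τ (s i τ)) := by
      intro s
      split_ifs with h
      · refine prod_congr rfl fun i _ => prod_congr rfl fun τ _ => ?_
        rw [if_neg]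
        rintro ⟨rfl, h'⟩
        exact h' (congrFun h i)
      · obtain ⟨i, hi⟩ := Function.ne_iff.1 h
        symm
        exact prod_eq_zero (mem_univ i) (prod_eq_zero (mem_univ (θ i)) (if_pos ⟨rfl, hi⟩))
    simp only [h1]
    rw [← Fintype.prod_sum fun (i : Fin n) (s : Fin (G.numTypes i) → Fin (G.numActions i)) =>
      ∏ τ : Fin (G.numTypes i), (if τ = θ i ∧ s τ ≠ a i then 0 else Z t i τ (s τ))]
    refine prod_congr rfl fun i _ => ?_
    rw [← Fintype.prod_sum fun (τ : Fin (G.numTypes i)) (b : Fin (G.numActions i)) =>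
      if τ = θ i ∧ b ≠ a i then 0 else Z t i τ b]
    rw [prod_eq_single (θ i)]
    · rw [sum_eq_single (a i)]
      · simp
      · intro b _ hb
        simp [hb]
      · simp
    · intro τ _ hτ
      simp only [hτ, false_and, if_false]
      exact (hZ t ht).sum_eq i τ
    · simp
  refine ⟨fun s => 1 / (T : ℝ) * ∑ t ∈ range T, p t s, ⟨fun s => mul_nonneg (by positivity)
    (sum_nonneg fun t ht => prod_nonneg fun i _ => prod_nonneg fun τ _ =>
      (hZ t (mem_range.1 ht)).nonneg i τ _), ?_⟩, fun θ a => ?_⟩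
  · rw [← mul_sum, sum_comm, sum_congr rfl fun t ht => hsum t (mem_range.1 ht)]
    simp [hT']
  · rw [mixture, sum_congr rfl fun t ht => (hmarg t (mem_range.1 ht) θ a).symm, sum_comm, mul_sum]
    refine sum_congr rfl fun s _ => ?_
    split_ifs <;> simp

end Equilibrium

section Outcome

open Finset

variable {n : ℕ} (G : BayesianGame n) (κ : ∀ i : Fin n, Fin (G.numTypes i) → PMF G.Types)

/-- What holds for round `t` of the dynamics with certainty: the played strategies `y t` are almost
invariant under the random deviations that have been learnt from the strategies and the
estimated payoffs `u` of the previous rounds. -/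
structure RoundOK (H : ℝ) (y u : ℕ → ℕ → ℕ → ℕ → ℝ) (t : ℕ) : Prop where
  profile : IsProfile G (y t)
  mem : ∀ i : Fin n, ∀ θ < G.numTypes i, ∀ a < G.numActions i, 0 ≤ u t i θ a ∧ u t i θ a ≤ 1
  fixed : ∀ i : Fin n, ∀ θ < G.numTypes i, ∑ a ∈ range (G.numActions i),
    |app (G.numTypes i) (G.numActions i) (wtKernel (G.numTypes i) (G.numActions i)
      (wt H (fun s => y s i) (fun s => u s i) t)) (y t i) θ a - y t i θ a| ≤ 4 / H

/-- The estimated payoffs of round `t` are close to the true conditional payoffs. -/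
def Accurate (H : ℝ) (y u : ℕ → ℕ → ℕ → ℕ → ℝ) (t : ℕ) : Prop :=
  ∀ (i : Fin n) (θ : Fin (G.numTypes i)), ∀ a < G.numActions i,
    |u t i θ a - condPayoff G κ (y t) i θ a| ≤ 1 / H

variable {G κ}

lemma abs_sum_mul_le {A : ℕ} {p v : ℕ → ℝ} {C : ℝ} (hp : ∀ a < A, 0 ≤ p a)
    (hp1 : ∑ a ∈ range A, p a = 1) (hv : ∀ a < A, |v a| ≤ C) :
    |∑ a ∈ range A, p a * v a| ≤ C := by
  refine (abs_sum_le_sum_abs _ _).trans ?_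
  calc ∑ a ∈ range A, |p a * v a| ≤ ∑ a ∈ range A, p a * C := by
        refine sum_le_sum fun a ha => ?_
        rw [mem_range] at ha
        rw [abs_mul, abs_of_nonneg (hp a ha)]
        exact mul_le_mul_of_nonneg_left (hv a ha) (hp a ha)
    _ = C := by rw [← sum_mul, hp1, one_mul]

/-- After `H ^ 4` rounds with accurate estimates the mixture of the played profiles is an
approximate communication equilibrium. -/
lemma isApproxCommEq_of_rounds (hκ : G.IsConditionalSampler κ) {H : ℕ} (hH : 0 < H) {ε : ℝ}
    (hε : 0 < ε) (hHε : 16 / ε ≤ H)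
    (hsize : ∀ i : Fin n, G.numTypes i ≤ H ∧ G.numActions i ≤ H)
    {y u : ℕ → ℕ → ℕ → ℕ → ℝ} (hr : ∀ t < H ^ 4, RoundOK G H y u t)
    (ha : ∀ t < H ^ 4, Accurate G κ H y u t) :
    G.IsApproxCommEq ε (mixture G (H ^ 4) y) := by
  have hH' : (1 : ℝ) ≤ H := by exact_mod_cast hH
  have hH0 : (0 : ℝ) < H := by linarith
  refine isApproxCommEq_mixture hκ (by positivity) (fun t ht => (hr t ht).profile)
    fun i => ?_
  set Θ := G.numTypes i with hΘ
  set A := G.numActions i with hA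
  set T := H ^ 4 with hT
  intro s s' φ
  -- the map `φ` on natural numbers
  set φ' : ℕ → ℕ := fun a => if h : a < A then φ ⟨a, h⟩ else 0 with hφ'
  have hφ'A : ∀ a < A, φ' a < A := fun a h => by
    rw [hφ']
    simp only [dif_pos h]
    exact (φ ⟨a, h⟩).2
  have hreg := regret_le (Θ := Θ) (A := A) (H := H) (y := fun t => y t i) (u := fun t => u t i)
    (T := T) hH' (fun t ht => (hr t ht).profile i) (fun t ht => (hr t ht).mem i) s.2 s'.2 hφ'A
  set c : ℕ → ℕ → ℝ := fun t a => condPayoff G κ (y t) i s a with hc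
  have h1 : ∀ t < T, ∑ b : Fin A, y t i s' b * c t (φ b) ≤
      ∑ a ∈ range A, y t i s' a * u t i s (φ' a) + 1 / H := by
    intro t ht
    have e : ∑ b : Fin A, y t i s' b * c t (φ b) = ∑ a ∈ range A, y t i s' a * c t (φ' a) := by
      rw [sum_range]
      refine sum_congr rfl fun b _ => ?_
      simp [hφ']
    have hst := (hr t ht).profile i s' s'.2
    have := (abs_le.1 (abs_sum_mul_le (v := fun a => u t i s (φ' a) - c t (φ' a)) hst.1 hst.2
      fun a h => ha t ht i s _ (hφ'A a h))).1
    simp only [mul_sub, sum_sub_distrib] at this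
    rw [e]
    linarith
  have h2 : ∀ t < T, ∑ a ∈ range A, app Θ A (wtKernel Θ A (wt H (fun s => y s i)
      (fun s => u s i) t)) (y t i) s a * u t i s a ≤
        ∑ b : Fin A, y t i s b * c t b + 1 / H + 4 / H := by
    intro t ht
    have hst := (hr t ht).profile i s s.2
    have h3 := (abs_le.1 (abs_sum_mul_le (v := fun a => u t i s a - c t a) hst.1 hst.2
      fun a h => ha t ht i s _ h)).2
    simp only [mul_sub, sum_sub_distrib] at h3
    have h4 : ∑ a ∈ range A, app Θ A (wtKernel Θ A (wt H (fun s => y s i)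
        (fun s => u s i) t)) (y t i) s a * u t i s a - ∑ a ∈ range A, y t i s a * u t i s a ≤
          4 / H := by
      rw [← sum_sub_distrib]
      refine le_trans (sum_le_sum fun a h => ?_) ((hr t ht).fixed i s s.2)
      rw [mem_range] at h
      obtain ⟨hu0, hu1⟩ := (hr t ht).mem i s s.2 a h
      rw [← sub_mul]
      refine (mul_le_mul_of_nonneg_right (le_abs_self _) hu0).trans ?_
      exact mul_le_of_le_one_right (abs_nonneg _) hu1
    rw [sum_range (fun a => y t i s a * c t a)] at h3
    linarith
  have h3 := sum_le_sum fun t ht => h1 t (mem_range.1 ht)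
  have h4 := sum_le_sum fun t ht => h2 t (mem_range.1 ht)
  simp only [sum_add_distrib, sum_const, card_range, nsmul_eq_mul] at h3 h4
  have hTH : (T : ℝ) = (H : ℝ) ^ 4 := by rw [hT]; push_cast; rfl
  have h5 : ((Θ : ℝ) + A * A) * H ≤ 2 * T / H := by
    have hΘH : (Θ : ℝ) ≤ H := by exact_mod_cast (hsize i).1
    have hAH : (A : ℝ) ≤ H := by exact_mod_cast (hsize i).2
    have e : 2 * (T : ℝ) / H = (H * H + H * H) * H := by
      rw [hTH]
      field_simp
      ring
    rw [e]
    gcongr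
    nlinarith
  have h6 : 10 * (T : ℝ) / H ≤ ε * T := by
    rw [div_le_iff₀ hε] at hHε
    rw [div_le_iff₀ hH0]
    have : (0 : ℝ) ≤ T := by positivity
    nlinarith
  have e1 : (T : ℝ) * (1 / H) = T / H := by ring
  have e2 : (T : ℝ) * (4 / H) = 4 * (T / H) := by ring
  have e3 : 2 * (T : ℝ) / H = 2 * (T / H) := by ring
  have e4 : 10 * (T : ℝ) / H = 10 * (T / H) := by ring
  rw [e1] at h3
  rw [e1, e2] at h4
  rw [e3] at h5 hreg
  rw [e4] at h6
  linarith

end Outcome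

/-! ### The program -/

/-!
Besides the input, the memory is used as follows; a scalar is the entry of an array at the empty
index.

* Natural-number arrays: `3` is the current round, `4` is `⌈16 / ε⌉`, `5` is the exponent of a
  power of two above `1 / δ`, `6` is the number `k` of bits of a grid point; `10` and `12` are the
  types and actions of a sample, `11` is a coin, `13` is a grid point; `14` and `20` to `25` are
  loop counters.
* Real arrays: `2` and `3` are the strategies and estimates of all rounds, indexed by round,
  player, type and action; `4` is the accuracy parameter, `6` is the number of grid points; `7`,
  `16`, `8` and `17` are the weights and their sums and products, `9` is the random deviation; `10`
  and `12` are its iterates and their sum, `11` and `13` are copies of them; `14` contains the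
  cumulative distribution functions; `15` is the payoff of a sample; `5` is auxiliary.
* The scalars from `100` on are loop counters and registers of compiled expressions.
-/

/-- The loop counter of level `k`. -/
abbrev ctr (k : ℕ) : IExp := ic (100 + k) []

/-- The loop bounds for the players, their types and their actions. -/
abbrev cellBounds : List Bd := [.players, .types (ctr 0), .acts (ctr 0)]

/-- The weights, computed from the strategies (array `2`) and estimates (array `3`) of the
previous rounds. -/
def cmdWeights : Cmd :=
  fill 7 [] [.players, .types (ctr 0), .types (ctr 0), .acts (ctr 0), .acts (ctr 0)]
    (.prod .rounds (.base (.add (.ofInt (.lit 1)) (.div (.mul (rc 2 [ctr 5, ctr 0, ctr 2, ctr 3])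
      (rc 3 [ctr 5, ctr 0, ctr 1, ctr 4])) (rc 4 []))))) 100

/-- The sums of weights over the action that is played. -/
def cmdSums : Cmd :=
  fill 16 [] [.players, .types (ctr 0), .types (ctr 0), .acts (ctr 0)]
    (.sum (.acts (ctr 0)) (.base (rc 7 [ctr 0, ctr 1, ctr 2, ctr 3, ctr 4]))) 100

/-- The weights of the reports. -/
def cmdReports : Cmd :=
  fill 8 [] [.players, .types (ctr 0), .types (ctr 0)]
    (.prod (.acts (ctr 0)) (.base (rc 16 [ctr 0, ctr 1, ctr 2, ctr 3]))) 100

/-- The total weights. -/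
def cmdTotals : Cmd :=
  fill 17 [] [.players, .types (ctr 0)]
    (.sum (.types (ctr 0)) (.base (rc 8 [ctr 0, ctr 1, ctr 2]))) 100

/-- The random deviations in proportion to the weights. -/
def cmdKernel : Cmd :=
  fill 9 [] [.players, .types (ctr 0), .acts (ctr 0), .types (ctr 0), .acts (ctr 0)]
    (.base (.mul (.div (rc 8 [ctr 0, ctr 1, ctr 3]) (rc 17 [ctr 0, ctr 1]))
      (.div (rc 7 [ctr 0, ctr 1, ctr 3, ctr 4, ctr 2]) (rc 16 [ctr 0, ctr 1, ctr 3, ctr 4])))) 100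

/-- The learning phase of a round. -/
def cmdLearn : Cmd := .seq cmdWeights (.seq cmdSums (.seq cmdReports (.seq cmdTotals cmdKernel)))

/-- The uniform strategies. -/
def cmdUniform : Cmd :=
  fill 10 [] cellBounds (.base (.div (.ofInt (.lit 1)) (.ofInt (ic 2 [ctr 0])))) 100

/-- Clearing the accumulators for the average of the iterates. -/
def cmdClear : Cmd := fill 12 [] cellBounds (.base (.ofInt (.lit 0))) 100

/-- One iteration of the random deviations; arrays `11` and `13` are auxiliary copies. -/
def cmdIterate : Cmd :=
  .seq (fill 11 [] cellBounds (.sum (.types (ctr 0)) (.sum (.acts (ctr 0)) (.base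
    (.mul (rc 9 [ctr 0, ctr 1, ctr 2, ctr 3, ctr 4]) (rc 10 [ctr 0, ctr 3, ctr 4]))))) 100)
  (.seq (fill 13 [] cellBounds (.base (.add (rc 12 [ctr 0, ctr 1, ctr 2])
    (rc 10 [ctr 0, ctr 1, ctr 2]))) 100)
  (.seq (fill 10 [] cellBounds (.base (rc 11 [ctr 0, ctr 1, ctr 2])) 100)
    (fill 12 [] cellBounds (.base (rc 13 [ctr 0, ctr 1, ctr 2])) 100)))

/-- The sum of the iterates. -/
def cmdAverage : Cmd := .seq cmdUniform (.seq cmdClear (forLoop 14 (rc 4 []) cmdIterate))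

/-- The cumulative distribution functions of the averages, scaled by the number of grid points. -/
def cmdCumulate : Cmd :=
  fill 14 [] [.players, .types (ctr 0), .cuts (ctr 0)]
    (.sum (.acts (ctr 0)) (.ite (.intLt (ctr 3) (ctr 2))
      (.base (.div (.mul (rc 12 [ctr 0, ctr 1, ctr 3]) (rc 6 [])) (rc 4 [])))
      (.base (.ofInt (.lit 0))))) 100

/-- The strategies played in this round. -/
def cmdPlay : Cmd :=
  fill 2 [ic 3 []] cellBounds
    (.sum .grid (.ite (.realLt (.ofInt (ctr 3)) (rc 14 [ctr 0, ctr 1, ctr 2]))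
      (.base (.ofInt (.lit 0)))
      (.ite (.realLt (.ofInt (ctr 3)) (rc 14 [ctr 0, ctr 1, .add (ctr 2) (.lit 1)]))
        (.base (.div (.ofInt (.lit 1)) (rc 6 []))) (.base (.ofInt (.lit 0)))))) 100

/-- Clearing the estimates of this round. -/
def cmdForget : Cmd := fill 3 [ic 3 []] cellBounds (.base (.ofInt (.lit 0))) 100

/-- The computation of the strategies of a round. -/
def cmdStrategies : Cmd :=
  .seq cmdLearn (.seq cmdAverage (.seq cmdCumulate (.seq cmdPlay cmdForget)))

/-! ### Computation of the strategies -/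

section Strategies

open Finset

/-- The natural-number arrays below `100` outside `I` and the real arrays below `100` outside `R`
are the same in both memories. -/
def Keep (I R : List ℕ) (s s' : State) : Prop :=
  (∀ y < 100, y ∉ I → s'.int y = s.int y) ∧ ∀ y < 100, y ∉ R → s'.real y = s.real y

lemma Same.keep {x : ℕ} {s s' : State} (h : Same 100 x s s') : Keep [] [x] s s' :=
  ⟨fun _ hy _ => h.1.eq hy, fun y hy hx => h.2 y hy (by simpa using hx)⟩

lemma Keep.trans {I R : List ℕ} {s s' s'' : State} (h : Keep I R s s') (h' : Keep I R s' s'') :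
    Keep I R s s'' :=
  ⟨fun y hy hI => (h'.1 y hy hI).trans (h.1 y hy hI),
    fun y hy hR => (h'.2 y hy hR).trans (h.2 y hy hR)⟩

lemma Keep.mono {I R I' R' : List ℕ} {s s' : State} (h : Keep I R s s') (hI : I ⊆ I')
    (hR : R ⊆ R') : Keep I' R' s s' :=
  ⟨fun y hy hy' => h.1 y hy fun h => hy' (hI h), fun y hy hy' => h.2 y hy fun h => hy' (hR h)⟩

lemma Keep.small {I R : List ℕ} {s s' : State} {N : ℕ} (h : Keep I R s s') (hs : Small N s)
    (hI : ∀ y ∈ [0, 1, 2, 3], y ∉ I) (hR : ∀ y ∈ [4, 6], y ∉ R) : Small N s' := by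
  unfold Small at *
  rwa [h.1 0 (by norm_num) (hI 0 (by simp)), h.1 1 (by norm_num) (hI 1 (by simp)),
    h.1 2 (by norm_num) (hI 2 (by simp)), h.1 3 (by norm_num) (hI 3 (by simp)),
    h.2 4 (by norm_num) (hR 4 (by simp)), h.2 6 (by norm_num) (hR 6 (by simp))]

/-- The strategies (`x = 2`) or estimates (`x = 3`) recorded in the memory. -/
def hist (x : ℕ) (s : State) (t i θ a : ℕ) : ℝ := s.real x [t, i, θ, a]

/-- Started in a memory in which all loop bounds are at most `N`, the command takes at most `p N`
steps for a fixed polynomial `p`, and relates the memory before and after the execution by `Q`. -/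
def PolyDet (c : Cmd) (Q : State → State → Prop) : Prop :=
  ∃ p : Polynomial ℕ, ∀ {n : ℕ} {G : BayesianGame n}
    {κ : ∀ i : Fin n, Fin (G.numTypes i) → PMF G.Types} {N : ℕ} {s : State}, Small N s →
    Det G κ c s (p.eval N) (Q s)

lemma PolyDet.mono {c : Cmd} {Q Q' : State → State → Prop} (h : PolyDet c Q)
    (hQ : ∀ s s', Q s s' → Q' s s') : PolyDet c Q' :=
  h.imp fun _ hp {_ _ _ _ s} hs => (hp hs).mono le_rfl (hQ s)

lemma PolyDet.seq {c d : Cmd} {Q Q' : State → State → Prop} (h : PolyDet c Q) (h' : PolyDet d Q')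
    (hQ : ∀ N s s', Small N s → Q s s' → Small N s') :
    PolyDet (.seq c d) fun s s'' => ∃ s', Q s s' ∧ Q' s' s'' := by
  obtain ⟨p, hp⟩ := h
  obtain ⟨q, hq⟩ := h'
  refine ⟨p + q + 1, fun {n G κ N s} hs => ?_⟩
  simp only [Polynomial.eval_add, Polynomial.eval_one]
  exact Det.seq (hp hs) fun s' hs' => (hq (hQ N s s' hs hs')).mono le_rfl fun s'' h => ⟨s', hs', h⟩

lemma PolyDet.forLoop {x : ℕ} {b : RExp} {c : Cmd} {Q : State → State → Prop} (h : PolyDet c Q)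
    (Inv : State → ℕ → State → Prop) (hb : ∀ N s, Small N s → ⌈b.eval s⌉₊ ≤ N)
    (hx : ∀ s j s', Inv s j s' → s'.int x [] = j ∧ ⌈b.eval s'⌉₊ = ⌈b.eval s⌉₊)
    (hs : ∀ N s j s', Small N s → Inv s j s' → Small N s')
    (h0 : ∀ s, Inv s 0 (s.setInt x [] 0))
    (hc : ∀ s j s' s'', Inv s j s' → Q s' s'' →
      Inv s (j + 1) (s''.setInt x [] (s''.int x [] + 1))) :
    PolyDet (forLoop x b c) fun s s' => Inv s ⌈b.eval s⌉₊ s' := by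
  obtain ⟨p, hp⟩ := h
  refine ⟨.X * (p + 3) + 3, fun {n G κ N s} hN => ?_⟩
  refine (Det.forLoop (B := p.eval N) (Inv s) ⌈b.eval s⌉₊ (hx s) (h0 s) fun j s' _ hj =>
    (hp (hs N s j s' hN hj)).mono le_rfl fun s'' h => hc s j s' s'' hj h).mono ?_ fun _ h => h
  have := Nat.mul_le_mul_right (p.eval N + 3) (hb N s hN)
  simp only [forCost, Polynomial.eval_add, Polynomial.eval_mul, Polynomial.eval_X,
    Polynomial.eval_ofNat]
  omega

lemma exists_poly_forCost {f : ℕ → ℕ} (h : ∃ p : Polynomial ℕ, ∀ N, f N = p.eval N) :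
    ∃ p : Polynomial ℕ, ∀ N, forCost N (f N) = p.eval N := by
  obtain ⟨p, hp⟩ := h
  exact ⟨.X * (p + 3) + 3, fun N => by simp [forCost, hp]⟩

lemma BigExp.exists_poly_cost (e : BigExp) : ∃ p : Polynomial ℕ, ∀ N, e.cost N = p.eval N := by
  induction e with
  | base e => exact ⟨1, fun N => by simp [BigExp.cost]⟩
  | ite t e f ihe ihf =>
    obtain ⟨p, hp⟩ := ihe
    obtain ⟨q, hq⟩ := ihf
    exact ⟨p + q + 1, fun N => by simp [BigExp.cost, hp, hq]⟩
  | sum b e ih =>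
    obtain ⟨p, hp⟩ := ih
    obtain ⟨q, hq⟩ := exists_poly_forCost (f := fun N => e.cost N + 1 + 1)
      ⟨p + 1 + 1, fun N => by simp [hp]⟩
    exact ⟨q + 2, fun N => by simp [BigExp.cost, hq]⟩
  | prod b e ih =>
    obtain ⟨p, hp⟩ := ih
    obtain ⟨q, hq⟩ := exists_poly_forCost (f := fun N => e.cost N + 1 + 1)
      ⟨p + 1 + 1, fun N => by simp [hp]⟩
    exact ⟨q + 2, fun N => by simp [BigExp.cost, hq]⟩

lemma exists_poly_fillCost (bs : List Bd) (e : BigExp) :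
    ∃ p : Polynomial ℕ, ∀ N, fillCost N bs e = p.eval N := by
  induction bs with
  | nil =>
    obtain ⟨p, hp⟩ := e.exists_poly_cost
    exact ⟨p + 2, fun N => by simp [fillCost, hp]⟩
  | cons b bs ih => exact exists_poly_forCost ih

/-- `fill` takes polynomial time. -/
lemma polyDet_fill {x : ℕ} (hx : x ≠ 4 ∧ x ≠ 6 ∧ x < 100) (pre : List IExp) (bs : List Bd)
    (e : BigExp) (he : FillLow x bs e 100) (hpre : ∀ i ∈ pre, i.Low 100) :
    PolyDet (fill x pre bs e 100) fun s =>
      Filled 100 x (pre.map (IExp.eval s)) (fillVal bs e 100 s) s := by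
  obtain ⟨p, hp⟩ := exists_poly_fillCost bs e
  refine ⟨p, fun {n G κ N s} hs => ?_⟩
  rw [← hp]
  exact det_fill ⟨hx.1, hx.2.1⟩ hx.2.2 pre bs e le_rfl he hpre s hs

lemma polyDet_weights : PolyDet cmdWeights fun s s' => Keep [] [7] s s' ∧
      ∀ i < s.int 0 [], ∀ θ < s.int 1 [i], ∀ θ' < s.int 1 [i], ∀ a' < s.int 2 [i],
        ∀ a < s.int 2 [i], s'.real 7 [i, θ, θ', a', a] = wt (s.real 4 [])
          (fun t => hist 2 s t i) (fun t => hist 3 s t i) (s.int 3 []) θ θ' a' a := by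
  refine (polyDet_fill (by simp) _ _ _ ?_ (by simp)).mono fun s s' h =>
    ⟨h.1.keep, fun i hi θ hθ θ' hθ' a' ha' a ha => ?_⟩
  · simp [FillLow, BigExp.Low, Bd.Low, RExp.Low, IExp.Low, ic_low, rc_low]
  · have := h.2.1 [i, θ, θ', a', a]
    simp [fillVal, hi, hθ, hθ', ha', ha, BigExp.val, RExp.eval, IExp.eval] at this
    rw [this]
    rfl

lemma polyDet_sums : PolyDet cmdSums fun s s' => Keep [] [16] s s' ∧
      ∀ i < s.int 0 [], ∀ θ < s.int 1 [i], ∀ θ' < s.int 1 [i], ∀ a' < s.int 2 [i],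
        s'.real 16 [i, θ, θ', a'] =
          wtSum (s.int 2 [i]) (fun θ θ' a' a => s.real 7 [i, θ, θ', a', a]) θ θ' a' := by
  refine (polyDet_fill (by simp) _ _ _ ?_ (by simp)).mono fun s s' h =>
    ⟨h.1.keep, fun i hi θ hθ θ' hθ' a' ha' => ?_⟩
  · simp [FillLow, BigExp.Low, Bd.Low, ic_low, rc_low]
  · have := h.2.1 [i, θ, θ', a']
    simp [fillVal, hi, hθ, hθ', ha', BigExp.val] at this
    rw [this]
    rfl

lemma polyDet_reports : PolyDet cmdReports fun s s' => Keep [] [8] s s' ∧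
      ∀ i < s.int 0 [], ∀ θ < s.int 1 [i], ∀ θ' < s.int 1 [i], s'.real 8 [i, θ, θ'] =
        ∏ a' ∈ range (s.int 2 [i]), s.real 16 [i, θ, θ', a'] := by
  refine (polyDet_fill (by simp) _ _ _ ?_ (by simp)).mono fun s s' h =>
    ⟨h.1.keep, fun i hi θ hθ θ' hθ' => ?_⟩
  · simp [FillLow, BigExp.Low, Bd.Low, ic_low, rc_low]
  · have := h.2.1 [i, θ, θ']
    simpa [fillVal, hi, hθ, hθ', BigExp.val] using this

lemma polyDet_totals : PolyDet cmdTotals fun s s' => Keep [] [17] s s' ∧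
      ∀ i < s.int 0 [], ∀ θ < s.int 1 [i], s'.real 17 [i, θ] =
        ∑ θ' ∈ range (s.int 1 [i]), s.real 8 [i, θ, θ'] := by
  refine (polyDet_fill (by simp) _ _ _ ?_ (by simp)).mono fun s s' h =>
    ⟨h.1.keep, fun i hi θ hθ => ?_⟩
  · simp [FillLow, BigExp.Low, Bd.Low, ic_low, rc_low]
  · have := h.2.1 [i, θ]
    simpa [fillVal, hi, hθ, BigExp.val] using this

lemma polyDet_kernel : PolyDet cmdKernel fun s s' => Keep [] [9] s s' ∧
      ∀ i < s.int 0 [], ∀ θ < s.int 1 [i], ∀ a < s.int 2 [i], ∀ θ' < s.int 1 [i],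
        ∀ a' < s.int 2 [i], s'.real 9 [i, θ, a, θ', a'] =
          s.real 8 [i, θ, θ'] / s.real 17 [i, θ] *
            (s.real 7 [i, θ, θ', a', a] / s.real 16 [i, θ, θ', a']) := by
  refine (polyDet_fill (by simp) _ _ _ ?_ (by simp)).mono fun s s' h =>
    ⟨h.1.keep, fun i hi θ hθ a ha θ' hθ' a' ha' => ?_⟩
  · simp [FillLow, BigExp.Low, Bd.Low, RExp.Low, ic_low, rc_low]
  · have := h.2.1 [i, θ, a, θ', a']
    simpa [fillVal, hi, hθ, hθ', ha', ha, BigExp.val, RExp.eval] using this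

/-- The kernel only depends on the weights within the bounds. -/
lemma wtKernel_congr {Θ A : ℕ} {V V' : ℕ → ℕ → ℕ → ℕ → ℝ}
    (h : ∀ θ < Θ, ∀ θ' < Θ, ∀ a' < A, ∀ a < A, V θ θ' a' a = V' θ θ' a' a) {θ a θ' a' : ℕ}
    (hθ : θ < Θ) (ha : a < A) (hθ' : θ' < Θ) (ha' : a' < A) :
    wtKernel Θ A V θ a θ' a' = wtKernel Θ A V' θ a θ' a' := by
  have hS : ∀ θ' < Θ, ∀ a' < A, wtSum A V θ θ' a' = wtSum A V' θ θ' a' := fun θ' hθ' a' ha' =>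
    sum_congr rfl fun a ha => h θ hθ θ' hθ' a' ha' a (mem_range.1 ha)
  have hR : ∀ θ' < Θ, wtReport A V θ θ' = wtReport A V' θ θ' := fun θ' hθ' =>
    prod_congr rfl fun a' ha' => hS θ' hθ' a' (mem_range.1 ha')
  have hZ : wtTotal Θ A V θ = wtTotal Θ A V' θ :=
    sum_congr rfl fun θ' hθ' => hR θ' (mem_range.1 hθ')
  rw [wtKernel, wtKernel, hR θ' hθ', hZ, hS θ' hθ' a' ha', h θ hθ θ' hθ' a' ha' a ha]

/-- The learning phase computes the random deviation from the history. -/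
lemma polyDet_learn : PolyDet cmdLearn fun s s' => Keep [] [7, 8, 9, 16, 17] s s' ∧
      ∀ i < s.int 0 [], ∀ θ < s.int 1 [i], ∀ a < s.int 2 [i], ∀ θ' < s.int 1 [i],
        ∀ a' < s.int 2 [i], s'.real 9 [i, θ, a, θ', a'] =
          wtKernel (s.int 1 [i]) (s.int 2 [i]) (wt (s.real 4 []) (fun t => hist 2 s t i)
            (fun t => hist 3 s t i) (s.int 3 [])) θ a θ' a' := by
  have m : ∀ {x s s'}, Keep [] [x] s s' → x ∈ [7, 8, 9, 16, 17] →
      Keep [] [7, 8, 9, 16, 17] s s' := fun h hx => h.mono (by simp) (by simpa using hx)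
  refine (polyDet_weights.seq (polyDet_sums.seq (polyDet_reports.seq (polyDet_totals.seq
    polyDet_kernel fun N s s' hs k => k.1.small hs (by simp) (by simp))
    fun N s s' hs k => k.1.small hs (by simp) (by simp))
    fun N s s' hs k => k.1.small hs (by simp) (by simp))
    fun N s s' hs k => k.1.small hs (by simp) (by simp)).mono ?_
  rintro s s' ⟨s₁, k₁, s₂, k₂, s₃, k₃, s₄, k₄, k₅⟩
  refine ⟨((((m k₁.1 (by simp)).trans (m k₂.1 (by simp))).trans (m k₃.1 (by simp))).trans
      (m k₄.1 (by simp))).trans (m k₅.1 (by simp)), fun i hi θ hθ a ha θ' hθ' a' ha' => ?_⟩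
  obtain ⟨⟨i₁, r₁⟩, k₁⟩ := k₁
  obtain ⟨⟨i₂, r₂⟩, k₂⟩ := k₂
  obtain ⟨⟨i₃, r₃⟩, k₃⟩ := k₃
  obtain ⟨⟨i₄, r₄⟩, k₄⟩ := k₄
  simp [i₁, i₂, i₃, i₄, r₄, r₃, r₂] at k₂ k₃ k₄ k₅
  rw [k₅.2 i hi θ hθ a ha θ' hθ' a' ha', k₄ i hi θ hθ, k₃ i hi θ hθ θ' hθ',
    sum_congr rfl fun θ' hθ' => k₃ i hi θ hθ θ' (mem_range.1 hθ'),
    sum_congr rfl fun θ' hθ' => prod_congr rfl fun a' ha' =>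
      k₂ i hi θ hθ θ' (mem_range.1 hθ') a' (mem_range.1 ha'),
    prod_congr rfl fun a' ha' => k₂ i hi θ hθ θ' hθ' a' (mem_range.1 ha'),
    k₂ i hi θ hθ θ' hθ' a' ha']
  exact wtKernel_congr (k₁ i hi) hθ ha hθ' ha'

/-- The three parts of an index in the range of the loops over players, types and actions. -/
def InCell (s : State) (i θ a : ℕ) : Prop := i < s.int 0 [] ∧ θ < s.int 1 [i] ∧ a < s.int 2 [i]

/-- Filling an array indexed by players, types and actions. -/
lemma polyDet_cell {x : ℕ} (hx : x ≠ 4 ∧ x ≠ 6 ∧ x < 100) (e : BigExp) (he : e.Low x 103) :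
    PolyDet (fill x [] cellBounds e 100) fun s s' => Keep [] [x] s s' ∧
      ∀ i θ a, InCell s i θ a → s'.real x [i, θ, a] =
        e.val 103 (((s.setInt 100 [] i).setInt 101 [] θ).setInt 102 [] a) := by
  refine (polyDet_fill hx _ _ _ ?_ (by simp)).mono fun s s' h => ⟨h.1.keep, fun i θ a hc => ?_⟩
  · simp [FillLow, Bd.Low, ic_low, he]
  · have := h.2.1 [i, θ, a]
    simpa [fillVal, hc.1, hc.2.1, hc.2.2] using this

lemma app_congr {Θ A : ℕ} {K : ℕ → ℕ → ℕ → ℕ → ℝ} {x x' : ℕ → ℕ → ℝ}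
    (h : ∀ θ < Θ, ∀ a < A, x θ a = x' θ a) (θ a : ℕ) : app Θ A K x θ a = app Θ A K x' θ a :=
  sum_congr rfl fun θ' hθ' => sum_congr rfl fun a' ha' => by
    rw [h θ' (mem_range.1 hθ') a' (mem_range.1 ha')]

/-- The `k`-th iterate of the random deviations in array `9` for player `i`. -/
def iterate (s : State) (i k : ℕ) : (ℕ → ℕ → ℝ) → ℕ → ℕ → ℝ :=
  (app (s.int 1 [i]) (s.int 2 [i]) fun θ a θ' a' => s.real 9 [i, θ, a, θ', a'])^[k]

/-- An iteration applies the random deviation in array `9` to array `10`, and adds the old content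
of array `10` to array `12`. -/
lemma polyDet_iterate : PolyDet cmdIterate fun s s' => Keep [] [10, 11, 12, 13] s s' ∧
    ∀ i θ a, InCell s i θ a →
      s'.real 10 [i, θ, a] = iterate s i 1 (fun θ a => s.real 10 [i, θ, a]) θ a ∧
      s'.real 12 [i, θ, a] = s.real 12 [i, θ, a] + s.real 10 [i, θ, a] := by
  have m : ∀ {x s s'}, Keep [] [x] s s' → x ∈ [10, 11, 12, 13] →
      Keep [] [10, 11, 12, 13] s s' := fun h hx => h.mono (by simp) (by simpa using hx)
  refine ((polyDet_cell (by simp) _ ?_).seq ((polyDet_cell (by simp) _ ?_).seq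
    ((polyDet_cell (by simp) _ ?_).seq (polyDet_cell (by simp) _ ?_)
    fun N s s' hs k => k.1.small hs (by simp) (by simp))
    fun N s s' hs k => k.1.small hs (by simp) (by simp))
    fun N s s' hs k => k.1.small hs (by simp) (by simp)).mono ?_
  iterate 4 simp [BigExp.Low, Bd.Low, RExp.Low, ic_low, rc_low]
  rintro s s' ⟨s₁, k₁, s₂, k₂, s₃, k₃, k₄⟩
  refine ⟨(((m k₁.1 (by simp)).trans (m k₂.1 (by simp))).trans (m k₃.1 (by simp))).trans
      (m k₄.1 (by simp)), fun i θ a hc => ?_⟩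
  obtain ⟨⟨i₁, r₁⟩, k₁⟩ := k₁
  obtain ⟨⟨i₂, r₂⟩, k₂⟩ := k₂
  obtain ⟨⟨i₃, r₃⟩, k₃⟩ := k₃
  obtain ⟨⟨i₄, r₄⟩, k₄⟩ := k₄
  simp only [InCell] at hc k₁ k₂ k₃ k₄
  simp [BigExp.val, RExp.eval, i₁, i₂, i₃, r₁, r₂, r₃, r₄] at k₁ k₂ k₃ k₄ ⊢
  rw [k₃ i θ a hc.1 hc.2.1 hc.2.2, k₄ i θ a hc.1 hc.2.1 hc.2.2, k₁ i θ a hc.1 hc.2.1 hc.2.2,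
    k₂ i θ a hc.1 hc.2.1 hc.2.2]
  exact ⟨rfl, rfl⟩

/-- The sum of the iterates of the random deviations in array `9`, started in the uniform
strategy. -/
lemma polyDet_average : PolyDet cmdAverage fun s s' => Keep [14] [10, 11, 12, 13] s s' ∧
    ∀ i θ a, InCell s i θ a → s'.real 12 [i, θ, a] =
      ∑ k ∈ range ⌈s.real 4 []⌉₊, iterate s i k (fun _ _ => 1 / (s.int 2 [i] : ℝ)) θ a := by
  have m : ∀ {x s s'}, Keep [] [x] s s' → x ∈ [10, 11, 12, 13] →
      Keep [14] [10, 11, 12, 13] s s' := fun h hx => h.mono (by simp) (by simpa using hx)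
  refine ((polyDet_cell (by simp) _ ?_).seq ((polyDet_cell (by simp) _ ?_).seq
    (polyDet_iterate.forLoop (fun s j s' => Keep [14] [10, 11, 12, 13] s s' ∧ s'.int 14 [] = j ∧
      ∀ i θ a, InCell s i θ a →
        s'.real 10 [i, θ, a] = iterate s i j (fun θ a => s.real 10 [i, θ, a]) θ a ∧
        s'.real 12 [i, θ, a] = s.real 12 [i, θ, a] +
          ∑ k ∈ range j, iterate s i k (fun θ a => s.real 10 [i, θ, a]) θ a) ?_ ?_ ?_ ?_ ?_)
    fun N s s' hs k => k.1.small hs (by simp) (by simp))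
    fun N s s' hs k => k.1.small hs (by simp) (by simp)).mono ?_
  · simp [BigExp.Low, RExp.Low, IExp.Low, ic_low]
  · simp [BigExp.Low, RExp.Low, IExp.Low]
  · exact fun N s hs => by simpa using hs.2.2.2.2.1
  · exact fun s j s' h => ⟨h.2.1, by simp [h.1.2]⟩
  · exact fun N s j s' hs h => h.1.small hs (by simp) (by simp)
  · refine fun s => ⟨⟨fun y _ hy => setInt_int_ne _ (by simpa using hy) _ _, fun _ _ _ => rfl⟩,
      by simp, fun i θ a _ => ?_⟩
    simp [iterate]
  · rintro s j s' s'' ⟨⟨hi, hr⟩, hj, h⟩ ⟨⟨hi', hr'⟩, h'⟩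
    refine ⟨⟨fun y hy hy' => ?_, fun y hy hy' => ?_⟩, ?_, fun i θ a hc => ?_⟩
    · rw [setInt_int_ne _ (by simpa using hy'), hi' y hy (by simp), hi y hy hy']
    · rw [setInt_real, hr' y hy hy', hr y hy hy']
    · simp [hi', hj]
    · have hc' : InCell s' i θ a := by simpa [InCell, hi] using hc
      obtain ⟨h1, h2⟩ := h' i θ a hc'
      obtain ⟨h3, h4⟩ := h i θ a hc
      rw [setInt_real, h1, h2, h3, h4, sum_range_succ, add_assoc]
      refine ⟨?_, rfl⟩
      rw [iterate, iterate, Function.iterate_one, Function.iterate_succ_apply',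
        hi 1 (by norm_num) (by simp), hi 2 (by norm_num) (by simp),
        hr 9 (by norm_num) (by simp)]
      refine app_congr (fun θ hθ a ha => ?_) _ _
      exact (h i θ a ⟨hc.1, hθ, ha⟩).1
  · rintro s s' ⟨s₁, k₁, s₂, k₂, k₃, -, h⟩
    refine ⟨((m k₁.1 (by simp)).trans (m k₂.1 (by simp))).trans k₃, fun i θ a hc => ?_⟩
    obtain ⟨⟨i₁, r₁⟩, k₁⟩ := k₁
    obtain ⟨⟨i₂, r₂⟩, k₂⟩ := k₂
    simp only [InCell] at hc h k₁ k₂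
    simp [BigExp.val, RExp.eval, IExp.eval, iterate, i₁, i₂, r₁, r₂] at h k₁ k₂ ⊢
    rw [(h i θ a hc.1 hc.2.1 hc.2.2).2, k₂ i θ a hc.1 hc.2.1 hc.2.2, zero_add]
    refine sum_congr rfl fun k _ => ?_
    cases k with
    | zero => simpa using k₁ i θ a hc.1 hc.2.1 hc.2.2
    | succ k =>
      rw [Function.iterate_succ_apply, Function.iterate_succ_apply]
      have e := fun θ a => app_congr (K := fun θ a θ' a' => s.real 9 [i, θ, a, θ', a'])
        (fun θ hθ a ha => k₁ i θ a hc.1 hθ ha) θ a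
      rw [funext₂ e]

lemma polyDet_cumulate : PolyDet cmdCumulate fun s s' => Keep [] [14] s s' ∧
    ∀ i < s.int 0 [], ∀ θ < s.int 1 [i], ∀ a ≤ s.int 2 [i], s'.real 14 [i, θ, a] =
      ∑ b ∈ range a, s.real 12 [i, θ, b] * s.real 6 [] / s.real 4 [] := by
  refine (polyDet_fill (by simp) _ _ _ ?_ (by simp)).mono fun s s' h =>
    ⟨h.1.keep, fun i hi θ hθ a ha => ?_⟩
  · simp [FillLow, BigExp.Low, Bd.Low, RExp.Low, IExp.Low, Test.Low, ic_low, rc_low]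
  · have := h.2.1 [i, θ, a]
    simp [fillVal, hi, hθ, Nat.lt_succ_of_le ha, BigExp.val, RExp.eval, IExp.eval,
      Test.holds] at this
    rw [this, ← sum_filter]
    congr 1
    ext b
    simp only [mem_filter, mem_range]
    omega

open Classical in
lemma polyDet_play : PolyDet cmdPlay fun s s' => Keep [] [2] s s' ∧
    (∀ l, ¬ [s.int 3 []] <+: l → s'.real 2 l = s.real 2 l) ∧
    ∀ i θ a, InCell s i θ a → s'.real 2 [s.int 3 [], i, θ, a] =
      ∑ m ∈ range ⌈s.real 6 []⌉₊, if (m : ℝ) < s.real 14 [i, θ, a] then 0 else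
        if (m : ℝ) < s.real 14 [i, θ, a + 1] then 1 / s.real 6 [] else 0 := by
  refine (polyDet_fill (by simp) _ _ _ ?_ (by simp [ic_low])).mono fun s s' h =>
    ⟨h.1.keep, by simpa using h.2.2, fun i θ a hc => ?_⟩
  · simp [FillLow, BigExp.Low, Bd.Low, RExp.Low, IExp.Low, Test.Low, ic_low, rc_low]
  · have := h.2.1 [i, θ, a]
    simp [fillVal, hc.1, hc.2.1, hc.2.2, BigExp.val, RExp.eval, IExp.eval, Test.holds] at this
    rw [this]
    simp

lemma polyDet_forget : PolyDet cmdForget fun s s' => Keep [] [3] s s' ∧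
    (∀ l, ¬ [s.int 3 []] <+: l → s'.real 3 l = s.real 3 l) ∧
    ∀ i θ a, InCell s i θ a → s'.real 3 [s.int 3 [], i, θ, a] = 0 := by
  refine (polyDet_fill (by simp) _ _ _ ?_ (by simp [ic_low])).mono fun s s' h =>
    ⟨h.1.keep, by simpa using h.2.2, fun i θ a hc => ?_⟩
  · simp [FillLow, BigExp.Low, Bd.Low, RExp.Low, IExp.Low, ic_low]
  · have := h.2.1 [i, θ, a]
    simpa [fillVal, hc.1, hc.2.1, hc.2.2, BigExp.val, RExp.eval, IExp.eval] using this

lemma iterate_app_congr {Θ A : ℕ} {K K' : ℕ → ℕ → ℕ → ℕ → ℝ}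
    (h : ∀ θ < Θ, ∀ a < A, ∀ θ' < Θ, ∀ a' < A, K θ a θ' a' = K' θ a θ' a') (k : ℕ)
    (x : ℕ → ℕ → ℝ) : ∀ θ < Θ, ∀ a < A, (app Θ A K)^[k] x θ a = (app Θ A K')^[k] x θ a := by
  induction k with
  | zero => exact fun _ _ _ _ => rfl
  | succ k ih =>
    intro θ hθ a ha
    rw [Function.iterate_succ_apply', Function.iterate_succ_apply', app_congr ih]
    exact sum_congr rfl fun θ' hθ' => sum_congr rfl fun a' ha' => by
      rw [h θ hθ a ha θ' (mem_range.1 hθ') a' (mem_range.1 ha')]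

/-- The kernel of player `i` learnt from the history in the memory. -/
def learnt (s : State) (i : ℕ) : ℕ → ℕ → ℕ → ℕ → ℝ :=
  wtKernel (s.int 1 [i]) (s.int 2 [i]) (wt (s.real 4 []) (fun t => hist 2 s t i)
    (fun t => hist 3 s t i) (s.int 3 []))

/-- The real arrays that the computation of the strategies of a round overwrites, apart from the
entries of the current round in the arrays `2` and `3`. -/
abbrev workArrays : List ℕ := [2, 3, 7, 8, 9, 10, 11, 12, 13, 14, 16, 17]

open Classical in
/-- The strategies of a round are obtained from the average of the iterates of the learnt
deviation, and the estimates of the round are cleared. -/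
lemma polyDet_strategies : PolyDet cmdStrategies fun s s' => Keep [14] workArrays s s' ∧
    (∀ l, ¬ [s.int 3 []] <+: l → s'.real 2 l = s.real 2 l ∧ s'.real 3 l = s.real 3 l) ∧
    (∀ i < s.int 0 [], ∀ θ < s.int 1 [i], ∀ a ≤ s.int 2 [i], s'.real 14 [i, θ, a] =
      ∑ b ∈ range a, (∑ k ∈ range ⌈s.real 4 []⌉₊, (app (s.int 1 [i]) (s.int 2 [i])
        (learnt s i))^[k] (fun _ _ => 1 / (s.int 2 [i] : ℝ)) θ b) * s.real 6 [] / s.real 4 []) ∧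
    ∀ i θ a, InCell s i θ a → s'.real 3 [s.int 3 [], i, θ, a] = 0 ∧
      s'.real 2 [s.int 3 [], i, θ, a] =
        ∑ m ∈ range ⌈s.real 6 []⌉₊, if (m : ℝ) < s'.real 14 [i, θ, a] then 0 else
          if (m : ℝ) < s'.real 14 [i, θ, a + 1] then 1 / s.real 6 [] else 0 := by
  have m : ∀ {I R s s'}, Keep I R s s' → I ⊆ [14] → R ⊆ workArrays → Keep [14] workArrays s s' :=
    fun h => h.mono
  refine (polyDet_learn.seq (polyDet_average.seq (polyDet_cumulate.seq (polyDet_play.seq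
    polyDet_forget fun N s s' hs k => k.1.small hs (by simp) (by simp))
    fun N s s' hs k => k.1.small hs (by simp) (by simp))
    fun N s s' hs k => k.1.small hs (by simp) (by simp))
    fun N s s' hs k => k.1.small hs (by simp) (by simp)).mono ?_
  rintro s s' ⟨s₁, k₁, s₂, k₂, s₃, k₃, s₄, k₄, k₅⟩
  refine ⟨((((m k₁.1 (by simp) (by simp)).trans (m k₂.1 (by simp) (by simp))).trans
    (m k₃.1 (by simp) (by simp))).trans (m k₄.1 (by simp) (by simp))).trans
    (m k₅.1 (by simp) (by simp)), ?_, ?_, ?_⟩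
  all_goals
    obtain ⟨⟨i₁, r₁⟩, k₁⟩ := k₁
    obtain ⟨⟨i₂, r₂⟩, k₂⟩ := k₂
    obtain ⟨⟨i₃, r₃⟩, k₃⟩ := k₃
    obtain ⟨⟨i₄, r₄⟩, k₄⟩ := k₄
    obtain ⟨⟨i₅, r₅⟩, k₅⟩ := k₅
    simp [InCell, i₁, i₂, i₃, i₄, r₁, r₂, r₃, r₄, r₅] at k₂ k₃ k₄ k₅ ⊢
  · intro l hl
    rw [k₄.1 l hl, k₅.1 l hl]
    exact ⟨rfl, rfl⟩
  · intro i hi θ hθ a ha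
    rw [k₃ i hi θ hθ a ha]
    refine sum_congr rfl fun b hb => ?_
    rw [mem_range] at hb
    rw [k₂ i θ b hi hθ (by omega)]
    congr 2
    refine sum_congr rfl fun k _ => ?_
    rw [iterate, i₁ 1 (by norm_num) (by simp), i₁ 2 (by norm_num) (by simp)]
    exact iterate_app_congr (k₁ i hi) k _ θ hθ b (by omega)
  · intro i θ a hi hθ ha
    rw [k₅.2 i θ a hi hθ ha, k₄.2 i θ a hi hθ ha]
    exact ⟨rfl, rfl⟩

end Strategies

/-! ### Correctness of the strategies -/

section Correctness

open Finset

variable {n : ℕ} (G : BayesianGame n)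

/-- The part of the memory that stays the same in all rounds: the size of the game, the accuracy
parameter `H`, and the number `2 ^ k` of grid points. -/
structure Base (H k : ℕ) (s : State) : Prop where
  players : s.int 0 [] = n
  types : ∀ i : Fin n, s.int 1 [(i : ℕ)] = G.numTypes i
  acts : ∀ i : Fin n, s.int 2 [(i : ℕ)] = G.numActions i
  accuracy : s.real 4 [] = H
  bits : s.int 6 [] = k
  grid : s.real 6 [] = ((2 ^ k : ℕ) : ℝ)

/-- `H` bounds the size of the game, and the grid is fine enough for `H`. -/
structure Params (H k : ℕ) : Prop where
  pos : 0 < H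
  types_le : ∀ i, G.numTypes i ≤ H
  acts_le : ∀ i, G.numActions i ≤ H
  fine : H ^ 2 ≤ 2 ^ k

/-- The strategies of round `t` are obtained by rounding from the cumulative distribution functions
in array `14`. -/
def Cumulative (k t : ℕ) (s : State) : Prop :=
  ∀ i : Fin n, ∀ θ < G.numTypes i, s.real 14 [i, θ, 0] = 0 ∧
    s.real 14 [i, θ, G.numActions i] = ((2 ^ k : ℕ) : ℝ) ∧
    ∀ a < G.numActions i, s.real 14 [i, θ, a] ≤ s.real 14 [i, θ, a + 1] ∧
      hist 2 s t i θ a = rounded (2 ^ k) (fun a => s.real 14 [i, θ, a]) a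

variable {G}

lemma Base.congr {H k : ℕ} {s s' : State} (h : Base G H k s) (h0 : s'.int 0 = s.int 0)
    (h1 : s'.int 1 = s.int 1) (h2 : s'.int 2 = s.int 2) (h6 : s'.int 6 = s.int 6)
    (r4 : s'.real 4 = s.real 4) (r6 : s'.real 6 = s.real 6) : Base G H k s' := by
  constructor
  · rw [h0, h.players]
  · rw [h1]; exact h.types
  · rw [h2]; exact h.acts
  · rw [r4, h.accuracy]
  · rw [h6, h.bits]
  · rw [r6, h.grid]

lemma wt_congr {H : ℝ} {y y' u u' : ℕ → ℕ → ℕ → ℝ} {t : ℕ}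
    (h : ∀ s < t, y s = y' s ∧ u s = u' s) : wt H y u t = wt H y' u' t := by
  funext θ θ' a' a
  refine prod_congr rfl fun s hs => ?_
  rw [(h s (mem_range.1 hs)).1, (h s (mem_range.1 hs)).2]

lemma RoundOK.congr {H : ℝ} {y y' u u' : ℕ → ℕ → ℕ → ℕ → ℝ} {t : ℕ} (h : RoundOK G H y u t)
    (hyu : ∀ s ≤ t, y' s = y s ∧ u' s = u s) : RoundOK G H y' u' t := by
  refine ⟨?_, ?_, fun i => ?_⟩
  · rw [(hyu t le_rfl).1]; exact h.profile
  · rw [(hyu t le_rfl).2]; exact h.mem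
  · have e : wt H (fun s => y' s i) (fun s => u' s i) t =
        wt H (fun s => y s i) (fun s => u s i) t :=
      wt_congr fun s hs => ⟨by rw [(hyu s hs.le).1], by rw [(hyu s hs.le).2]⟩
    rw [e, (hyu t le_rfl).1]
    exact h.fixed i

lemma hist_congr {x t t₀ : ℕ} {s s' : State} (h : ∀ l, ¬ [t₀] <+: l → s'.real x l = s.real x l)
    (ht : t ≠ t₀) : hist x s' t = hist x s t := by
  funext i θ a
  refine h _ ?_
  simpa using ht.symm

open Classical in
/-- The strategies computed in a round are almost invariant under the learnt deviations. -/
lemma strategies_spec {H k : ℕ} (hp : Params G H k) {s s' : State} (hs : Base G H k s)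
    (hok : ∀ t < s.int 3 [], RoundOK G H (hist 2 s) (hist 3 s) t)
    (hkeep : ∀ l, ¬ [s.int 3 []] <+: l → s'.real 2 l = s.real 2 l ∧ s'.real 3 l = s.real 3 l)
    (hcum : ∀ i < s.int 0 [], ∀ θ < s.int 1 [i], ∀ a ≤ s.int 2 [i], s'.real 14 [i, θ, a] =
      ∑ b ∈ range a, (∑ k ∈ range ⌈s.real 4 []⌉₊, (app (s.int 1 [i]) (s.int 2 [i])
        (learnt s i))^[k] (fun _ _ => 1 / (s.int 2 [i] : ℝ)) θ b) * s.real 6 [] / s.real 4 [])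
    (hplay : ∀ i θ a, InCell s i θ a → s'.real 3 [s.int 3 [], i, θ, a] = 0 ∧
      s'.real 2 [s.int 3 [], i, θ, a] =
        ∑ m ∈ range ⌈s.real 6 []⌉₊, if (m : ℝ) < s'.real 14 [i, θ, a] then 0 else
          if (m : ℝ) < s'.real 14 [i, θ, a + 1] then 1 / s.real 6 [] else 0) :
    Cumulative G k (s.int 3 []) s' ∧ IsProfile G (hist 2 s' (s.int 3 [])) ∧
    ∀ i : Fin n, ∀ θ < G.numTypes i, ∑ a ∈ range (G.numActions i),
      |app (G.numTypes i) (G.numActions i) (wtKernel (G.numTypes i) (G.numActions i)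
        (wt H (fun t => hist 2 s' t i) (fun t => hist 3 s' t i) (s.int 3 [])))
        (hist 2 s' (s.int 3 []) i) θ a - hist 2 s' (s.int 3 []) i θ a| ≤ 4 / H := by
  set T := s.int 3 [] with hT
  have hH0 : (0 : ℝ) < H := by exact_mod_cast hp.pos
  have hK0 : (0 : ℝ) < ((2 ^ k : ℕ) : ℝ) := by positivity
  -- the iterates of the learnt deviation
  set X : Fin n → ℕ → ℕ → ℕ → ℝ := fun i k => (app (G.numTypes i) (G.numActions i)
    (learnt s i))^[k] (fun _ _ => 1 / (G.numActions i : ℝ)) with hX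
  have hlearn : ∀ i : Fin n, learnt s i = wtKernel (G.numTypes i) (G.numActions i)
      (wt H (fun t => hist 2 s' t i) (fun t => hist 3 s' t i) T) := by
    intro i
    rw [learnt, hs.types, hs.acts, hs.accuracy]
    congr 1
    exact wt_congr fun t ht =>
      ⟨by rw [hist_congr (fun l hl => (hkeep l hl).1) (ne_of_lt ht)],
        by rw [hist_congr (fun l hl => (hkeep l hl).2) (ne_of_lt ht)]⟩
  have hdev : ∀ i : Fin n, IsDeviation (G.numTypes i) (G.numActions i) (learnt s i) := by
    intro i
    rw [learnt, hs.types, hs.acts, hs.accuracy]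
    exact (wt_pos hH0 (fun t ht => (hok t ht).profile i) fun t ht => (hok t ht).mem i).isDeviation
  have hX0 : ∀ i, IsStrat (G.numTypes i) (G.numActions i) (X i 0) := fun i θ hθ => by
    have : (G.numActions i : ℝ) ≠ 0 := by exact_mod_cast (G.numActions_pos i).ne'
    refine ⟨fun a _ => by simp only [hX, Function.iterate_zero, id]; positivity, ?_⟩
    simp [hX, this]
  have hXs : ∀ i k, IsStrat (G.numTypes i) (G.numActions i) (X i k) := by
    intro i k
    induction k with
    | zero => exact hX0 i
    | succ k ih =>
      rw [hX]
      simp only [Function.iterate_succ_apply']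
      exact (hdev i).app_isStrat ih
  have hc : ∀ i : Fin n, ∀ θ < G.numTypes i, ∀ a ≤ G.numActions i, s'.real 14 [i, θ, a] =
      ∑ b ∈ range a, (∑ k ∈ range H, X i k θ b) * ((2 ^ k : ℕ) : ℝ) / H := by
    intro i θ hθ a ha
    have := hcum i (by rw [hs.players]; exact i.2) θ (by rwa [hs.types]) a (by rwa [hs.acts])
    rw [this, hs.accuracy, hs.grid, hs.types, hs.acts, Nat.ceil_natCast]
  have hsucc : ∀ i : Fin n, ∀ θ < G.numTypes i, ∀ a < G.numActions i, s'.real 14 [i, θ, a + 1] =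
      s'.real 14 [i, θ, a] + (∑ k ∈ range H, X i k θ a) * ((2 ^ k : ℕ) : ℝ) / H := by
    intro i θ hθ a ha
    rw [hc i θ hθ _ ha, hc i θ hθ _ ha.le, sum_range_succ]
  have hmono : ∀ i : Fin n, ∀ θ < G.numTypes i, ∀ a < G.numActions i,
      s'.real 14 [i, θ, a] ≤ s'.real 14 [i, θ, a + 1] := by
    intro i θ hθ a ha
    rw [hsucc i θ hθ a ha, le_add_iff_nonneg_right]
    exact div_nonneg (mul_nonneg (sum_nonneg fun k _ => (hXs i k θ hθ).1 a ha) hK0.le) hH0.le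
  have h0 : ∀ i : Fin n, ∀ θ < G.numTypes i, s'.real 14 [i, θ, 0] = 0 := by
    intro i θ hθ
    rw [hc i θ hθ 0 (Nat.zero_le _), range_zero, sum_empty]
  have hA : ∀ i : Fin n, ∀ θ < G.numTypes i,
      s'.real 14 [i, θ, G.numActions i] = ((2 ^ k : ℕ) : ℝ) := by
    intro i θ hθ
    rw [hc i θ hθ _ le_rfl, ← sum_div, ← sum_mul, sum_comm,
      sum_congr rfl fun k _ => (hXs i k θ hθ).2]
    simp [hH0.ne']
  have hy : ∀ i : Fin n, ∀ θ < G.numTypes i, ∀ a < G.numActions i,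
      hist 2 s' T i θ a = rounded (2 ^ k) (fun a => s'.real 14 [i, θ, a]) a := by
    intro i θ hθ a ha
    have hcell : InCell s i θ a := by
      refine ⟨by rw [hs.players]; exact i.2, by rwa [hs.types], by rwa [hs.acts]⟩
    rw [hist, (hplay i θ a hcell).2, hs.grid, Nat.ceil_natCast]
    rfl
  have hprof : IsProfile G (hist 2 s' T) := by
    refine fun i θ hθ => ⟨fun a ha => ?_, ?_⟩
    · rw [hy i θ hθ a ha]
      exact rounded_nonneg _ _ _
    · rw [sum_congr rfl fun a ha => hy i θ hθ a (mem_range.1 ha)]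
      exact sum_rounded (by positivity) (h0 i θ hθ) (hA i θ hθ) (hmono i θ hθ)
  refine ⟨fun i θ hθ => ⟨h0 i θ hθ, hA i θ hθ, fun a ha => ⟨hmono i θ hθ a ha, hy i θ hθ a ha⟩⟩,
    hprof, fun i θ hθ => ?_⟩
  rw [← hlearn]
  refine ((hdev i).almost_fixed (G.numActions_pos i) (hX0 i) (fun k θ _ a _ => ?_) hp.pos
    (C := 1 / H) (fun θ hθ => ?_) hθ).trans (le_of_eq (by ring))
  · simp only [hX, Function.iterate_succ_apply']
  · calc ∑ a ∈ range (G.numActions i), |hist 2 s' T i θ a - (∑ k ∈ range H, X i k θ a) / H|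
        ≤ ∑ a ∈ range (G.numActions i), 1 / ((2 ^ k : ℕ) : ℝ) := by
          refine sum_le_sum fun a ha => ?_
          rw [mem_range] at ha
          have := abs_rounded_sub_le (h0 i θ hθ) (hA i θ hθ) (hmono i θ hθ) ha
          have e : (∑ k ∈ range H, X i k θ a) * ((2 ^ k : ℕ) : ℝ) / H / ((2 ^ k : ℕ) : ℝ) =
              (∑ k ∈ range H, X i k θ a) / H := by
            rw [div_right_comm, mul_div_cancel_right₀ _ hK0.ne']
          rw [hsucc i θ hθ a ha, add_sub_cancel_left, e] at this
          rwa [hy i θ hθ a ha]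
      _ ≤ 1 / H := by
          rw [sum_const, card_range, nsmul_eq_mul, mul_one_div, div_le_div_iff₀ hK0 hH0, one_mul]
          have h1 : (G.numActions i : ℝ) ≤ H := by exact_mod_cast hp.acts_le i
          have h2 : (H : ℝ) ^ 2 ≤ ((2 ^ k : ℕ) : ℝ) := by exact_mod_cast hp.fine
          nlinarith

end Correctness

/-! ### Sampling -/

section Sampling

open Finset

/-- Draw a grid point by as many coin tosses as scalar `6` says, and write the action that it
determines for the player in scalar `23`, whose type is in array `10`, to array `12`. The inner
loop counts the actions whose cumulative probability does not exceed the grid point. -/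
def cmdDraw : Cmd :=
  .seq (asgInt 13 [] (.lit 0))
  (.seq (forLoop 24 (.ofInt (ic 6 [])) (.seq (.coin 11)
    (asgInt 13 [] (.add (.add (ic 13 []) (ic 13 [])) (ic 11 [])))))
  (.seq (asgInt 12 [ic 23 []] (.lit 0))
    (forLoop 25 (.ofInt (ic 2 [ic 23 []]))
      (.branch (.realLt (.ofInt (ic 13 []))
          (rc 14 [ic 23 [], ic 10 [ic 23 []], .add (ic 25 []) (.lit 1)]))
        (asgInt 11 [] (.lit 0))
        (asgInt 12 [ic 23 []] (.add (ic 12 [ic 23 []]) (.lit 1)))))))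

/-- The fourth power of the accuracy parameter: the number of rounds, and the number of samples for
every estimate. -/
def powH : RExp := .mul (.mul (rc 4 []) (rc 4 [])) (.mul (rc 4 []) (rc 4 []))

/-- One sample for the estimates in the current round for the player in scalar `20` with the type
in scalar `21`. The actions of all players are drawn, and then the own action is replaced by each
of the possible actions in turn. -/
def cmdSample : Cmd :=
  .seq (.sampleOthers 10 (ic 20 []) (ic 21 []))
  (.seq (asgInt 10 [ic 20 []] (ic 21 []))
  (.seq (forLoop 23 (.ofInt (ic 0 [])) cmdDraw)
    (forLoop 25 (.ofInt (ic 2 [ic 20 []]))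
      (.seq (asgInt 12 [ic 20 []] (ic 25 []))
      (.seq (.utility 15 (ic 20 []) 10 12)
        (asgReal 3 [ic 3 [], ic 20 [], ic 21 [], ic 25 []]
          (.add (rc 3 [ic 3 [], ic 20 [], ic 21 [], ic 25 []]) (.div (rc 15 []) powH))))))))

/-- The estimates of the current round. -/
def cmdEstimate : Cmd :=
  forLoop 20 (.ofInt (ic 0 [])) (forLoop 21 (.ofInt (ic 1 [ic 20 []])) (forLoop 22 powH cmdSample))

lemma eval_powH {s : State} {H : ℕ} (h : s.real 4 [] = H) : powH.eval s = ((H ^ 4 : ℕ) : ℝ) := by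
  simp only [powH, RExp.eval, eval_rc, List.map_nil, h]
  push_cast
  ring

variable {n : ℕ} {G : BayesianGame n} {κ : ∀ i : Fin n, Fin (G.numTypes i) → PMF G.Types}

/-- Outcomes may be renamed. -/
lemma Rand.map {α β : Type*} {c : Cmd} {s : State} {B : ℕ} {E : (α → ℝ≥0∞) → ℝ≥0∞}
    {E' : (β → ℝ≥0∞) → ℝ≥0∞} {Q : α → State → Prop} {Q' : β → State → Prop}
    (h : Rand G κ c s B E Q) (φ : α → β) (hQ : ∀ a s', Q a s' → Q' (φ a) s')
    (hE : ∀ g, E (fun a => g (φ a)) ≤ E' g) : Rand G κ c s B E' Q' :=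
  fun f g hf => (h f _ fun a s' hs => hf _ s' (hQ a s' hs)).trans (hE g)

lemma rand_coin (x : ℕ) (s : State) :
    Rand G κ (.coin x) s 1 (fun g : ℕ → ℝ≥0∞ => (g 0 + g 1) / 2)
      fun b s' => b < 2 ∧ s' = s.setInt x [] b := by
  intro f g hf
  refine (wp_of_step ((PMF.uniformOfFintype (Fin 2)).map fun b : Fin 2 => (b : ℕ))
    (fun b => s.setInt x [] b) (fun k => by rw [step]; rfl) f).trans ?_
  show _ ≤ (g 0 + g 1) / 2
  rw [mean_map, mean_fintype, Fin.sum_univ_two, ENNReal.div_eq_inv_mul, mul_add]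
  simp only [PMF.uniformOfFintype_apply, Fintype.card_fin, Nat.cast_ofNat]
  gcongr <;> exact hf _ _ ⟨by norm_num, rfl⟩

/-- Successive bits give a uniformly distributed number. -/
lemma iterExp_bits (g : ℕ → ℝ≥0∞) (j m u : ℕ) :
    iterExp (fun _ u (g : ℕ → ℝ≥0∞) => (g (u + u + 0) + g (u + u + 1)) / 2) j m u g =
      (∑ v ∈ range (2 ^ m), g (u * 2 ^ m + v)) / (2 ^ m : ℕ) := by
  induction m generalizing j u with
  | zero => simp [iterExp]
  | succ m ih =>
    show (iterExp _ _ _ _ g + iterExp _ _ _ _ g) / 2 = _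
    rw [ih, ih, pow_succ, mul_two, sum_range_add, ENNReal.div_add_div_same,
      div_eq_mul_inv, div_eq_mul_inv, div_eq_mul_inv, mul_assoc,
      ← ENNReal.mul_inv (by simp) (by simp)]
    congr 1
    · congr 1 <;> refine sum_congr rfl fun v _ => ?_ <;> congr 1 <;> ring
    · congr 1; push_cast; ring

lemma keep_setInt {I R : List ℕ} {s : State} {x : ℕ} (hx : x ∈ I) (l : List ℕ) (v : ℕ) :
    Keep I R s (s.setInt x l v) :=
  ⟨fun _ _ hy => setInt_int_ne _ (ne_of_mem_of_not_mem hx hy).symm _ _, fun _ _ _ => rfl⟩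

lemma keep_setReal {I R : List ℕ} {s : State} {x : ℕ} (hx : x ∈ R) (l : List ℕ) (v : ℝ) :
    Keep I R s (s.setReal x l v) :=
  ⟨fun _ _ _ => rfl, fun _ _ hy => setReal_real_ne _ (ne_of_mem_of_not_mem hx hy).symm _ _⟩

/-- The cost of drawing an action. -/
def drawCost (N : ℕ) : ℕ := forCost N 3 + forCost N 2 + 5

/-- The action is distributed according to the rounded strategy. The array `14` holds the
cumulative distribution function `c`. -/
lemma rand_draw {s : State} {j A k N : ℕ} (hj : s.int 23 [] = j) (hA : s.int 2 [j] = A)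
    (hk : s.int 6 [] = k) (hAN : A ≤ N) (hkN : k ≤ N) {c : ℕ → ℝ}
    (hc : ∀ a, s.real 14 [j, s.int 10 [j], a] = c a) (h0 : c 0 = 0)
    (hcA : c A = ((2 ^ k : ℕ) : ℝ)) (hmono : ∀ a < A, c a ≤ c (a + 1)) :
    Rand G κ cmdDraw s (drawCost N)
      (fun g : ℕ → ℝ≥0∞ => ∑ b ∈ range A, ENNReal.ofReal (rounded (2 ^ k) c b) * g b)
      fun b s' => b < A ∧ Keep [11, 12, 13, 24, 25] [] s s' ∧ s'.int 12 [j] = b ∧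
        ∀ l, l ≠ [j] → s'.int 12 l = s.int 12 l := by
  have hbits : ∀ s₁ : State, Keep [11, 13, 24] [] s s₁ → s₁.int 13 [] = 0 →
      Rand G κ (forLoop 24 (.ofInt (ic 6 [])) (.seq (.coin 11)
        (asgInt 13 [] (.add (.add (ic 13 []) (ic 13 [])) (ic 11 []))))) s₁ (forCost k 3)
        (fun g : ℕ → ℝ≥0∞ => (∑ v ∈ range (2 ^ k), g v) / (2 ^ k : ℕ)) fun u s' =>
          u < 2 ^ k ∧ Keep [11, 13, 24] [] s s' ∧ s'.int 13 [] = u := by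
    intro s₁ hs₁ hz
    refine Rand.map (Rand.forLoop (fun j u s' => s'.int 24 [] = j ∧ u < 2 ^ j ∧
      Keep [11, 13, 24] [] s s' ∧ s'.int 13 [] = u)
      (fun _ u g => (g (u + u + 0) + g (u + u + 1)) / 2) 0 k ?_ ?_ ?_) id (fun u s' h => h.2) ?_
    · rintro j u s' ⟨h1, -, h2, -⟩
      refine ⟨h1, ?_⟩
      rw [RExp.eval, Nat.ceil_natCast, eval_ic, List.map_nil, h2.1 6 (by norm_num) (by simp), hk]
    · exact ⟨by simp, by simp, hs₁.trans (keep_setInt (by simp) _ _), by simp [hz]⟩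
    · rintro j u s' hj ⟨h1, h2, h3, h4⟩
      have hstep := Rand.seq_det (rand_coin (G := G) (κ := κ) 11 s') (B₂ := 1)
        (d := asgInt 13 [] (.add (.add (ic 13 []) (ic 13 [])) (ic 11 [])))
        (Q' := fun b s'' => b < 2 ∧ Keep [11, 13, 24] [] s s'' ∧ s''.int 24 [] = j ∧
          s''.int 13 [] = u + u + b) ?_
      · refine Rand.map hstep (fun b => u + u + b) ?_ fun g => le_rfl
        rintro b s'' ⟨hb, h5, h6, h7⟩
        refine ⟨by simp [h6], ?_, h5.trans (keep_setInt (by simp) _ _), by simp [h7]⟩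
        rw [pow_succ]; omega
      · rintro b _ ⟨hb, rfl⟩
        refine det_asgInt ⟨hb, (h3.trans (keep_setInt (by simp) _ _)).trans
          (keep_setInt (by simp) _ _), ?_, ?_⟩
        · simp [h1]
        · simp [IExp.eval, h4]
    · intro g
      rw [iterExp_bits]
      simp
  have hcount : ∀ (u : ℕ) (s₁ : State), Keep [11, 13, 24] [] s s₁ → s₁.int 13 [] = u →
      Det G κ (.seq (asgInt 12 [ic 23 []] (.lit 0)) (forLoop 25 (.ofInt (ic 2 [ic 23 []]))
        (.branch (.realLt (.ofInt (ic 13 []))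
          (rc 14 [ic 23 [], ic 10 [ic 23 []], .add (ic 25 []) (.lit 1)]))
        (asgInt 11 [] (.lit 0))
        (asgInt 12 [ic 23 []] (.add (ic 12 [ic 23 []]) (.lit 1)))))) s₁ (1 + forCost A 2 + 1)
        fun s' => Keep [11, 12, 13, 24, 25] [] s s' ∧ s'.int 12 [j] = draw A c u ∧
          ∀ l, l ≠ [j] → s'.int 12 l = s.int 12 l := by
    intro u s₁ hs₁ hu
    have hs₁' : Keep [11, 12, 13, 24, 25] [] s s₁ := hs₁.mono (by simp) (by simp)
    refine Det.seq (det_asgInt (Q := fun s' => Keep [11, 12, 13, 24, 25] [] s s' ∧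
      s'.int 13 [] = u ∧ s'.int 12 [j] = 0 ∧ ∀ l, l ≠ [j] → s'.int 12 l = s.int 12 l) ?_) ?_
    · have e : s₁.int 23 [] = j := by rw [hs₁.1 23 (by norm_num) (by simp), hj]
      refine ⟨hs₁'.trans (keep_setInt (by simp) _ _), by simp [hu], by simp [e, IExp.eval],
        fun l hl => ?_⟩
      simp [e, hl, hs₁.1 12 (by norm_num) (by simp)]
    · rintro s₂ ⟨k₂, h13, h12, hl⟩
      refine (Det.forLoop (fun b s' => Keep [11, 12, 13, 24, 25] [] s s' ∧ s'.int 13 [] = u ∧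
        (∀ l, l ≠ [j] → s'.int 12 l = s.int 12 l) ∧ s'.int 25 [] = b ∧
        s'.int 12 [j] = draw b c u) A ?_ ?_ ?_).mono le_rfl fun s' h => ⟨h.1, h.2.2.2.2, h.2.2.1⟩
      · rintro b s' ⟨h1, -, -, h2, -⟩
        refine ⟨h2, ?_⟩
        rw [RExp.eval, Nat.ceil_natCast, eval_ic, List.map_singleton, eval_ic, List.map_nil,
          h1.1 23 (by norm_num) (by simp), h1.1 2 (by norm_num) (by simp), hj, hA]
      · exact ⟨k₂.trans (keep_setInt (by simp) _ _), by simp [h13], by simpa using hl, by simp,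
          by simp [h12, draw]⟩
      · rintro b s' hb ⟨h1, h2, h3, h4, h5⟩ f r hf
        have e23 : s'.int 23 [] = j := by rw [h1.1 23 (by norm_num) (by simp), hj]
        have e10 : s'.int 10 = s.int 10 := h1.1 10 (by norm_num) (by simp)
        have e14 : s'.real 14 = s.real 14 := h1.2 14 (by norm_num) (by simp)
        by_cases ht : (Test.realLt (.ofInt (ic 13 []))
          (rc 14 [ic 23 [], ic 10 [ic 23 []], .add (ic 25 []) (.lit 1)])).holds s'
        · refine (wp_branch_pos ht _ _ _ _).trans (det_asgInt (Q := fun s'' => _) ?_ f r hf)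
          simp [Test.holds, RExp.eval, IExp.eval, e23, h2, h4, e10, e14, hc] at ht
          refine ⟨(h1.trans (keep_setInt (by simp) _ _)).trans (keep_setInt (by simp) _ _),
            by simp [h2], by simpa using h3, by simp [h4], ?_⟩
          simp [h5, draw, range_add_one, filter_insert, not_le.2 ht]
        · refine (wp_branch_neg ht _ _ _ _).trans (det_asgInt (Q := fun s'' => _) ?_ f r hf)
          simp [Test.holds, RExp.eval, IExp.eval, e23, h2, h4, e10, e14, hc] at ht
          refine ⟨(h1.trans (keep_setInt (by simp) _ _)).trans (keep_setInt (by simp) _ _),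
            by simp [h2], fun l hl => by simpa [e23, hl] using h3 l hl, by simp [h4], ?_⟩
          simp [h5, e23, IExp.eval, draw, range_add_one, filter_insert, ht]
  refine Rand.map (Rand.mono (Det.seq_rand (det_asgInt (Q := fun s₁ => Keep [11, 13, 24] [] s s₁ ∧
    s₁.int 13 [] = 0) ⟨keep_setInt (by simp) _ _, by simp [IExp.eval]⟩) fun s₁ hs₁ =>
    Rand.seq_det (hbits s₁ hs₁.1 hs₁.2) (Q' := fun u s' => u < 2 ^ k ∧
      Keep [11, 12, 13, 24, 25] [] s s' ∧ s'.int 12 [j] = draw A c u ∧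
          ∀ l, l ≠ [j] → s'.int 12 l = s.int 12 l)
      fun u s₂ hs₂ => (hcount u s₂ hs₂.2.1 hs₂.2.2).mono le_rfl fun s' h => ⟨hs₂.1, h⟩)
    ?_ fun _ _ h => h) (draw A c) ?_ fun g => ?_
  · have := forCost_mono hkN (le_refl 3)
    have := forCost_mono hAN (le_refl 2)
    unfold drawCost
    omega
  · exact fun u s' h => ⟨draw_lt h0 hcA hmono h.1, h.2⟩
  · exact (sum_draw (by positivity) h0 hcA hmono g).le

/-- Independent draws, one after the other, have the product law. The coordinates before `j` have
been drawn already. -/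
lemma iterExp_prod {n : ℕ} {β : Fin n → Type*} [∀ i, Fintype (β i)] (p : ∀ i, β i → ℝ≥0∞)
    (g : (∀ i, β i) → ℝ≥0∞) {j m : ℕ} (hjm : j + m = n) (a : ∀ i, β i) :
    iterExp (fun j (a : ∀ i, β i) (g : (∀ i, β i) → ℝ≥0∞) => if h : j < n then
      ∑ b, p ⟨j, h⟩ b * g (Function.update a ⟨j, h⟩ b) else 0) j m a g =
    open Classical in
    ∑ a', (∏ i : Fin n, if (i : ℕ) < j then (if a' i = a i then 1 else 0) else p i (a' i)) *
      g a' := by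
  classical
  induction m generalizing j a with
  | zero =>
    obtain rfl : j = n := hjm
    have : ∀ a' : ∀ i, β i, (∏ i : Fin j, if (i : ℕ) < j then (if a' i = a i then (1 : ℝ≥0∞) else 0)
        else p i (a' i)) = if a' = a then 1 else 0 := by
      intro a'
      simp only [Fin.is_lt, if_true]
      by_cases h : a' = a
      · simp [h]
      · obtain ⟨i, hi⟩ := Function.ne_iff.1 h
        rw [if_neg h]
        exact prod_eq_zero (mem_univ i) (by simp [hi])
    simp only [iterExp, this]
    simp
  | succ m ih =>
    have hj : j < n := by omega
    simp only [iterExp, dif_pos hj]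
    simp only [ih (show j + 1 + m = n by omega), mul_sum]
    rw [sum_comm]
    refine sum_congr rfl fun a' _ => ?_
    simp only [← mul_assoc, ← sum_mul]
    congr 1
    set i₀ : Fin n := ⟨j, hj⟩ with hi₀
    have hr : ∀ b, ∏ i ∈ univ.erase i₀, (if (i : ℕ) < j + 1 then
        (if a' i = Function.update a i₀ b i then (1 : ℝ≥0∞) else 0) else p i (a' i)) =
        ∏ i ∈ univ.erase i₀, (if (i : ℕ) < j then
          (if a' i = a i then (1 : ℝ≥0∞) else 0) else p i (a' i)) := by
      intro b
      refine prod_congr rfl fun i hi => ?_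
      have hne : i ≠ i₀ := (mem_erase.1 hi).1
      have hne' : (i : ℕ) ≠ j := fun h => hne (Fin.ext h)
      rw [Function.update_of_ne hne]
      have : (i : ℕ) < j + 1 ↔ (i : ℕ) < j := by omega
      simp only [this]
    have hs : ∀ b, ∏ i : Fin n, (if (i : ℕ) < j + 1 then
        (if a' i = Function.update a i₀ b i then (1 : ℝ≥0∞) else 0) else p i (a' i)) =
        (if a' i₀ = b then 1 else 0) * ∏ i ∈ univ.erase i₀, (if (i : ℕ) < j then
          (if a' i = a i then (1 : ℝ≥0∞) else 0) else p i (a' i)) := by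
      intro b
      rw [← mul_prod_erase univ _ (mem_univ i₀), hr]
      simp [hi₀]
    simp only [hs, ← mul_assoc, ← sum_mul]
    rw [← mul_prod_erase univ _ (mem_univ i₀)]
    simp [hi₀]

lemma Cumulative.congr {k t : ℕ} {s s' : State} (h : Cumulative G k t s)
    (h2 : s'.real 2 = s.real 2) (h14 : s'.real 14 = s.real 14) : Cumulative G k t s' := by
  have e : hist 2 s' t = hist 2 s t := by funext i θ a; simp only [hist, h2]
  intro i θ hθ
  simpa only [h14, e] using h i θ hθ

lemma Base.keep {H k : ℕ} {I R : List ℕ} {s s' : State} (h : Base G H k s) (hs : Keep I R s s')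
    (hI : ∀ y ∈ [0, 1, 2, 6], y ∉ I) (hR : ∀ y ∈ [4, 6], y ∉ R) : Base G H k s' :=
  h.congr (hs.1 0 (by norm_num) (hI 0 (by simp))) (hs.1 1 (by norm_num) (hI 1 (by simp)))
    (hs.1 2 (by norm_num) (hI 2 (by simp))) (hs.1 6 (by norm_num) (hI 6 (by simp)))
    (hs.2 4 (by norm_num) (hR 4 (by simp))) (hs.2 6 (by norm_num) (hR 6 (by simp)))

/-- The actions of all players are drawn independently. -/
lemma rand_draws {s : State} {H k t N : ℕ} (hb : Base G H k s) (hc : Cumulative G k t s)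
    (hAN : ∀ i, G.numActions i ≤ N) (hkN : k ≤ N) {θ : G.Types}
    (hθ : ∀ j : Fin n, s.int 10 [(j : ℕ)] = θ j) :
    Rand G κ (forLoop 23 (.ofInt (ic 0 [])) cmdDraw) s (forCost n (drawCost N))
      (fun g : G.Actions → ℝ≥0∞ => ∑ a : G.Actions,
        (∏ j : Fin n, ENNReal.ofReal (hist 2 s t j (θ j) (a j))) * g a)
      fun a s' => Keep [11, 12, 13, 23, 24, 25] [] s s' ∧
        ∀ j : Fin n, s'.int 12 [(j : ℕ)] = a j := by
  have main := Rand.forLoop (G := G) (κ := κ) (x := 23) (b := .ofInt (ic 0 [])) (c := cmdDraw)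
    (B := drawCost N) (s := s) (fun j (a : G.Actions) s' => s'.int 23 [] = j ∧
      Keep [11, 12, 13, 23, 24, 25] [] s s' ∧ ∀ i : Fin n, (i : ℕ) < j → s'.int 12 [(i : ℕ)] = a i)
    (fun j (a : G.Actions) (g : G.Actions → ℝ≥0∞) => if h : j < n then
      ∑ b : Fin (G.numActions ⟨j, h⟩),
        ENNReal.ofReal (hist 2 s t j (θ ⟨j, h⟩) b) * g (Function.update a ⟨j, h⟩ b) else 0)
    (fun i => ⟨0, G.numActions_pos i⟩) n ?_ ?_ ?_
  · refine Rand.map main id (fun a s' h => ⟨h.2.1, fun j => h.2.2 j j.2⟩) fun g => ?_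
    refine (iterExp_prod (fun (j : Fin n) (b : Fin (G.numActions j)) =>
      ENNReal.ofReal (hist 2 s t j (θ j) b)) _ (zero_add n) _).le.trans
      ?_
    simp
  · rintro j a s' ⟨h1, h2, -⟩
    refine ⟨h1, ?_⟩
    rw [RExp.eval, Nat.ceil_natCast, eval_ic, List.map_nil, h2.1 0 (by norm_num) (by simp),
      hb.players]
  · exact ⟨by simp, keep_setInt (by simp) _ _, by simp⟩
  · rintro j a s' hj ⟨h1, h2, h3⟩
    set i : Fin n := ⟨j, hj⟩ with hi
    have hb' : Base G H k s' := hb.keep h2 (by simp) (by simp)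
    have hc' := (hc.congr (h2.2 2 (by norm_num) (by simp)) (h2.2 14 (by norm_num) (by simp)))
      i (θ i) (θ i).2
    have e10 : s'.int 10 [j] = θ i := by rw [h2.1 10 (by norm_num) (by simp)]; exact hθ i
    have e2 : hist 2 s' t = hist 2 s t := by
      funext i θ a; simp only [hist, h2.2 2 (by norm_num) (by simp)]
    refine Rand.map (rand_draw h1 (hb'.acts i) hb'.bits (hAN i) hkN (c := fun a =>
      s'.real 14 [j, θ i, a]) (fun a => by rw [e10]) hc'.1 hc'.2.1 fun a ha => (hc'.2.2 a ha).1)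
      (fun b => if h : b < G.numActions i then Function.update a i ⟨b, h⟩ else a) ?_ fun g => ?_
    · rintro b s'' ⟨hbA, h4, h5, h6⟩
      rw [dif_pos hbA]
      refine ⟨by simp [h4.1 23 (by norm_num) (by simp), h1],
        (h2.trans (h4.mono (by simp) (by simp))).trans (keep_setInt (by simp) _ _),
        fun i' hi' => ?_⟩
      by_cases hii : i' = i
      · subst hii; simp [h5, hi]
      · have hne : (i' : ℕ) ≠ j := fun h => hii (Fin.ext h)
        rw [setInt_int, if_neg (by simp), h6 _ (by simpa using hne), h3 i' (by omega),
          Function.update_of_ne hii]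
    · rw [dif_pos hj, sum_range]
      refine (sum_congr rfl fun b _ => ?_).le
      beta_reduce
      rw [dif_pos b.2, ← e2]
      exact congrArg (ENNReal.ofReal · * _) (hc'.2.2 b b.2).2.symm

lemma det_utility {r : ℕ} {i : IExp} {θ a : ℕ} {s : State} {Q : State → Prop}
    (h : Q (s.setReal r [] (utilityAnswer G s (i.eval s) θ a))) :
    Det G κ (.utility r i θ a) s 1 Q :=
  fun f _ hf => (wp_of_step_pure (fun k => by rw [step]) f).trans (hf _ h)

lemma rand_sampleOthers {x : ℕ} {e e' : IExp} {s : State} {i : Fin n} {t : Fin (G.numTypes i)}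
    (hi : e.eval s = i) (ht : e'.eval s = t) :
    Rand G κ (.sampleOthers x e e') s 1 (fun g : G.Types → ℝ≥0∞ => ∑ θ, κ i t θ * g θ)
      fun θ s' => s' = writeOthers G s x i θ := by
  intro f g hf
  have h : ∃ h : e.eval s < n, e'.eval s < G.numTypes ⟨e.eval s, h⟩ := by
    simp only [hi, ht]
    exact ⟨i.2, t.2⟩
  refine (wp_of_step (κ i t) (fun θ => writeOthers G s x i θ) (fun k => ?_) f).trans ?_
  · rw [step, dif_pos h]
    have h1 : (⟨e.eval s, h.1⟩ : Fin n) = i := Fin.ext hi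
    obtain ⟨h', h''⟩ := h
    obtain ⟨iv, hiv⟩ := i
    obtain ⟨tv, htv⟩ := t
    simp only at hi ht
    subst hi ht
    rfl
  · rw [mean_fintype]
    exact sum_le_sum fun θ _ => mul_le_mul_right (hf θ _ rfl) _

lemma utilityAnswer_eq {s : State} {i : Fin n} {x y : ℕ} {θ : G.Types} {a : G.Actions}
    (hθ : ∀ j : Fin n, s.int x [(j : ℕ)] = θ j) (ha : ∀ j : Fin n, s.int y [(j : ℕ)] = a j) :
    utilityAnswer G s i x y = G.utility i θ a := by
  have h : (i : ℕ) < n ∧ (∀ j : Fin n, s.int x [(j : ℕ)] < G.numTypes j) ∧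
      (∀ j : Fin n, s.int y [(j : ℕ)] < G.numActions j) :=
    ⟨i.2, fun j => by rw [hθ]; exact (θ j).2, fun j => by rw [ha]; exact (a j).2⟩
  rw [utilityAnswer, dif_pos h]
  congr 1
  · exact funext fun j => Fin.ext (hθ j)
  · exact funext fun j => Fin.ext (ha j)

/-- The cost of a sample. -/
def sampleCost (N : ℕ) : ℕ := forCost N (drawCost N) + forCost N 5 + 5

/-- The memory after one sample for player `i` with type `θ`: the value of the outcome `ω` has been
added to the accumulators for all actions. -/
structure Sampled (G : BayesianGame n) (H t : ℕ) (i : Fin n) (θ : Fin (G.numTypes i)) (s : State)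
    (ω : G.Types × G.Actions) (s' : State) : Prop where
  keep : Keep [10, 11, 12, 13, 23, 24, 25] [3, 15] s s'
  val : ∀ b < G.numActions i, s'.real 3 [t, i, θ, b] =
    s.real 3 [t, i, θ, b] + sampleValue G i θ ω b / (H ^ 4 : ℕ)
  frame : ∀ l, ¬ [t, (i : ℕ), (θ : ℕ)] <+: l → s'.real 3 l = s.real 3 l

/-- The outcome of a sample has the law `sampleWeight`. -/
lemma rand_sample {s : State} {H k t N : ℕ} (hb : Base G H k s) (hc : Cumulative G k t s)
    (hAN : ∀ i, G.numActions i ≤ N) (hkN : k ≤ N) (hnN : n ≤ N) {i : Fin n}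
    {θ : Fin (G.numTypes i)} (ht : s.int 3 [] = t) (hi : s.int 20 [] = i) (hθ : s.int 21 [] = θ) :
    Rand G κ cmdSample s (sampleCost N)
      (fun g : G.Types × G.Actions → ℝ≥0∞ => ∑ ω, sampleWeight G κ (hist 2 s t) i θ ω * g ω)
      (Sampled G H t i θ s) := by
  -- evaluating the payoffs of an outcome
  have heval : ∀ (ω : G.Types × G.Actions) (s₁ : State), Keep [10, 11, 12, 13, 23, 24, 25] [] s s₁ →
      (∀ j : Fin n, s₁.int 10 [(j : ℕ)] = Function.update ω.1 i θ j) →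
      (∀ j : Fin n, s₁.int 12 [(j : ℕ)] = ω.2 j) →
      Det G κ (forLoop 25 (.ofInt (ic 2 [ic 20 []]))
        (.seq (asgInt 12 [ic 20 []] (ic 25 []))
        (.seq (.utility 15 (ic 20 []) 10 12)
        (asgReal 3 [ic 3 [], ic 20 [], ic 21 [], ic 25 []]
          (.add (rc 3 [ic 3 [], ic 20 [], ic 21 [], ic 25 []]) (.div (rc 15 []) powH)))))) s₁
        (forCost (G.numActions i) 5) (Sampled G H t i θ s ω) := by
    intro ω s₁ hs₁ h10 h12
    refine (Det.forLoop (fun b s' => s'.int 25 [] = b ∧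
      Keep [10, 11, 12, 13, 23, 24, 25] [3, 15] s s' ∧
      (∀ j : Fin n, s'.int 10 [(j : ℕ)] = Function.update ω.1 i θ j) ∧
      (∀ j : Fin n, j ≠ i → s'.int 12 [(j : ℕ)] = ω.2 j) ∧
      (∀ b', s'.real 3 [t, i, θ, b'] = s.real 3 [t, i, θ, b'] +
        if b' < b then sampleValue G i θ ω b' / (H ^ 4 : ℕ) else 0) ∧
      ∀ l, ¬ [t, (i : ℕ), (θ : ℕ)] <+: l → s'.real 3 l = s.real 3 l) (G.numActions i) ?_ ?_
      ?_).mono le_rfl ?_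
    · rintro b s' ⟨h1, h2, -⟩
      refine ⟨h1, ?_⟩
      rw [RExp.eval, Nat.ceil_natCast, eval_ic, List.map_singleton, eval_ic, List.map_nil,
        h2.1 20 (by norm_num) (by simp), h2.1 2 (by norm_num) (by simp), hi, hb.acts]
    · exact ⟨by simp, (hs₁.mono (by simp) (by simp)).trans (keep_setInt (by simp) _ _),
        by simpa using h10, fun j _ => by simpa using h12 j,
        by simp [hs₁.2 3 (by norm_num) (by simp)], by simp [hs₁.2 3 (by norm_num) (by simp)]⟩
    · rintro b s' hbA ⟨h1, h2, h3, h4, h5, h6⟩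
      have e20 : s'.int 20 [] = i := by rw [h2.1 20 (by norm_num) (by simp), hi]
      have e21 : s'.int 21 [] = θ := by rw [h2.1 21 (by norm_num) (by simp), hθ]
      have e3 : s'.int 3 [] = t := by rw [h2.1 3 (by norm_num) (by simp), ht]
      have e4 : s'.real 4 [] = H := by rw [h2.2 4 (by norm_num) (by simp), hb.accuracy]
      refine Det.seq (B₁ := 1) (B₂ := 3) (Q := fun s'' => s'' = s'.setInt 12 [(i : ℕ)] b)
        (det_asgInt (by simp [e20, h1])) ?_
      rintro _ rfl
      refine Det.seq (B₁ := 1) (B₂ := 1) (Q := fun s'' => s'' =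
        (s'.setInt 12 [(i : ℕ)] b).setReal 15 [] (sampleValue G i θ ω b)) (det_utility ?_) ?_
      · have : (ic 20 []).eval (s'.setInt 12 [(i : ℕ)] b) = i := by simp [e20]
        rw [this, utilityAnswer_eq (θ := Function.update ω.1 i θ)
          (a := Function.update ω.2 i ⟨b, hbA⟩), sampleValue, dif_pos hbA]
        · intro j; simpa using h3 j
        · intro j
          by_cases hj : j = i
          · subst hj; simp
          · rw [setInt_int, if_neg (by simpa [Fin.ext_iff] using hj), h4 j hj,
              Function.update_of_ne hj]
      rintro _ rfl
      refine det_asgReal ⟨by simp [h1], ?_, ?_, ?_, ?_, ?_⟩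
      · exact (((h2.trans (keep_setInt (by simp) _ _)).trans (keep_setReal (by simp) _ _)).trans
          (keep_setReal (by simp) _ _)).trans (keep_setInt (by simp) _ _)
      · simpa using h3
      · intro j hj
        simpa [Fin.ext_iff.not.1 hj] using h4 j hj
      · intro b'
        by_cases hbb : b' = b
        · subst hbb
          have := h5 b'
          simp only [lt_irrefl, if_false, add_zero] at this
          simp [RExp.eval, e20, e21, e3, h1, this, powH, e4]
          congr 1; ring
        · have : b' < b + 1 ↔ b' < b := by omega
          simp [RExp.eval, e20, e21, e3, h1, hbb, h5 b', this]
      · intro l hl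
        rw [setInt_real, setReal_real, if_neg, setReal_real_ne _ (by norm_num), setInt_real,
          h6 l hl]
        rintro ⟨-, rfl⟩
        simp [e20, e21, e3] at hl
    · rintro s' ⟨-, h2, -, -, h5, h6⟩
      exact ⟨h2, fun b hbA => by rw [h5, if_pos hbA], h6⟩
  have hdraws : ∀ (θ' : G.Types) (s₁ : State), s₁ = writeOthers G s 10 i θ' →
      Rand G κ (.seq (asgInt 10 [ic 20 []] (ic 21 [])) (.seq (forLoop 23 (.ofInt (ic 0 [])) cmdDraw)
        (forLoop 25 (.ofInt (ic 2 [ic 20 []])) (.seq (asgInt 12 [ic 20 []] (ic 25 []))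
        (.seq (.utility 15 (ic 20 []) 10 12)
        (asgReal 3 [ic 3 [], ic 20 [], ic 21 [], ic 25 []]
          (.add (rc 3 [ic 3 [], ic 20 [], ic 21 [], ic 25 []]) (.div (rc 15 []) powH)))))))) s₁
        (1 + (forCost n (drawCost N) + forCost (G.numActions i) 5 + 1) + 1)
        (fun g : G.Types × G.Actions → ℝ≥0∞ => ∑ a : G.Actions,
          (∏ j : Fin n, ENNReal.ofReal (hist 2 s t j (Function.update θ' i θ j) (a j))) * g (θ', a))
        (Sampled G H t i θ s) := by
    rintro θ' _ rfl
    have hw : Keep [10, 11, 12, 13, 23, 24, 25] [] s (writeOthers G s 10 i θ') := by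
      refine ⟨fun y _ hy => ?_, fun _ _ _ => rfl⟩
      have hy' : y ≠ 10 := by simp at hy; tauto
      funext l
      simp only [writeOthers]
      split
      · split_ifs <;> simp_all
      · rfl
    have hw10 : ∀ j : Fin n, j ≠ i → (writeOthers G s 10 i θ').int 10 [(j : ℕ)] = θ' j := by
      intro j hj
      have : (j : ℕ) ≠ i := fun h => hj (Fin.ext h)
      simp [writeOthers, this]
    refine Det.seq_rand (det_asgInt (Q := fun s₂ => Keep [10, 11, 12, 13, 23, 24, 25] [] s s₂ ∧
      ∀ j : Fin n, s₂.int 10 [(j : ℕ)] = Function.update θ' i θ j)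
      ⟨hw.trans (keep_setInt (by simp) _ _), fun j => ?_⟩) fun s₂ hs₂ => ?_
    · have e20 := hw.1 20 (by norm_num) (by simp)
      have e21 := hw.1 21 (by norm_num) (by simp)
      by_cases hj : j = i
      · subst hj; simp [e20, e21, hi, hθ]
      · have : (j : ℕ) ≠ i := fun h => hj (Fin.ext h)
        simp [e20, hi, this, hw10 j hj, hj]
    · have e2 : hist 2 s₂ t = hist 2 s t := by
        funext i θ a; simp only [hist, hs₂.1.2 2 (by norm_num) (by simp)]
      have h1 := rand_draws (κ := κ) (hb.keep hs₂.1 (by simp) (by simp))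
        (hc.congr (hs₂.1.2 2 (by norm_num) (by simp)) (hs₂.1.2 14 (by norm_num) (by simp)))
        hAN hkN hs₂.2
      rw [e2] at h1
      have h1' := h1.map (fun a => ((θ', a) : G.Types × G.Actions))
        (E' := fun g => ∑ a : G.Actions,
          (∏ j : Fin n, ENNReal.ofReal (hist 2 s t j (Function.update θ' i θ j) (a j))) * g (θ', a))
        (Q' := fun ω s₃ => Keep [10, 11, 12, 13, 23, 24, 25] [] s s₃ ∧
          (∀ j : Fin n, s₃.int 10 [(j : ℕ)] = Function.update ω.1 i θ j) ∧
          ∀ j : Fin n, s₃.int 12 [(j : ℕ)] = ω.2 j)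
        (fun a s₃ h => ⟨hs₂.1.trans (h.1.mono (by simp) (by simp)), fun j => by
          rw [h.1.1 10 (by norm_num) (by simp)]; exact hs₂.2 j, h.2⟩) fun g => le_rfl
      exact h1'.seq_det fun ω s₃ h => heval ω s₃ h.1 h.2.1 h.2.2
  have hso := rand_sampleOthers (κ := κ) (x := 10) (e := ic 20 []) (e' := ic 21 []) (s := s)
    (i := i) (t := θ) (by simpa using hi) (by simpa using hθ)
  refine ((hso.seq hdraws).mono ?_ fun _ _ h => h).map id (fun _ _ h => h) fun g => ?_
  · have := forCost_mono hnN (le_refl (drawCost N))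
    have := forCost_mono (hAN i) (le_refl 5)
    unfold sampleCost
    omega
  · rw [Fintype.sum_prod_type]
    refine (sum_congr rfl fun θ' _ => ?_).le
    rw [mul_sum]
    refine sum_congr rfl fun a _ => ?_
    rw [sampleWeight, mul_assoc]
    rfl

/-- The arrays that the estimation of the payoffs changes. -/
abbrev sampleCounters : List ℕ := [10, 11, 12, 13, 20, 21, 22, 23, 24, 25]

/-- The memory in the course of the estimation in round `t`, when the players and types in `P` have
been dealt with. -/
structure Estimated (G : BayesianGame n) (t : ℕ) (P : ℕ → ℕ → Prop) (s s' : State) : Prop where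
  keep : Keep sampleCounters [3, 15] s s'
  frame : ∀ l, ¬ [t] <+: l → s'.real 3 l = s.real 3 l
  done : ∀ i : Fin n, ∀ θ < G.numTypes i, ∀ b < G.numActions i, P i θ →
    0 ≤ s'.real 3 [t, i, θ, b] ∧ s'.real 3 [t, i, θ, b] ≤ 1
  todo : ∀ i : Fin n, ∀ θ < G.numTypes i, ∀ b < G.numActions i, ¬ P i θ →
    s'.real 3 [t, i, θ, b] = 0

/-- The estimates in round `t` for the players and types in `P` are accurate. -/
def AccurateOn (G : BayesianGame n) (κ : ∀ i : Fin n, Fin (G.numTypes i) → PMF G.Types) (H t : ℕ)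
    (Y : ℕ → ℕ → ℕ → ℝ) (P : ℕ → ℕ → Prop) (s : State) : Prop :=
  ∀ (i : Fin n) (θ : Fin (G.numTypes i)), P i θ → ∀ b < G.numActions i,
    |s.real 3 [t, i, θ, b] - condPayoff G κ Y i θ b| ≤ 1 / H

/-- A bound for the probability that the estimates for one player and type are inaccurate. -/
def missProb (H : ℕ) : ℝ≥0∞ :=
  H * (2 * ENNReal.ofReal (Real.exp (-((H ^ 4 : ℕ) / (4 * (H : ℝ) ^ 2)))))

lemma Estimated.congr {t : ℕ} {P P' : ℕ → ℕ → Prop} {s s' s'' : State}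
    (h : Estimated G t P s s') (hP : ∀ i : Fin n, ∀ θ < G.numTypes i, P i θ ↔ P' i θ)
    (hk : Keep sampleCounters [3, 15] s' s'') (hr : s''.real 3 = s'.real 3) :
    Estimated G t P' s s'' :=
  ⟨h.keep.trans hk, fun l hl => by rw [hr, h.frame l hl],
    fun i θ hθ b hb hp => by rw [hr]; exact h.done i θ hθ b hb ((hP i θ hθ).2 hp),
    fun i θ hθ b hb hp => by rw [hr]; exact h.todo i θ hθ b hb fun hp' => hp ((hP i θ hθ).1 hp')⟩

lemma AccurateOn.congr {H t : ℕ} {Y : ℕ → ℕ → ℕ → ℝ} {P P' : ℕ → ℕ → Prop} {s s' : State}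
    (h : AccurateOn G κ H t Y P s) (hP : ∀ i : Fin n, ∀ θ < G.numTypes i, P' i θ → P i θ)
    (hr : s'.real 3 = s.real 3) : AccurateOn G κ H t Y P' s' :=
  fun i θ hp => by rw [hr]; exact h i θ (hP i θ θ.2 hp)

/-- The estimates for one player and type. -/
lemma fail_estimate {s₀ s : State} {H k t N : ℕ} (hH : 0 < H) (hb : Base G H k s₀)
    (hc : Cumulative G k t s₀) (hY : IsProfile G (hist 2 s₀ t)) (hAH : ∀ i, G.numActions i ≤ H)
    (hAN : ∀ i, G.numActions i ≤ N) (hkN : k ≤ N) (hnN : n ≤ N) (ht : s₀.int 3 [] = t)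
    {P : ℕ → ℕ → Prop} (hs : Estimated G t P s₀ s) {i : Fin n} {θ : Fin (G.numTypes i)}
    (hi : s.int 20 [] = i) (hθ : s.int 21 [] = θ) (hP : ¬ P i θ) :
    Fail G κ (forLoop 22 powH cmdSample) s (forCost (H ^ 4) (sampleCost N))
      (fun s' => Estimated G t (fun i' θ' => P i' θ' ∨ (i' = i ∧ θ' = θ)) s₀ s' ∧
        s'.int 20 [] = i ∧ s'.int 21 [] = θ)
      (fun s' => AccurateOn G κ H t (hist 2 s₀ t) P s →
        AccurateOn G κ H t (hist 2 s₀ t) (fun i' θ' => P i' θ' ∨ (i' = i ∧ θ' = θ)) s')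
      (missProb H) := by
  set Y := hist 2 s₀ t with hYdef
  have hM : 0 < H ^ 4 := by positivity
  have hM' : (0 : ℝ) < (H ^ 4 : ℕ) := by exact_mod_cast hM
  have main : Rand G κ (forLoop 22 powH cmdSample) s (forCost (H ^ 4) (sampleCost N))
      (iterExp (sampleExp (sampleWeight G κ Y i θ) (sampleValue G i θ) (H ^ 4 : ℕ)) 0 (H ^ 4)
        fun _ => 0)
      fun acc s' => s'.int 22 [] = H ^ 4 ∧
        Keep [10, 11, 12, 13, 22, 23, 24, 25] [3, 15] s s' ∧
        (∀ b < G.numActions i, s'.real 3 [t, i, θ, b] = acc b ∧ 0 ≤ acc b ∧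
          acc b ≤ (H ^ 4 : ℕ) / (H ^ 4 : ℕ)) ∧
        ∀ l, ¬ [t, (i : ℕ), (θ : ℕ)] <+: l → s'.real 3 l = s.real 3 l := by
    refine (Rand.forLoop (fun j (acc : ℕ → ℝ) s' => s'.int 22 [] = j ∧
        Keep [10, 11, 12, 13, 22, 23, 24, 25] [3, 15] s s' ∧
        (∀ b < G.numActions i, s'.real 3 [t, i, θ, b] = acc b ∧ 0 ≤ acc b ∧
          acc b ≤ j / (H ^ 4 : ℕ)) ∧
        ∀ l, ¬ [t, (i : ℕ), (θ : ℕ)] <+: l → s'.real 3 l = s.real 3 l) _ _ _ ?_ ?_ ?_).mono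
        le_rfl fun _ _ h => h
    · rintro j acc s' ⟨h1, h2, -⟩
      refine ⟨h1, ?_⟩
      rw [eval_powH (H := H), Nat.ceil_natCast]
      rw [h2.2 4 (by norm_num) (by simp), hs.keep.2 4 (by norm_num) (by simp), hb.accuracy]
    · refine ⟨by simp, keep_setInt (by simp) _ _, fun b hbA => ?_, fun _ _ => rfl⟩
      simp [hs.todo i θ θ.2 b hbA hP]
    · rintro j acc s' hj ⟨h1, h2, h3, h4⟩
      have hk' : Keep sampleCounters [3, 15] s₀ s' := hs.keep.trans (h2.mono (by simp) (by simp))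
      have e2 : hist 2 s' t = Y := by
        funext i θ a; simp only [hYdef, hist, hk'.2 2 (by norm_num) (by simp)]
      have hsam := rand_sample (κ := κ) (N := N) (i := i) (θ := θ) (s := s') (t := t)
        (hb.keep hk' (by simp) (by simp)) (hc.congr (hk'.2 2 (by norm_num) (by simp))
        (hk'.2 14 (by norm_num) (by simp))) hAN hkN hnN
        (by rw [hk'.1 3 (by norm_num) (by simp), ht])
        (by rw [h2.1 20 (by norm_num) (by simp), hi])
        (by rw [h2.1 21 (by norm_num) (by simp), hθ])
      rw [e2] at hsam
      refine hsam.map (fun ω b => acc b + sampleValue G i θ ω b / (H ^ 4 : ℕ)) ?_ fun g => le_rfl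
      rintro ω s'' ⟨k₁, k₂, k₃⟩
      refine ⟨by simp [k₁.1 22 (by norm_num) (by simp), h1],
        (h2.trans (k₁.mono (by simp) (by simp))).trans (keep_setInt (by simp) _ _),
        fun b hbA => ?_, fun l hl => ?_⟩
      · obtain ⟨h5, h6, h7⟩ := h3 b hbA
        obtain ⟨v0, v1⟩ := sampleValue_mem i θ ω b
        refine ⟨by rw [setInt_real, k₂ b hbA, h5], by positivity, ?_⟩
        push_cast at h7 ⊢
        rw [add_div]
        gcongr
      · rw [setInt_real, k₃ l hl, h4 l hl]
  have hpre : ∀ (i' : Fin n) (θ' b : ℕ), ¬ ((i' : ℕ) = i ∧ θ' = θ) →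
      ¬ [t, (i : ℕ), (θ : ℕ)] <+: [t, (i' : ℕ), θ', b] := by
    intro i' θ' b h h'
    simp at h'
    exact h ⟨h'.1.symm, h'.2.symm⟩
  classical
  refine main.fail (fun acc => ∃ b < G.numActions i, 1 / (H : ℝ) <
    |acc b - ∑ ω, (sampleWeight G κ Y i θ ω).toReal * sampleValue G i θ ω b|) ?_ ?_ ?_
  · rintro acc s' ⟨-, h2, h3, h4⟩
    refine ⟨⟨hs.keep.trans (h2.mono (by simp) (by simp)), fun l hl => ?_,
      fun i' θ' hθ' b hbA hp => ?_,
      fun i' θ' hθ' b hbA hp => ?_⟩, by rw [h2.1 20 (by norm_num) (by simp), hi],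
      by rw [h2.1 21 (by norm_num) (by simp), hθ]⟩
    · rw [h4 l (fun h => hl (List.IsPrefix.trans (by simp) h)), hs.frame l hl]
    · by_cases he : (i' : ℕ) = i ∧ θ' = θ
      · obtain ⟨he, rfl⟩ := he
        obtain rfl := Fin.ext he
        obtain ⟨h5, h6, h7⟩ := h3 b hbA
        rw [h5]
        rw [div_self hM'.ne'] at h7
        exact ⟨h6, h7⟩
      · rw [h4 _ (hpre i' θ' b he)]
        exact hs.done i' θ' hθ' b hbA (hp.resolve_right he)
    · push Not at hp
      rw [h4 _ (hpre i' θ' b fun h => hp.2 h.1 h.2)]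
      exact hs.todo i' θ' hθ' b hbA hp.1
  · rintro acc s' ⟨-, h2, h3, h4⟩ hbad hacc i' θ' hp b hbA
    by_cases he : (i' : ℕ) = i ∧ (θ' : ℕ) = θ
    · obtain ⟨he, he'⟩ := he
      obtain rfl := Fin.ext he
      obtain rfl := Fin.ext he'
      push Not at hbad
      rw [(h3 b hbA).1]
      exact hbad b hbA
    · rw [h4 _ (hpre i' θ' b he)]
      exact hacc i' θ' (hp.resolve_right he) b hbA
  · intro r
    refine (iterExp_sample_bad_le (hY.sum_sampleWeight i θ) (fun ω b => sampleValue_mem i θ ω b) hM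
      (by exact_mod_cast hH) _ r).trans ?_
    unfold missProb
    gcongr
    exact hAH i

/-- The cost of the estimation. -/
def estimateCost (N : ℕ) : ℕ := forCost N (forCost N (forCost N (sampleCost N)))

/-- All estimates of a round. -/
lemma fail_estimates {s : State} {H k t N : ℕ} (hp : Params G H k) (hb : Base G H k s)
    (hc : Cumulative G k t s) (hY : IsProfile G (hist 2 s t)) (hHN : H ^ 4 ≤ N) (hkN : k ≤ N)
    (hnN : n ≤ N) (ht : s.int 3 [] = t)
    (h0 : ∀ i : Fin n, ∀ θ < G.numTypes i, ∀ b < G.numActions i, s.real 3 [t, i, θ, b] = 0) :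
    Fail G κ cmdEstimate s (estimateCost N)
      (fun s' => Estimated G t (fun i _ => i < n) s s')
      (fun s' => AccurateOn G κ H t (hist 2 s t) (fun i _ => i < n) s')
      (n * (H * missProb H)) := by
  have hHH : H ≤ H ^ 4 := Nat.le_self_pow (by norm_num) H
  have hΘ : ∀ i : Fin n, G.numTypes i ≤ N := fun i => ((hp.types_le i).trans hHH).trans hHN
  have hA : ∀ i : Fin n, G.numActions i ≤ N := fun i => ((hp.acts_le i).trans hHH).trans hHN
  refine (Fail.forLoop (fun i s' => Estimated G t (fun i' _ => i' < i) s s' ∧ s'.int 20 [] = i)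
    (fun i s' => AccurateOn G κ H t (hist 2 s t) (fun i' _ => i' < i) s') _ n
    (B := forCost N (forCost N (sampleCost N))) ?_ ?_ ?_ ?_).mono (forCost_mono hnN le_rfl)
    (fun s' h => h.1) (fun s' _ h => h) le_rfl
  · rintro i s' ⟨h1, h2⟩
    refine ⟨h2, ?_⟩
    rw [RExp.eval, Nat.ceil_natCast, eval_ic, List.map_nil, h1.keep.1 0 (by norm_num) (by simp),
      hb.players]
  · exact ⟨⟨keep_setInt (by simp) _ _, fun _ _ => rfl, fun _ _ _ _ _ h => absurd h (by simp),
      fun i θ hθ b hbA _ => h0 i θ hθ b hbA⟩, by simp⟩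
  · exact fun i θ h => absurd h (by simp)
  · rintro i s₁ hi ⟨h1, h2⟩
    set i₀ : Fin n := ⟨i, hi⟩ with hi₀
    refine (Fail.forLoop (fun j s' => Estimated G t (fun i' θ' => i' < i ∨ (i' = i ∧ θ' < j)) s s' ∧
      s'.int 20 [] = i ∧ s'.int 21 [] = j)
      (fun j s' => AccurateOn G κ H t (hist 2 s t) (fun i' _ => i' < i) s₁ →
        AccurateOn G κ H t (hist 2 s t) (fun i' θ' => i' < i ∨ (i' = i ∧ θ' < j)) s')
      (missProb H) (G.numTypes i₀) (B := forCost N (sampleCost N)) ?_ ?_ ?_ ?_).mono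
      (forCost_mono (hΘ i₀) le_rfl) ?_ ?_ ?_
    · rintro j s' ⟨h3, h4, h5⟩
      refine ⟨h5, ?_⟩
      rw [RExp.eval, Nat.ceil_natCast, eval_ic, List.map_singleton, eval_ic, List.map_nil, h4,
        h3.keep.1 1 (by norm_num) (by simp)]
      exact hb.types i₀
    · exact ⟨h1.congr (by simp) (keep_setInt (by simp) _ _) rfl, by simp [h2], by simp⟩
    · exact fun h => h.congr (by simp) rfl
    · rintro j s' hj ⟨h3, h4, h5⟩
      refine (fail_estimate hp.pos hb hc hY hp.acts_le hA hkN hnN ht h3 (i := i₀)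
        (θ := ⟨j, hj⟩) h4 h5 (by simp [hi₀])).mono (forCost_mono hHN le_rfl) ?_ ?_ le_rfl
      · rintro s'' ⟨h6, h7, h8⟩
        refine ⟨h6.congr (fun i' θ' _ => ?_) (keep_setInt (by simp) _ _) rfl, by simpa using h7,
          by simpa using h8⟩
        simp only [hi₀]; omega
      · rintro s'' - h6 h7 h8
        refine (h6 (h7 h8)).congr (fun i' θ' _ => ?_) rfl
        simp only [hi₀]; omega
    · rintro s' ⟨h3, h4, -⟩
      refine ⟨h3.congr (fun i' θ' hθ' => ?_) (keep_setInt (by simp) _ _) rfl, by simp [h4]⟩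
      constructor
      · omega
      · intro h
        by_cases he : (i' : ℕ) = i
        · obtain rfl : i' = i₀ := Fin.ext he
          exact Or.inr ⟨he, hθ'⟩
        · omega
    · rintro s' - h3 h4
      refine (h3 h4).congr (fun i' θ' hθ' h => ?_) rfl
      by_cases he : (i' : ℕ) = i
      · obtain rfl : i' = i₀ := Fin.ext he
        exact Or.inr ⟨he, hθ'⟩
      · omega
    · gcongr
      exact hp.types_le i₀

end Sampling

/-! ### The rounds -/

section Rounds

open Finset

/-- The rounds of the learning dynamics. -/
def cmdRounds : Cmd := forLoop 3 powH (.seq cmdStrategies cmdEstimate)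

lemma exists_poly_estimateCost : ∃ p : Polynomial ℕ, ∀ N, estimateCost N = p.eval N := by
  obtain ⟨p₁, h₁⟩ := exists_poly_forCost (f := fun _ => 3) ⟨3, by simp⟩
  obtain ⟨p₂, h₂⟩ := exists_poly_forCost (f := fun _ => 2) ⟨2, by simp⟩
  obtain ⟨p₃, h₃⟩ := exists_poly_forCost (f := drawCost) ⟨p₁ + p₂ + 5, by simp [drawCost, h₁, h₂]⟩
  obtain ⟨p₄, h₄⟩ := exists_poly_forCost (f := fun _ => 5) ⟨5, by simp⟩
  exact exists_poly_forCost (exists_poly_forCost (exists_poly_forCost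
    ⟨p₃ + p₄ + 5, by simp [sampleCost, h₃, h₄]⟩))

variable {n : ℕ} {G : BayesianGame n} {κ : ∀ i : Fin n, Fin (G.numTypes i) → PMF G.Types}

/-- The effect of a round on the invariants of the dynamics: the memory is `s` before the round,
`s'` after the computation of the strategies, and `s''` after the estimation. -/
lemma roundOK_of_estimated {H k t : ℕ} {s s' s'' : State} (ht : s.int 3 [] = t)
    (hok : ∀ r < t, RoundOK G H (hist 2 s) (hist 3 s) r)
    (hkeep : ∀ l, ¬ [t] <+: l → s'.real 2 l = s.real 2 l ∧ s'.real 3 l = s.real 3 l)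
    (hspec : Cumulative G k t s' ∧ IsProfile G (hist 2 s' t) ∧
      ∀ i : Fin n, ∀ θ < G.numTypes i, ∑ a ∈ range (G.numActions i),
      |app (G.numTypes i) (G.numActions i) (wtKernel (G.numTypes i) (G.numActions i)
        (wt H (fun r => hist 2 s' r i) (fun r => hist 3 s' r i) t))
        (hist 2 s' t i) θ a - hist 2 s' t i θ a| ≤ 4 / H)
    (hest : Estimated G t (fun i _ => i < n) s' s'') {r : ℕ} (hr : r < t + 1) :
    RoundOK G H (hist 2 s'') (hist 3 s'') r := by
  have e2 : hist 2 s'' = hist 2 s' := by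
    funext r i θ a; simp only [hist, hest.keep.2 2 (by norm_num) (by simp)]
  have e3 : ∀ r < t, hist 3 s'' r = hist 3 s' r := fun r hr => hist_congr hest.frame hr.ne
  rcases Nat.lt_succ_iff_lt_or_eq.1 hr with hr | rfl
  · refine (hok r hr).congr fun q hq => ⟨?_, ?_⟩
    · rw [e2, hist_congr (fun l hl => (hkeep l hl).1) (by omega)]
    · rw [e3 q (by omega), hist_congr (fun l hl => (hkeep l hl).2) (by omega)]
  · refine ⟨by rw [e2]; exact hspec.2.1, fun i θ hθ a ha => hest.done i θ hθ a ha i.2, fun i => ?_⟩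
    have e : wt H (fun q => hist 2 s'' q i) (fun q => hist 3 s'' q i) r =
        wt H (fun q => hist 2 s' q i) (fun q => hist 3 s' q i) r :=
      wt_congr fun q hq => ⟨by rw [e2], by rw [e3 q hq]⟩
    rw [e, e2]
    exact hspec.2.2 i

lemma accurate_of_accurateOn {H t : ℕ} {s s' s'' : State}
    (hac : ∀ r < t, Accurate G κ H (hist 2 s) (hist 3 s) r)
    (hkeep : ∀ l, ¬ [t] <+: l → s'.real 2 l = s.real 2 l ∧ s'.real 3 l = s.real 3 l)
    (hest : Estimated G t (fun i _ => i < n) s' s'')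
    (hnew : AccurateOn G κ H t (hist 2 s' t) (fun i _ => i < n) s'') {r : ℕ} (hr : r < t + 1) :
    Accurate G κ H (hist 2 s'') (hist 3 s'') r := by
  have e2 : hist 2 s'' = hist 2 s' := by
    funext r i θ a; simp only [hist, hest.keep.2 2 (by norm_num) (by simp)]
  rcases Nat.lt_succ_iff_lt_or_eq.1 hr with hr | rfl
  · intro i θ a ha
    have := hac r hr i θ a ha
    rwa [e2, hist_congr hest.frame hr.ne, hist_congr (fun l hl => (hkeep l hl).2) hr.ne,
      hist_congr (fun l hl => (hkeep l hl).1) hr.ne]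
  · intro i θ a ha
    rw [e2]
    exact hnew i θ i.2 a ha

/-- The dynamics takes polynomial time. It certainly plays almost invariant strategies, and it is
likely that all its estimates are accurate. -/
lemma exists_poly_rounds : ∃ p : Polynomial ℕ, ∀ {n : ℕ} {G : BayesianGame n}
    {κ : ∀ i : Fin n, Fin (G.numTypes i) → PMF G.Types} {N H k : ℕ} {s : State},
    Params G H k → Base G H k s → Small N s → H ^ 4 ≤ N → k ≤ N → n ≤ N →
    Fail G κ cmdRounds s (p.eval N)
      (fun s' => s'.int 3 [] = H ^ 4 ∧ ∀ r < H ^ 4, RoundOK G H (hist 2 s') (hist 3 s') r)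
      (fun s' => ∀ r < H ^ 4, Accurate G κ H (hist 2 s') (hist 3 s') r)
      ((H ^ 4 : ℕ) * (n * (H * missProb H))) := by
  obtain ⟨q, hq⟩ := polyDet_strategies
  obtain ⟨q', hq'⟩ := exists_poly_estimateCost
  refine ⟨.X * (q + q' + 1 + 3) + 3, fun {n G κ N H k s} hp hb hs hHN hkN hnN => ?_⟩
  refine (Fail.forLoop (B := q.eval N + estimateCost N + 1) (fun t s' => s'.int 3 [] = t ∧
    Small N s' ∧ Base G H k s' ∧ ∀ r < t, RoundOK G H (hist 2 s') (hist 3 s') r)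
    (fun t s' => ∀ r < t, Accurate G κ H (hist 2 s') (hist 3 s') r) _ (H ^ 4) ?_ ?_ ?_ ?_).mono
    ?_ (fun s' h => ⟨h.1, h.2.2.2⟩) (fun s' _ h => h) le_rfl
  · rintro t s' ⟨h1, -, h2, -⟩
    exact ⟨h1, by rw [eval_powH h2.accuracy, Nat.ceil_natCast]⟩
  · refine ⟨by simp, ?_, ?_, by simp⟩
    · obtain ⟨h1, h2, h3, h4, h5, h6⟩ := hs
      exact ⟨by simpa using h1, by simpa using h2, by simpa using h3, by simp, by simpa using h5,
        by simpa using h6⟩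
    · exact hb.keep (keep_setInt (I := [3]) (R := []) (by simp) _ _) (by simp) (by simp)
  · simp
  · rintro t s₀ ht ⟨h1, h2, h3, h4⟩
    refine Det.seq_fail (hq h2) fun s' ⟨hk, hkeep, hcum, hplay⟩ => ?_
    have hspec := strategies_spec hp h3 (s' := s') (by rwa [h1]) hkeep hcum hplay
    rw [h1] at hspec hkeep hplay
    have h3' : Base G H k s' := h3.keep hk (by simp) (by simp)
    have h1' : s'.int 3 [] = t := by rw [hk.1 3 (by norm_num) (by simp), h1]
    have h2' : Small N s' := hk.small h2 (by simp) (by simp)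
    refine (fail_estimates hp h3' hspec.1 hspec.2.1 hHN hkN hnN h1' fun i θ hθ b hbA =>
      (hplay i θ b ⟨by rw [h3.players]; exact i.2, by rwa [h3.types], by rwa [h3.acts]⟩).1).mono
      le_rfl ?_ ?_ le_rfl
    · intro s'' h5
      have h3'' : Base G H k s'' := h3'.keep h5.keep (by simp) (by simp)
      have h2'' : Small N s'' := h5.keep.small h2' (by simp) (by simp)
      have e3 : s''.int 3 [] = t := by rw [h5.keep.1 3 (by norm_num) (by simp), h1']
      refine ⟨by simp [e3], ?_, ?_, fun r hr => ?_⟩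
      · obtain ⟨g1, g2, g3, g4, g5, g6⟩ := h2''
        exact ⟨by simpa using g1, by simpa using g2, by simpa using g3, by simp [e3]; omega,
          by simpa using g5, by simpa using g6⟩
      · exact h3''.keep (keep_setInt (I := [3]) (R := []) (by simp) _ _) (by simp) (by simp)
      · exact roundOK_of_estimated h1 h4 hkeep hspec h5 hr
    · intro s'' h5 h6 h7 r hr
      exact accurate_of_accurateOn h7 hkeep h5 h6 hr
  · have := Nat.mul_le_mul_right (q.eval N + q'.eval N + 1 + 3) hHN
    simp only [forCost, Polynomial.eval_add, Polynomial.eval_mul, Polynomial.eval_X,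
      Polynomial.eval_ofNat, Polynomial.eval_one, hq']
    omega

end Rounds

/-! ### Choice of the parameters -/

section Setup

open Finset

/-- Compute the least power of two that is at least `b` into the real scalar `x`, and its exponent
into the natural-number scalar `x`. -/
def cmdPow (x : ℕ) (b : RExp) : Cmd :=
  .seq (asgReal x [] (.ofInt (.lit 1))) (.seq (asgInt x [] (.lit 0))
    (.loop (.realLt (rc x []) b) (.seq (asgReal x [] (.add (rc x []) (rc x [])))
      (asgInt x [] (.add (ic x []) (.lit 1))))))

/-- The total number of types and actions of the players. -/
def sizeExp : BigExp := .sum .players (.base (.ofInt (.add (ic 1 [ctr 0]) (ic 2 [ctr 0]))))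

/-- The choice of the accuracy parameter (real scalar `4`) and the number of grid points (real
scalar `6`). The empty loop computes `⌈16 / ε⌉`. -/
def cmdSetup : Cmd :=
  .seq (forLoop 4 (.div (.ofInt (.lit 16)) (rc 0 [])) (asgInt 11 [] (.lit 0)))
  (.seq (cmdPow 5 (.div (.ofInt (.lit 1)) (rc 1 [])))
  (.seq (sizeExp.compile 100)
  (.seq (asgReal 4 [] (.add (rc 100 []) (.ofInt (.add (.add (.lit 64) (ic 0 []))
    (.add (ic 4 []) (ic 5 []))))))
    (cmdPow 6 (.mul (rc 4 []) (rc 4 []))))))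

variable {n : ℕ} {G : BayesianGame n} {κ : ∀ i : Fin n, Fin (G.numTypes i) → PMF G.Types}

/-- The exponent `N` is the least one with `β ≤ 2 ^ N`, where `β` is the value of the bound `b`. -/
lemma det_pow {x N : ℕ} {b : RExp} {β : ℝ} {s : State}
    (hb : ∀ s', Keep [x] [x] s s' → b.eval s' = β) (h1 : β ≤ 2 ^ N) (h2 : ∀ j < N, 2 ^ j < β) :
    Det G κ (cmdPow x b) s (N * 4 + 5)
      fun s' => Keep [x] [x] s s' ∧ s'.int x [] = N ∧ s'.real x [] = ((2 ^ N : ℕ) : ℝ) := by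
  refine (Det.seq (B₁ := 1) (B₂ := 1 + (N * 4 + 1) + 1)
    (Q := fun s' => Keep [x] [x] s s' ∧ s'.real x [] = 1)
    (det_asgReal ⟨keep_setReal (by simp) _ _, by simp [RExp.eval, IExp.eval]⟩) ?_).mono
    (by omega) fun _ h => h
  rintro s₁ ⟨k₁, r₁⟩
  refine Det.seq (Q := fun s' => Keep [x] [x] s s' ∧ s'.real x [] = 1 ∧ s'.int x [] = 0)
    (det_asgInt ⟨k₁.trans (keep_setInt (by simp) _ _), by simp [r₁], by simp [IExp.eval]⟩) ?_
  rintro s₂ ⟨k₂, r₂, i₂⟩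
  refine (Det.loop (B := 3) (N := N) (fun j s' => Keep [x] [x] s s' ∧ s'.real x [] = 2 ^ j ∧
    s'.int x [] = j ∧ j ≤ N) ?_ ⟨k₂, by simp [r₂], i₂, Nat.zero_le _⟩).mono (by omega) ?_
  · rintro j s' ⟨h3, h4, h5, h6⟩ hh
    simp only [Test.holds, eval_rc, List.map_nil, h4, hb s' h3] at hh
    have hj : j < N := by
      by_contra hj
      obtain rfl : j = N := by omega
      linarith
    refine ⟨hj, Det.seq (B₁ := 1) (B₂ := 1) (Q := fun s'' => Keep [x] [x] s s'' ∧
      s''.real x [] = 2 ^ (j + 1) ∧ s''.int x [] = j)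
      (det_asgReal ⟨h3.trans (keep_setReal (by simp) _ _), ?_, by simp [h5]⟩) ?_⟩
    · simp [RExp.eval, h4]; ring
    · rintro s'' ⟨h7, h8, h9⟩
      exact det_asgInt ⟨h7.trans (keep_setInt (by simp) _ _), by simp [h8], by simp [IExp.eval, h9],
        hj⟩
  · rintro s' ⟨j, ⟨h3, h4, h5, h6⟩, hh⟩
    simp only [Test.holds, eval_rc, List.map_nil, h4, hb s' h3, not_lt] at hh
    have hj : j = N := by
      by_contra hj
      have := h2 j (by omega)
      linarith
    subst hj
    exact ⟨h3, h5, by rw [h4]; push_cast; rfl⟩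

lemma exists_least_pow (β : ℝ) : ∃ N : ℕ, β ≤ 2 ^ N ∧ ∀ j < N, 2 ^ j < β := by
  classical
  have h : ∃ N : ℕ, β ≤ 2 ^ N := (pow_unbounded_of_one_lt β one_lt_two).imp fun _ h => h.le
  exact ⟨Nat.find h, Nat.find_spec h, fun j hj => not_le.1 (Nat.find_min h hj)⟩

/-- The accuracy parameter: it dominates the size of the game, `16 / ε` and the exponent `L` of a
power of two that is at least `1 / δ`. -/
def accuracy (G : BayesianGame n) (ε : ℝ) (L : ℕ) : ℕ :=
  ∑ i, (G.numTypes i + G.numActions i) + (64 + n + (⌈16 / ε⌉₊ + L))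

lemma accuracy_ge (G : BayesianGame n) (ε : ℝ) (L : ℕ) : 64 ≤ accuracy G ε L ∧
    n ≤ accuracy G ε L ∧ ⌈16 / ε⌉₊ ≤ accuracy G ε L ∧ L ≤ accuracy G ε L ∧
    ∀ i, G.numTypes i + G.numActions i ≤ accuracy G ε L := by
  unfold accuracy
  refine ⟨by omega, by omega, by omega, by omega, fun i => ?_⟩
  have := single_le_sum (f := fun i => G.numTypes i + G.numActions i) (fun _ _ => Nat.zero_le _)
    (mem_univ i)
  omega

/-- The machine finds suitable parameters in polynomial time. -/
lemma exists_poly_setup : ∃ p : Polynomial ℕ, ∀ {n : ℕ} {G : BayesianGame n}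
    {κ : ∀ i : Fin n, Fin (G.numTypes i) → PMF G.Types} {ε δ : ℝ} {L k : ℕ},
    1 / δ ≤ 2 ^ L → (∀ j < L, 2 ^ j < 1 / δ) →
    (accuracy G ε L : ℝ) * accuracy G ε L ≤ 2 ^ k →
    (∀ j < k, 2 ^ j < (accuracy G ε L : ℝ) * accuracy G ε L) →
    k ≤ accuracy G ε L ^ 4 → 2 ^ k ≤ accuracy G ε L ^ 4 →
    Det G κ cmdSetup (inputState G ε δ) (p.eval (accuracy G ε L ^ 4)) fun s =>
      Base G (accuracy G ε L) k s ∧ Small (accuracy G ε L ^ 4) s := by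
  obtain ⟨q, hq⟩ := sizeExp.exists_poly_cost
  obtain ⟨q', hq'⟩ := exists_poly_forCost (f := fun _ => 1) ⟨1, by simp⟩
  refine ⟨q' + .X * 4 + q + .X * 4 + 15, fun {n G κ ε δ L k} hL hL' hk hk' hkN hKN => ?_⟩
  obtain ⟨g1, g2, g3, g4, g5⟩ := accuracy_ge G ε L
  set H := accuracy G ε L with hH
  have hHH : H ≤ H ^ 4 := Nat.le_self_pow (by norm_num) H
  have hHpos : 1 ≤ H := by omega
  set N := H ^ 4 with hN
  set s₀ := inputState G ε δ with hs₀
  have hsmall : Small N s₀ := by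
    refine ⟨fun l => ?_, fun l => ?_, ?_, ?_, ?_, ?_⟩
    · simp only [hs₀, inputState]
      split <;> try simp_all
      split_ifs with h
      · have := g5 ⟨_, h⟩; omega
      · omega
    · simp only [hs₀, inputState]
      split <;> try simp_all <;> try omega
      split_ifs with h
      · have := g5 ⟨_, h⟩
        have : 0 < G.numTypes ⟨_, h⟩ := Fin.pos (G.prior.support_nonempty.some ⟨_, h⟩)
        omega
      · omega
    · simp only [hs₀, inputState]; omega
    · simp [hs₀, inputState]
    · simp [hs₀, inputState]
    · simp [hs₀, inputState]
  have step1 : Det G κ (forLoop 4 (.div (.ofInt (.lit 16)) (rc 0 [])) (asgInt 11 [] (.lit 0))) s₀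
      (forCost N 1) fun s => Keep [4, 5, 11] [5] s₀ s ∧ s.int 4 [] = ⌈16 / ε⌉₊ := by
    refine (Det.forLoop (fun j s => Keep [4, 5, 11] [5] s₀ s ∧ s.int 4 [] = j) ⌈16 / ε⌉₊ ?_ ?_
      ?_).mono (forCost_mono (g3.trans hHH) le_rfl) fun _ h => h
    · rintro j s ⟨h1, h2⟩
      refine ⟨h2, ?_⟩
      simp [RExp.eval, IExp.eval, h1.2 0 (by norm_num) (by simp), hs₀, inputState]
    · exact ⟨keep_setInt (by simp) _ _, by simp⟩
    · rintro j s - ⟨h1, h2⟩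
      exact det_asgInt ⟨(h1.trans (keep_setInt (by simp) _ _)).trans (keep_setInt (by simp) _ _),
        by simp [h2]⟩
  refine (Det.seq step1 (B₂ := (L * 4 + 5) + (sizeExp.cost N + (1 + (k * 4 + 5) + 1) + 1) + 1)
    ?_).mono ?_ fun _ h => h
  swap
  · simp only [Polynomial.eval_add, Polynomial.eval_mul, Polynomial.eval_X, Polynomial.eval_ofNat,
      ← hq, ← hq']
    omega
  rintro s₁ ⟨k₁, h₁⟩
  refine Det.seq (Q := fun s => Keep [4, 5, 11] [5] s₀ s ∧ s.int 4 [] = ⌈16 / ε⌉₊ ∧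
    s.int 5 [] = L) ((det_pow (N := L) (β := 1 / δ) ?_ hL hL').mono le_rfl ?_) ?_
  · intro s h
    have : s.real 1 = s₀.real 1 := by
      rw [h.2 1 (by norm_num) (by simp), k₁.2 1 (by norm_num) (by simp)]
    simp [RExp.eval, IExp.eval, this, hs₀, inputState]
  · rintro s ⟨h2, h3, -⟩
    exact ⟨k₁.trans (h2.mono (by simp) (by simp)), by rw [h2.1 4 (by norm_num) (by simp), h₁], h3⟩
  rintro s₂ ⟨k₂, h₂, h₂'⟩
  refine Det.seq (sizeExp.det_compile (x := 0) (N := N) (by norm_num) le_rfl ?_ s₂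
    (k₂.small hsmall (by simp) (by simp))) ?_
  · simp [sizeExp, BigExp.Low, Bd.Low, RExp.Low, IExp.Low, ic_low]
  rintro s₃ ⟨k₃, h₃⟩
  have k₃' : Keep [4, 5, 11] [5] s₀ s₃ := k₂.trans
    ⟨fun y hy _ => k₃.1.eq hy, fun y hy _ => k₃.2 y hy⟩
  have i0 : s₂.int 0 [] = n := by rw [k₂.1 0 (by norm_num) (by simp)]; rfl
  have i1 : ∀ i : Fin n, s₂.int 1 [(i : ℕ)] = G.numTypes i := fun i => by
    rw [k₂.1 1 (by norm_num) (by simp)]; simp [hs₀, inputState]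
  have i2 : ∀ i : Fin n, s₂.int 2 [(i : ℕ)] = G.numActions i := fun i => by
    rw [k₂.1 2 (by norm_num) (by simp)]; simp [hs₀, inputState]
  have hsum : s₃.real 100 [] = ∑ i, ((G.numTypes i : ℝ) + G.numActions i) := by
    rw [h₃]
    simp only [sizeExp, BigExp.val, Bd.card_players, i0, RExp.eval, IExp.eval, sum_range]
    refine sum_congr rfl fun i _ => ?_
    simp [i1, i2]
  refine Det.seq (Q := fun s => Keep [4, 5, 11] [4, 5] s₀ s ∧ s.real 4 [] = H) (det_asgReal
    ⟨(k₃'.mono (by simp) (by simp)).trans (keep_setReal (by simp) _ _), ?_⟩) ?_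
  · have e0 : s₃.int 0 [] = n := by rw [k₃.1.eq (by norm_num), i0]
    have e4 : s₃.int 4 [] = ⌈16 / ε⌉₊ := by rw [k₃.1.eq (by norm_num), h₂]
    have e5 : s₃.int 5 [] = L := by rw [k₃.1.eq (by norm_num), h₂']
    simp only [setReal_real, List.map_nil, and_self, if_true, RExp.eval, eval_rc, hsum, IExp.eval,
      eval_ic, e0, e4, e5, hH, accuracy]
    push_cast
    rfl
  rintro s₄ ⟨k₄, h₄⟩
  refine (det_pow (N := k) (β := (H : ℝ) * H) ?_ hk hk').mono le_rfl ?_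
  · intro s h
    simp only [RExp.eval, eval_rc, List.map_nil, h.2 4 (by norm_num) (by simp), h₄]
  rintro s ⟨h5, h6, h7⟩
  have k₅ : Keep [4, 5, 6, 11] [4, 5, 6] s₀ s :=
    (k₄.mono (by simp) (by simp)).trans (h5.mono (by simp) (by simp))
  have r4 : s.real 4 [] = H := by rw [h5.2 4 (by norm_num) (by simp), h₄]
  refine ⟨⟨?_, ?_, ?_, r4, h6, h7⟩, ?_⟩
  · rw [k₅.1 0 (by norm_num) (by simp)]; rfl
  · intro i; rw [k₅.1 1 (by norm_num) (by simp)]; simp [hs₀, inputState]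
  · intro i; rw [k₅.1 2 (by norm_num) (by simp)]; simp [hs₀, inputState]
  · obtain ⟨f1, f2, f3, f4, -, -⟩ := hsmall
    refine ⟨?_, ?_, ?_, ?_, ?_, ?_⟩
    · rwa [k₅.1 1 (by norm_num) (by simp)]
    · rwa [k₅.1 2 (by norm_num) (by simp)]
    · rwa [k₅.1 0 (by norm_num) (by simp)]
    · rwa [k₅.1 3 (by norm_num) (by simp)]
    · rw [r4]; exact_mod_cast hHH
    · rw [h7]; exact_mod_cast hKN

end Setup

/-! ### Success probability and running time -/

section Final

open Finset

/-- The algorithm. -/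
def cmdMain : Cmd := .seq cmdSetup cmdRounds

variable {n : ℕ} {G : BayesianGame n} {κ : ∀ i : Fin n, Fin (G.numTypes i) → PMF G.Types}

/-- The union bound over all rounds, players and types. -/
lemma total_missProb_le {H L : ℕ} {δ : ℝ} (hδ : 0 < δ) (hn : n ≤ H) (hH : 64 ≤ H) (hLH : L ≤ H)
    (hL : 1 / δ ≤ 2 ^ L) :
    ((H ^ 4 : ℕ) : ℝ≥0∞) * (n * (H * missProb H)) ≤ ENNReal.ofReal δ := by
  have hH' : (64 : ℝ) ≤ H := by exact_mod_cast hH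
  have hH0 : (0 : ℝ) < H := by linarith
  have hexp : ((H ^ 4 : ℕ) : ℝ) / (4 * (H : ℝ) ^ 2) = (H : ℝ) ^ 2 / 4 := by
    push_cast; field_simp
  have h1 : (H : ℝ) ≤ Real.exp H := (by linarith [Real.add_one_le_exp (H : ℝ)])
  have h2 : (2 : ℝ) ≤ Real.exp 1 := (by linarith [Real.add_one_le_exp (1 : ℝ)])
  have h3 : (2 : ℝ) ≤ Real.exp H := by linarith
  -- the left-hand side is at most `2 * H ^ 7 * exp (- H ^ 2 / 4)`
  have key : 2 * (H : ℝ) ^ 7 * Real.exp (-((H : ℝ) ^ 2 / 4)) ≤ δ := by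
    calc 2 * (H : ℝ) ^ 7 * Real.exp (-((H : ℝ) ^ 2 / 4))
        ≤ Real.exp H * Real.exp H ^ 7 * Real.exp (-(9 * H)) := by
          gcongr
          nlinarith
      _ = Real.exp (-H) := by
          rw [← Real.exp_nat_mul, ← Real.exp_add, ← Real.exp_add]
          congr 1; push_cast; ring
      _ ≤ δ := by
          rw [Real.exp_neg, inv_le_comm₀ (Real.exp_pos _) hδ, ← one_div]
          calc 1 / δ ≤ 2 ^ L := hL
            _ ≤ 2 ^ H := pow_le_pow_right₀ (by norm_num) hLH
            _ ≤ Real.exp 1 ^ H := by gcongr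
            _ = Real.exp H := by rw [← Real.exp_nat_mul, mul_one]
  refine le_trans ?_ (ENNReal.ofReal_le_ofReal key)
  rw [missProb, hexp]
  calc ((H ^ 4 : ℕ) : ℝ≥0∞) * (n * (H * (H * (2 * ENNReal.ofReal (Real.exp (-((H : ℝ) ^ 2 / 4)))))))
      ≤ ((H ^ 4 : ℕ) : ℝ≥0∞) *
        (H * (H * (H * (2 * ENNReal.ofReal (Real.exp (-((H : ℝ) ^ 2 / 4))))))) := by gcongr
    _ = ENNReal.ofReal (2 * (H : ℝ) ^ 7 * Real.exp (-((H : ℝ) ^ 2 / 4))) := by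
        rw [ENNReal.ofReal_mul (by positivity), ENNReal.ofReal_mul (by norm_num),
          ENNReal.ofReal_pow hH0.le, ENNReal.ofReal_natCast, ENNReal.ofReal_ofNat]
        push_cast
        ring

/-- The rounds output the mixture of the played profiles. -/
lemma succeeds_of_rounds (hκ : G.IsConditionalSampler κ) {H : ℕ} (hH : 0 < H) {ε : ℝ} (hε : 0 < ε)
    (hHε : 16 / ε ≤ H) (hsize : ∀ i : Fin n, G.numTypes i ≤ H ∧ G.numActions i ≤ H) {s : State}
    (hT : s.int 3 [] = H ^ 4) (hr : ∀ r < H ^ 4, RoundOK G H (hist 2 s) (hist 3 s) r)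
    (ha : ∀ r < H ^ 4, Accurate G κ H (hist 2 s) (hist 3 s) r) : Succeeds G ε ([], s) := by
  have hH4 : 0 < H ^ 4 := by positivity
  refine ⟨rfl, mixture G (H ^ 4) (hist 2 s), ⟨by rw [hT]; exact hH4, fun t ht i θ => ?_,
    fun θ a => by rw [hT]; rfl⟩, isApproxCommEq_of_rounds hκ hH hε hHε hsize hr ha,
    strategyRepresentable_mixture hH4 fun t ht => (hr t ht).profile⟩
  have hprof := (hr t (by rwa [← hT])).profile
  exact ⟨fun a => hprof.nonneg i θ a, hprof.sum_eq i θ⟩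

/-- A program that fails with probability at most `p` halts within its step bound in every
execution, and reaches a good memory with probability at least `1 - p`. -/
lemma Fail.run {c : Cmd} {s : State} {B : ℕ} {Q R : State → Prop} {p : ℝ≥0∞}
    (h : Fail G κ c s B Q R p) (hp : p ≠ ⊤) {S : Set Config}
    (hS : ∀ s', Q s' → R s' → (([], s') : Config) ∈ S) :
    (∀ d ∈ (CommEq.run G κ B ([c], s)).support, d.1 = []) ∧
      1 - p ≤ (CommEq.run G κ B ([c], s)).toOuterMeasure S := by
  classical
  set μ := CommEq.run G κ B ([c], s) with hμ
  set F : Config → ℝ≥0∞ := fun d => if d.1 ≠ [] then ⊤ else if d ∈ S then 0 else 1 with hF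
  have hE : mean μ F ≤ p := by
    have h1 := le_wp (G := G) (κ := κ) (c := c) (s := s) (B := B) (f := fun s' => F ([], s')) [] F B
      le_rfl fun τ' s' _ => (expect_nil G κ τ' s' F).le
    refine h1.trans ((h _ 0 (fun s' _ => ?_) fun s' hq hr => ?_).trans (zero_add p).le)
    · simp only [hF]; split_ifs <;> simp_all
    · simp [hF, hS s' hq hr]
  refine ⟨fun d hd => ?_, ?_⟩
  · by_contra hne
    have h1 : μ d * F d ≤ mean μ F := ENNReal.le_tsum d
    have h2 : μ d * F d = ⊤ := by
      simp only [hF, if_pos hne]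
      exact ENNReal.mul_top ((PMF.mem_support_iff _ _).1 hd)
    rw [h2] at h1
    exact hp (top_le_iff.1 (h1.trans hE))
  · rw [tsub_le_iff_right, PMF.toOuterMeasure_apply, ← μ.tsum_coe]
    refine le_trans ?_ (add_le_add_right hE _)
    rw [mean, ← ENNReal.tsum_add]
    refine ENNReal.tsum_le_tsum fun d => ?_
    by_cases hd : d ∈ S
    · rw [Set.indicator_of_mem hd]
      exact le_self_add
    · rw [Set.indicator_of_notMem hd, zero_add]
      refine le_mul_of_one_le_right (by simp) ?_
      simp only [hF]
      split_ifs <;> simp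

/-- Polynomials with coefficients in the naturals are monotone. -/
lemma eval_le_aeval (r : Polynomial ℕ) {H : ℕ} {x : ℝ} (hx : (H : ℝ) ≤ x) :
    ((r.eval H : ℕ) : ℝ) ≤ Polynomial.aeval x r := by
  rw [Polynomial.eval_eq_sum_range, Polynomial.aeval_eq_sum_range]
  push_cast
  refine sum_le_sum fun i _ => ?_
  rw [nsmul_eq_mul]
  gcongr

/-- The accuracy parameter is bounded by a linear polynomial in `n * max Θ`, `n * max A`, `1 / ε`
and `log (1 / δ)`. -/
lemma accuracy_le {ε δ : ℝ} (hε : 0 < ε) (hδ : 0 < δ) (hδ1 : δ < 1) {L : ℕ}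
    (hL : ∀ j < L, 2 ^ j < 1 / δ) :
    (accuracy G ε L : ℝ) ≤ 66 + n + n * (((univ.sup G.numTypes : ℕ) : ℝ) +
      ((univ.sup G.numActions : ℕ) : ℝ)) + 16 * (1 / ε) + 2 * Real.log (1 / δ) := by
  have h1 : ∑ i, (G.numTypes i + G.numActions i) ≤
      n * (univ.sup G.numTypes + univ.sup G.numActions) := by
    refine (sum_le_card_nsmul univ _ (univ.sup G.numTypes + univ.sup G.numActions)
      fun i _ => ?_).trans (by simp)
    exact add_le_add (le_sup (f := G.numTypes) (mem_univ i))
      (le_sup (f := G.numActions) (mem_univ i))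
  have h1' : ((∑ i, (G.numTypes i + G.numActions i) : ℕ) : ℝ) ≤
      n * (((univ.sup G.numTypes : ℕ) : ℝ) + ((univ.sup G.numActions : ℕ) : ℝ)) := by
    exact_mod_cast h1
  have h2 : (⌈16 / ε⌉₊ : ℝ) ≤ 16 * (1 / ε) + 1 := by
    have := Nat.ceil_lt_add_one (show 0 ≤ 16 / ε by positivity)
    rw [mul_one_div]
    exact this.le
  have h3 : (L : ℝ) ≤ 1 + 2 * Real.log (1 / δ) := by
    have hlog : 0 ≤ Real.log (1 / δ) := Real.log_nonneg (by rw [le_div_iff₀ hδ]; linarith)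
    rcases Nat.eq_zero_or_pos L with rfl | hpos
    · rw [Nat.cast_zero]; linarith
    · have h4 := hL (L - 1) (by omega)
      have h5 := Real.log_lt_log (by positivity) h4
      rw [Real.log_pow, Nat.cast_pred hpos] at h5
      have h6 : (1 : ℝ) ≤ L := by exact_mod_cast hpos
      have h7 := Real.log_two_gt_d9
      nlinarith
  rw [accuracy, Nat.cast_add]
  push_cast at h1' h2 ⊢
  linarith

end Final

end CommEq

end

theorem mainTheorem4 :
    ∃ (prog : CommEq.Cmd) (P : MvPolynomial (Fin 5) ℕ),
      ∀ (n : ℕ) (_ : 0 < n) (G : CommEq.BayesianGame n)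
        (κ : ∀ i : Fin n, Fin (G.numTypes i) → PMF G.Types) (_ : G.IsConditionalSampler κ)
        (ε δ : ℝ) (_ : 0 < ε) (_ : 0 < δ) (_ : δ < 1),
        ∃ τ : ℕ,
          (τ : ℝ) ≤ MvPolynomial.aeval
            ![(n : ℝ), ((Finset.univ.sup G.numTypes : ℕ) : ℝ),
              ((Finset.univ.sup G.numActions : ℕ) : ℝ), 1 / ε, Real.log (1 / δ)] P ∧
          (∀ c ∈ (CommEq.run G κ τ ([prog], CommEq.inputState G ε δ)).support, c.1 = []) ∧
          ENNReal.ofReal (1 - δ) ≤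
            (CommEq.run G κ τ ([prog], CommEq.inputState G ε δ)).toOuterMeasure
              {c | CommEq.Succeeds G ε c} := by
  obtain ⟨p, hp⟩ := CommEq.exists_poly_setup
  obtain ⟨q, hq⟩ := CommEq.exists_poly_rounds
  set r : Polynomial ℕ := (p + q + 1).comp (.X ^ 4) with hr
  set W : MvPolynomial (Fin 5) ℕ :=
    66 + .X 0 + .X 0 * (.X 1 + .X 2) + 16 * .X 3 + 2 * .X 4 with hW
  refine ⟨CommEq.cmdMain, Polynomial.aeval W r, fun n _ G κ hκ ε δ hε hδ hδ1 => ?_⟩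
  obtain ⟨L, hL, hL'⟩ := CommEq.exists_least_pow (1 / δ)
  set H := CommEq.accuracy G ε L with hH
  obtain ⟨g1, g2, g3, g4, g5⟩ := CommEq.accuracy_ge G ε L
  rw [← hH] at g1 g2 g3 g4 g5
  obtain ⟨k, hk, hk'⟩ := CommEq.exists_least_pow ((H : ℝ) * H)
  have hHH : H ≤ H ^ 4 := Nat.le_self_pow (by norm_num) H
  have hK : 2 ^ k ≤ H ^ 4 := by
    rcases Nat.eq_zero_or_pos k with rfl | hpos
    · simp; exact Nat.one_le_pow _ _ (by omega)
    · have h1 : 2 ^ (k - 1) < H * H := by exact_mod_cast hk' (k - 1) (by omega)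
      have h2 : 2 ^ k = 2 * 2 ^ (k - 1) := by rw [← pow_succ']; congr 1; omega
      have h3 : 2 * (H * H) ≤ H ^ 4 := by nlinarith [Nat.mul_le_mul g1 g1]
      omega
  have hkN : k ≤ H ^ 4 := (Nat.lt_two_pow_self).le.trans hK
  have hparams : CommEq.Params G H k := by
    refine ⟨by omega, fun i => ?_, fun i => ?_, ?_⟩
    · have := g5 i; omega
    · have := g5 i; omega
    · rw [sq]; exact_mod_cast hk
  have hδ' : ((H ^ 4 : ℕ) : ENNReal) * (n * (H * CommEq.missProb H)) ≤ ENNReal.ofReal δ :=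
    CommEq.total_missProb_le hδ g2 g1 g4 hL
  have hrun := ((hp (κ := κ) hL hL' hk hk' hkN hK).seq_fail fun s hs =>
    hq (κ := κ) hparams hs.1 hs.2 le_rfl hkN (g2.trans hHH)).run
    (ne_top_of_le_ne_top ENNReal.ofReal_ne_top hδ') (S := {c | CommEq.Succeeds G ε c})
    fun s hs ha => CommEq.succeeds_of_rounds hκ (by omega) hε
      ((Nat.le_ceil _).trans (by exact_mod_cast g3)) (fun i => by have := g5 i; omega) hs.1 hs.2 ha
  refine ⟨p.eval (H ^ 4) + q.eval (H ^ 4) + 1, ?_, hrun.1, ?_⟩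
  · have h1 : p.eval (H ^ 4) + q.eval (H ^ 4) + 1 = r.eval H := by simp [hr]
    rw [h1, ← Polynomial.aeval_algHom_apply]
    refine CommEq.eval_le_aeval r ((CommEq.accuracy_le hε hδ hδ1 hL').trans (le_of_eq ?_))
    simp [hW]
  · refine le_trans ?_ hrun.2
    rw [ENNReal.ofReal_sub _ hδ.le, ENNReal.ofReal_one]
    exact tsub_le_tsub_left hδ' 1
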